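/- Let $M$ be a smooth manifold of dimension $n>2$ with a conformal class $[g]$ of pseudo-Riemannian metrics (of arbitrary signature). For a metric $g$ with Levi-Civita connection $\nabla$, Ricci tensor $R_{ab}$, scalar curvature $R$ and Schouten tensor $P_{ab}=\frac{1}{n-2}\big(R_{ab}-\frac{R}{2(n-1)}g_{ab}\big)$, the standard tractor bundle $\mathcal T$ of $[g]$ splits as $\mathbb R\oplus TM\oplus\mathbb R$, with tractor metric $h\big((\rho,X,\sigma),(\alpha,Y,\beta)\big)=\sigma\alpha+\rho\beta+g(X,Y)$ and normal conformal tractor connection $$\bar\nabla_v(\rho,X,\sigma)=\big(d\rho(v)-P(v,X),\ \nabla_vX+\rho v+\sigma P(v,\cdot)^\sharp,\ d\sigma(v)-g(v,X)\big);$$ the splitting given by $e^{2\Upsilon}g$ has the components $\big(e^{-\Upsilon}(\rho-\Upsilon_aX^a-\tfrac12\sigma\Upsilon_a\Upsilon^a),\ e^{-\Upsilon}(X^a+\sigma\Upsilon^a),\ e^{\Upsilon}\sigma\big)$, where $\Upsilon_a=\nabla_a\Upsilon$. A metric on an open set is an aligned pure radiation metric with rays spanned by $K$ if $K$ is a smooth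 nowhere vanishing null vector field there with $R_{ab}=\varphi K_aK_b$ and $\nabla_aK^b=f_aK^b$ for some function $\varphi$ and some 1-form $f$. **Theorem 2.** On an open dense subset of $M$ the normal conformal tractor connection admits a parallel subbundle of totally null 2-planes if and only if, on an open dense subset of $M$, the conformal class contains an aligned pure radiation metric. More precisely: (a) There are an open dense $V\subseteq M$ and a smooth parallel totally null rank 2 subbundle of $\mathcal T|_V$ if and only if there are an open dense $U\subseteq M$ and an aligned pure radiation metric on $U$ in the conformal class $[g|_U]$. (b) There is a smooth parallel totally null rank 2 subbundle of $\mathcal T$ over all of $M$ if and only if there are an open dense $U\subseteq M$ and an aligned pure radiation metric $\hat g\in[g|_U]$ on $U$, with rays spanned by $K$, such that the 2-planes spanned by $(0,K,0)$ and $(0,0,1)$ in the splitting given by $\hat g$ extend from $U$ to a smooth rank 2 subbundle of $\mathcal T$ over $M$. (c) If $[g|_U]$ contains an aligned pure radiation metric on an open set $U\subseteq M$, then $\mathcal T|_U$ has a smooth parallel totally null rank 2 subbundle; in particular $\mathcal T$ has one over $M$ if $U=M$. -/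

import Mathlib

open scoped Manifold ContDiff Bundle

noncomputable section

namespace ConformalTractor

variable {E : Type*} [NormedAddCommGroup E] [NormedSpace ℝ E] [FiniteDimensional ℝ E]
  {M : Type*} [TopologicalSpace M] [ChartedSpace E M] [IsManifold 𝓘(ℝ, E) ∞ M]

/-! ### Pseudo-Riemannian metrics and tensor calculus -/

variable (E M) in
/-- Vector fields on `M` (no regularity imposed). -/
abbrev VField := (x : M) → TangentSpace 𝓘(ℝ, E) x

variable (E M) in
/-- Fields of bilinear forms on the tangent spaces of `M` (no regularity imposed). -/
abbrev BilinField :=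
  (x : M) → TangentSpace 𝓘(ℝ, E) x →L[ℝ] TangentSpace 𝓘(ℝ, E) x →L[ℝ] ℝ

/-- The vector field `X` is smooth on `U`. -/
def SmoothVFieldOn (U : Set M) (X : VField E M) : Prop :=
  ContMDiffOn 𝓘(ℝ, E) (𝓘(ℝ, E).prod 𝓘(ℝ, E)) ∞
    (fun x ↦ Bundle.TotalSpace.mk' E (E := TangentSpace 𝓘(ℝ, E)) x (X x)) U

/-- `g` is a smooth pseudo-Riemannian metric (of arbitrary signature) on `M`. -/
structure IsPseudoRiemannian (g : BilinField E M) : Prop where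
  symm : ∀ x v w, g x v w = g x w v
  nondegenerate : ∀ x v, (∀ w, g x v w = 0) → v = 0
  smooth : ContMDiff 𝓘(ℝ, E) (𝓘(ℝ, E).prod 𝓘(ℝ, E →L[ℝ] E →L[ℝ] ℝ)) ∞
    (fun x ↦ Bundle.TotalSpace.mk' (E →L[ℝ] E →L[ℝ] ℝ)
      (E := fun x : M ↦ TangentSpace 𝓘(ℝ, E) x →L[ℝ] TangentSpace 𝓘(ℝ, E) x →L[ℝ] ℝ) x (g x))

/-- The conformally related metric `e^{2Υ} g`. -/
def rescale (Υ : M → ℝ) (g : BilinField E M) : BilinField E M :=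
  fun x ↦ Real.exp (2 * Υ x) • g x

/-- A basis `b_1, …, b_n` of the tangent space at `x`. -/
def tbasis (x : M) :
    Module.Basis (Fin (Module.finrank ℝ E)) ℝ (TangentSpace 𝓘(ℝ, E) x) :=
  Module.finBasis ℝ E

/-- The components `g_{ij}` of the metric at `x` in the basis `tbasis x`. -/
def gram (g : BilinField E M) (x : M) :
    Matrix (Fin (Module.finrank ℝ E)) (Fin (Module.finrank ℝ E)) ℝ :=
  Matrix.of fun i j ↦ g x (tbasis x i) (tbasis x j)

/-- Raising an index: `α^a = g^{ab} α_b`, that is, for a linear form `α` on a tangent space,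
the vector `v` with `g(v, ·) = α`. -/
def raise (g : BilinField E M) (x : M) (α : TangentSpace 𝓘(ℝ, E) x → ℝ) :
    TangentSpace 𝓘(ℝ, E) x :=
  ∑ i, ∑ j, ((gram g x)⁻¹ i j * α (tbasis x j)) • tbasis x i

/-- The derivative of a function `f` at `x` in the direction `v`. -/
def dirDeriv (f : M → ℝ) (x : M) (v : TangentSpace 𝓘(ℝ, E) x) : ℝ :=
  mvfderiv 𝓘(ℝ, E) f x v

/-- The right-hand side of the Koszul formula: for the Levi-Civita connection `∇`,
`g(∇_V X, Z) = koszul g V X Z`. -/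
def koszul (g : BilinField E M) (V X Z : VField E M) (x : M) : ℝ :=
  (1 / 2) *
    (dirDeriv (fun y ↦ g y (X y) (Z y)) x (V x)
      + dirDeriv (fun y ↦ g y (V y) (Z y)) x (X x)
      - dirDeriv (fun y ↦ g y (V y) (X y)) x (Z x)
      + g x (VectorField.mlieBracket 𝓘(ℝ, E) V X x) (Z x)
      - g x (VectorField.mlieBracket 𝓘(ℝ, E) V Z x) (X x)
      - g x (VectorField.mlieBracket 𝓘(ℝ, E) X Z x) (V x))

/-- Extension of a tangent vector at `x` to a vector field that is smooth near `x`. -/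
def ext {x : M} (v : TangentSpace 𝓘(ℝ, E) x) : VField E M :=
  FiberBundle.extend E v

/-- The Levi-Civita connection `∇_v X` at `x`, for `v ∈ T_x M` and a vector field `X` that is
differentiable at `x`. -/
def nabla (g : BilinField E M) (X : VField E M) (x : M) (v : TangentSpace 𝓘(ℝ, E) x) :
    TangentSpace 𝓘(ℝ, E) x :=
  raise g x fun z ↦ koszul g (ext v) X (ext z) x

/-- The curvature tensor
`R(u, v) w = ∇_u ∇_v w - ∇_v ∇_u w - ∇_{[u, v]} w` at `x`, computed with local extensions. -/
def curv (g : BilinField E M) (x : M) (u v w : TangentSpace 𝓘(ℝ, E) x) :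
    TangentSpace 𝓘(ℝ, E) x :=
  nabla g (fun y ↦ nabla g (ext w) y (ext v y)) x u
    - nabla g (fun y ↦ nabla g (ext w) y (ext u y)) x v
    - nabla g (ext w) x (VectorField.mlieBracket 𝓘(ℝ, E) (ext u) (ext v) x)

/-- The Ricci tensor `Ric(v, w) = tr (u ↦ R(u, v) w)`. -/
def ricci (g : BilinField E M) (x : M) (v w : TangentSpace 𝓘(ℝ, E) x) : ℝ :=
  ∑ i, (tbasis x).repr (curv g x (tbasis x i) v w) i

/-- The scalar curvature `g^{ab} R_{ab}`. -/
def scal (g : BilinField E M) (x : M) : ℝ :=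
  ∑ i, ∑ j, (gram g x)⁻¹ i j * ricci g x (tbasis x i) (tbasis x j)

/-- The Schouten tensor `P_{ab} = (R_{ab} - R g_{ab} / (2 (n - 1))) / (n - 2)`. -/
def schouten (g : BilinField E M) (x : M) (v w : TangentSpace 𝓘(ℝ, E) x) : ℝ :=
  (1 / ((Module.finrank ℝ E : ℝ) - 2)) *
    (ricci g x v w - scal g x / (2 * ((Module.finrank ℝ E : ℝ) - 1)) * g x v w)

/-! ### Aligned pure radiation metrics -/

/-- On the set `U`, the metric `g` is an aligned pure radiation metric with rays spanned by the
nowhere vanishing null vector field `K`: `R_{ab} = φ K_a K_b` and `∇_a K^b = f_a K^b`. -/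
structure IsAlignedPureRadiationOn (U : Set M) (g : BilinField E M) (K : VField E M) :
    Prop where
  smooth : SmoothVFieldOn U K
  ne_zero : ∀ x ∈ U, K x ≠ 0
  null : ∀ x ∈ U, g x (K x) (K x) = 0
  ricci_eq : ∃ φ : M → ℝ, ∀ x ∈ U, ∀ v w,
    ricci g x v w = φ x * (g x (K x) v * g x (K x) w)
  parallel_ray : ∃ f : (x : M) → TangentSpace 𝓘(ℝ, E) x →L[ℝ] ℝ, ∀ x ∈ U, ∀ v,
    nabla g K x v = f x v • K x

/-- On the open set `U`, the conformal class of `g` contains an aligned pure radiation metric. -/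
def ContainsAlignedPureRadiation (g : BilinField E M) (U : Set M) : Prop :=
  ∃ (Υ : M → ℝ) (K : VField E M), ContMDiffOn 𝓘(ℝ, E) 𝓘(ℝ, ℝ) ∞ Υ U ∧
    IsAlignedPureRadiationOn U (rescale Υ g) K

/-! ### The standard tractor bundle with its normal connection

The standard tractor bundle of the conformal class of `g` is `ℝ ⊕ TM ⊕ ℝ` in the splitting that
is given by `g`; the components of a tractor are written `(ρ, X, σ)`. -/

/-- The fibre at `x` of the standard tractor bundle, in the splitting given by a metric. -/
abbrev Tractor (x : M) := ℝ × TangentSpace 𝓘(ℝ, E) x × ℝ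

variable (E M) in
/-- Sections of the tractor bundle (no regularity imposed). -/
abbrev TractorField := (x : M) → Tractor (E := E) x

/-- The tractor field `s` is smooth on `U`. -/
def SmoothTractorOn (U : Set M) (s : TractorField E M) : Prop :=
  ContMDiffOn 𝓘(ℝ, E) 𝓘(ℝ, ℝ) ∞ (fun x ↦ (s x).1) U ∧
    SmoothVFieldOn U (fun x ↦ (s x).2.1) ∧
    ContMDiffOn 𝓘(ℝ, E) 𝓘(ℝ, ℝ) ∞ (fun x ↦ (s x).2.2) U

/-- The tractor metric `h((ρ, X, σ), (α, Y, β)) = σ α + ρ β + g(X, Y)`. -/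
def tractorMetric (g : BilinField E M) (x : M) (s t : Tractor (E := E) x) : ℝ :=
  s.2.2 * t.1 + s.1 * t.2.2 + g x s.2.1 t.2.1

/-- The normal conformal tractor connection, in the splitting given by `g`:
`∇_v (ρ, X, σ) = (dρ(v) - P(v, X), ∇_v X + ρ v + σ P(v, ·)^♯, dσ(v) - g(v, X))`. -/
def tractorNabla (g : BilinField E M) (s : TractorField E M) (x : M)
    (v : TangentSpace 𝓘(ℝ, E) x) : Tractor (E := E) x :=
  (dirDeriv (fun y ↦ (s y).1) x v - schouten g x v (s x).2.1,
    nabla g (fun y ↦ (s y).2.1) x v + (s x).1 • v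
      + (s x).2.2 • raise g x (fun w ↦ schouten g x v w),
    dirDeriv (fun y ↦ (s y).2.2) x v - g x v (s x).2.1)

/-- The components of a tractor in the splitting given by `e^{2Υ} g`, in terms of its components
`(ρ, X, σ)` in the splitting given by `g`. The exponential factors are the conformal weights of
the three components, the tractor metric being a genuine (unweighted) bundle metric. -/
def changeSplitting (g : BilinField E M) (Υ : M → ℝ) (x : M) (s : Tractor (E := E) x) :
    Tractor (E := E) x :=
  (Real.exp (-Υ x) * (s.1 - dirDeriv Υ x s.2.1
      - (1 / 2) * s.2.2 * dirDeriv Υ x (raise g x (dirDeriv Υ x))),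
    Real.exp (-Υ x) • (s.2.1 + s.2.2 • raise g x (dirDeriv Υ x)),
    Real.exp (Υ x) * s.2.2)

/-- `H` is a smooth subbundle of rank two of the tractor bundle over the open set `U`. -/
def IsPlaneSubbundleOn (U : Set M) (H : (x : M) → Submodule ℝ (Tractor (E := E) x)) : Prop :=
  ∀ x ∈ U, ∃ (V : Set M) (s t : TractorField E M), IsOpen V ∧ x ∈ V ∧ V ⊆ U ∧
    SmoothTractorOn V s ∧ SmoothTractorOn V t ∧
    ∀ y ∈ V, LinearIndependent ℝ ![s y, t y] ∧ H y = Submodule.span ℝ {s y, t y}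

/-- `H` is a smooth subbundle of totally null 2-planes of the tractor bundle over the open set
`U`, and it is parallel: tractor derivatives of local sections of `H` are again in `H`. -/
structure IsParallelNullPlaneOn (g : BilinField E M) (U : Set M)
    (H : (x : M) → Submodule ℝ (Tractor (E := E) x)) : Prop where
  plane : IsPlaneSubbundleOn U H
  null : ∀ x ∈ U, ∀ s ∈ H x, ∀ t ∈ H x, tractorMetric g x s t = 0
  parallel : ∀ (V : Set M) (s : TractorField E M), IsOpen V → V ⊆ U → SmoothTractorOn V s →
    (∀ y ∈ V, s y ∈ H y) → ∀ x ∈ V, ∀ v, tractorNabla g s x v ∈ H x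

/-- Over the open set `U`, the normal conformal tractor connection admits a parallel subbundle of
totally null 2-planes. -/
def AdmitsParallelNullPlane (g : BilinField E M) (U : Set M) : Prop :=
  ∃ H : (x : M) → Submodule ℝ (Tractor (E := E) x), IsParallelNullPlaneOn g U H

/-- On the set `U`, the plane field `H` consists of the tractors that are linear combinations of
`(0, K, 0)` and `(0, 0, 1)` in the splitting given by `e^{2Υ} g`. -/
def IsSpannedByRayOn (g : BilinField E M) (U : Set M) (Υ : M → ℝ) (K : VField E M)
    (H : (x : M) → Submodule ℝ (Tractor (E := E) x)) : Prop :=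
  ∀ x ∈ U, ∀ s : Tractor (E := E) x,
    s ∈ H x ↔ ∃ a b : ℝ, changeSplitting g Υ x s = (0, a • K x, b)

end ConformalTractor

end

/-!
The proof rests on computing in the splitting given by a well chosen metric of the conformal class.

*Invariance.* The change of splitting from `g` to `e^{2Υ} g` is an isometry of the tractor metric
(`MetricAt.tractorMetric_changeSplitting`) and intertwines the tractor connections
(`MetricAt.tractorNabla_changeSplitting`, which comes down to the transformation laws
`MetricAt.nabla_rescale` and `MetricAt.schouten_rescale`). Hence it does not matter in which
splitting a plane field is tested for being totally null and parallel.

*The adapted splitting.* The planes spanned by `(0, K, 0)` and `(0, 0, 1)` are totally null and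
parallel if and only if `K` is null and recurrent and the Schouten tensor is a multiple of
`K_a K_b`; because `K` is null, taking a trace shows that this last condition says the same as
`R_{ab} = φ K_a K_b`. So aligned pure radiation metrics give parallel null planes
(`isParallelNullPlaneOn_of_isAlignedPureRadiationOn`), and they are the only metrics in whose
splitting a parallel null plane field takes this form
(`isAlignedPureRadiationOn_of_isParallelNullPlaneOn`).

*Finding the metric.* Let `H` be a parallel field of null planes. The component `σ` cannot vanish on
`H` over a nonempty open set (`IsParallelNullPlaneOn.dense_sigma_ne_zero`), and near a point where
it does not vanish, `H` has a frame `(ρ, K, 0)`, `(α, Y, 1)`. That `H` is parallel forces the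
1-forms `g(K, ·)` and `g(Y, ·)` to be closed on the hyperplanes `K^⊥`. Thus `K^⊥` is integrable, and
`-g(Y, ·)` has a potential `Υ` along its leaves; then `Y + grad Υ` is a multiple of `K`, and this
is what it means for `H` to be spanned by `(0, K, 0)` and `(0, 0, 1)` in the splitting given by
`e^{2Υ} g` (`IsParallelNullPlaneOn.exists_scale`). The potential is a Frobenius theorem with a
smooth transverse parameter (`exists_potential`), proved with the flow of commuting vector fields
(`exists_flow`). The flow is constructed, together with its smooth dependence on the initial value
and on the field, by the inverse function theorem on a Banach space of paths
(`exists_smooth_paths`).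

*From local to dense, and back.* The local potentials are not compatible, but a maximal family of
pairwise disjoint open sets carrying one has a dense union (`exists_dense_open_of_local`).
Conversely, a smooth plane field that is null and parallel over a dense open set is so everywhere,
by continuity and Cramer's rule (`IsParallelNullPlaneOn.extend`).

Throughout, smoothness is used as a property of germs (`SmoothFnAt`, `SmoothFieldAt`, `MetricAt`),
since `Υ` and `K` are controlled on an open set only.
-/

set_option linter.unusedSectionVars false

noncomputable section

namespace ConformalTractor

open Filter Topology

/-! ### Smooth superposition operators -/

section Superposition

universe u
variable {K : Type*} [TopologicalSpace K] [CompactSpace K]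
  {S : Type u} [NormedAddCommGroup S] [NormedSpace ℝ S]
  {T : Type u} [NormedAddCommGroup T] [NormedSpace ℝ T]

-- Shortcut instances, here and before `exists_smooth_paths`: without them type class search does not
-- find the norms on these spaces of operator-valued maps.
instance : NormedAddCommGroup C(K, S →L[ℝ] T) := ContinuousMap.instNormedAddCommGroup

instance : SeminormedAddCommGroup C(K, S →L[ℝ] T) := ContinuousMap.instSeminormedAddCommGroup

variable (K S T) in
/-- Pointwise evaluation of a continuous family of operators on a continuous map. -/
def pointwiseApply : C(K, S →L[ℝ] T) →L[ℝ] C(K, S) →L[ℝ] C(K, T) :=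
  LinearMap.mkContinuous₂
    (LinearMap.mk₂ ℝ (fun (A : C(K, S →L[ℝ] T)) (h : C(K, S)) ↦
      (⟨fun t ↦ A t (h t), by fun_prop⟩ : C(K, T)))
      (fun _ _ _ ↦ by ext; simp) (fun _ _ _ ↦ by ext; simp) (fun _ _ _ ↦ by ext; simp)
      (fun _ _ _ ↦ by ext; simp)) 1 fun A h ↦ by
    refine (ContinuousMap.norm_le _ (by positivity)).2 fun t ↦ ?_
    rw [one_mul]
    exact (A t).le_of_opNorm_le_of_le (A.norm_coe_le_norm t) (h.norm_coe_le_norm t)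

/-- The superposition operator `γ ↦ F ∘ γ` of a `C^1` map `F` is differentiable. -/
theorem hasFDerivAt_comp_continuousMap {F : C(S, T)} {F' : C(S, S →L[ℝ] T)}
    (hF : ∀ z, HasFDerivAt F (F' z) z) (γ : C(K, S)) :
    HasFDerivAt (fun γ : C(K, S) ↦ F.comp γ) (pointwiseApply K S T (F'.comp γ)) γ := by
  refine .of_isLittleO (Asymptotics.isLittleO_iff.2 fun ε hε ↦ ?_)
  have hc : ContinuousAt (fun γ : C(K, S) ↦ F'.comp γ) γ :=
    (ContinuousMap.continuous_postcomp F').continuousAt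
  obtain ⟨δ, hδ, hball⟩ := (Metric.continuousAt_iff (α := C(K, S)) (β := C(K, S →L[ℝ] T))).1 hc ε hε
  filter_upwards [Metric.ball_mem_nhds γ hδ] with γ' hγ'
  refine (ContinuousMap.norm_le _ (by positivity)).2 fun t ↦ ?_
  have hseg : ∀ z ∈ segment ℝ (γ t) (γ' t), ‖F' z - F' (γ t)‖ ≤ ε := by
    intro z hz
    rw [segment_eq_image'] at hz
    obtain ⟨θ, hθ, rfl⟩ := hz
    have hmem : γ + θ • (γ' - γ) ∈ Metric.ball γ δ := by
      refine (convex_ball γ δ).segment_subset (Metric.mem_ball_self hδ) hγ' ?_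
      rw [segment_eq_image']
      exact ⟨θ, hθ, rfl⟩
    have h := hball hmem
    rw [dist_eq_norm] at h
    exact ((F'.comp (γ + θ • (γ' - γ)) - F'.comp γ).norm_coe_le_norm t).trans h.le
  have h := (convex_segment (γ t) (γ' t)).norm_image_sub_le_of_norm_hasFDerivWithin_le'
    (fun z _ ↦ (hF z).hasFDerivWithinAt) hseg (left_mem_segment ℝ _ _) (right_mem_segment ℝ _ _)
  exact h.trans (mul_le_mul_of_nonneg_left ((γ' - γ).norm_coe_le_norm t) hε.le)

/-- By induction on `n`: the derivative of `γ ↦ F ∘ γ` is the superposition operator of the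
derivative of `F`, followed by `pointwiseApply`. -/
theorem contDiff_comp_continuousMap_nat (n : ℕ) : ∀ {T : Type u} [NormedAddCommGroup T]
    [NormedSpace ℝ T] (F : C(S, T)), ContDiff ℝ n F →
    ContDiff ℝ n (fun γ : C(K, S) ↦ F.comp γ) := by
  induction n with
  | zero =>
    intro T _ _ F _
    exact contDiff_zero.2 (ContinuousMap.continuous_postcomp F)
  | succ n ih =>
    intro T _ _ F hF
    have hF' : ContDiff ℝ (n + 1) F := by exact_mod_cast hF
    obtain ⟨hd, -, hn⟩ := contDiff_succ_iff_fderiv.1 hF'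
    let F' : C(S, S →L[ℝ] T) := ⟨fderiv ℝ F, hn.continuous⟩
    have h : ∀ γ : C(K, S), HasFDerivAt (fun γ : C(K, S) ↦ F.comp γ)
        (pointwiseApply K S T (F'.comp γ)) γ :=
      hasFDerivAt_comp_continuousMap fun z ↦ (hd z).hasFDerivAt
    have h2 : ContDiff ℝ (n + 1) (fun γ : C(K, S) ↦ F.comp γ) := by
      rw [contDiff_succ_iff_fderiv]
      refine ⟨fun γ ↦ (h γ).differentiableAt, fun h ↦ by simp at h, ?_⟩
      have : fderiv ℝ (fun γ : C(K, S) ↦ F.comp γ)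
          = fun γ ↦ pointwiseApply K S T (F'.comp γ) := funext fun γ ↦ (h γ).fderiv
      rw [this]
      exact (pointwiseApply K S T).contDiff.comp (ih F' hn)
    exact_mod_cast h2

/-- The superposition operator `γ ↦ F ∘ γ` on `C(K, S)` is smooth if `F` is. -/
theorem contDiff_comp_continuousMap {F : C(S, T)} (hF : ContDiff ℝ ∞ F) :
    ContDiff ℝ ∞ (fun γ : C(K, S) ↦ F.comp γ) :=
  contDiff_infty.2 fun n ↦ contDiff_comp_continuousMap_nat n F (contDiff_infty.1 hF n)

end Superposition

/-! ### Smooth local inverses -/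

/-- The inverse function theorem with a right inverse that is smooth in a whole neighbourhood: at
`∞`, `ContDiffAt.toOpenPartialHomeomorph` alone gives smoothness at the point only. -/
theorem exists_smooth_localInverse {X Y : Type*} [NormedAddCommGroup X] [NormedSpace ℝ X]
    [CompleteSpace X] [NormedAddCommGroup Y] [NormedSpace ℝ Y] {F : X → Y} {a : X}
    (hF : ∀ᶠ x in 𝓝 a, ContDiffAt ℝ ∞ F x) {F' : X ≃L[ℝ] Y}
    (hF' : HasFDerivAt F (F' : X →L[ℝ] Y) a) :
    ∃ G : Y → X, G (F a) = a ∧ (∀ᶠ y in 𝓝 (F a), ContDiffAt ℝ ∞ G y) ∧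
      ∀ᶠ y in 𝓝 (F a), F (G y) = y := by
  have ha := hF.self_of_nhds
  have h0 : (∞ : WithTop ℕ∞) ≠ 0 := by simp
  let e := ha.toOpenPartialHomeomorph F hF' h0
  have hsrc : a ∈ e.source := ha.mem_toOpenPartialHomeomorph_source hF' h0
  have htgt : F a ∈ e.target := e.map_source hsrc
  have hGa : e.symm (F a) = a := e.left_inv hsrc
  have hc : Tendsto e.symm (𝓝 (F a)) (𝓝 a) := by
    have := e.continuousAt_symm htgt
    rwa [ContinuousAt, hGa] at this
  have hinv : ∀ᶠ x in 𝓝 a, ∃ L : X ≃L[ℝ] Y, (L : X →L[ℝ] Y) = fderiv ℝ F x := by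
    have h1 : ContinuousAt (fderiv ℝ F) a := (ha.fderiv_right (m := 0) (by simp)).continuousAt
    have h2 := F'.nhds
    rw [← hF'.fderiv] at h2
    exact h1.eventually h2
  refine ⟨e.symm, hGa, ?_, ?_⟩
  · filter_upwards [hc.eventually hF, hc.eventually hinv, e.open_target.mem_nhds htgt]
      with y h1 ⟨L, hL⟩ h3
    refine e.contDiffAt_symm h3 (f₀' := L) ?_ h1
    rw [hL]
    exact (h1.differentiableAt h0).hasFDerivAt
  · filter_upwards [e.open_target.mem_nhds htgt] with y hy
    exact e.right_inv hy

/-! ### Extension of smooth germs -/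

/-- A bump function extends a smooth germ to a smooth function on the whole space. -/
theorem exists_contDiff_eventuallyEq {X Y : Type*} [NormedAddCommGroup X] [NormedSpace ℝ X]
    [FiniteDimensional ℝ X] [NormedAddCommGroup Y] [NormedSpace ℝ Y] {F : X → Y} {a : X}
    (hF : ∀ᶠ x in 𝓝 a, ContDiffAt ℝ ∞ F x) : ∃ G : X → Y, ContDiff ℝ ∞ G ∧ G =ᶠ[𝓝 a] F := by
  obtain ⟨ε, hε, hball⟩ := Metric.eventually_nhds_iff_ball.1 hF
  let χ : ContDiffBump a := ⟨ε / 4, ε / 2, by positivity, by linarith⟩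
  refine ⟨fun x ↦ χ x • F x, contDiff_iff_contDiffAt.2 fun x ↦ ?_, ?_⟩
  · by_cases hx : x ∈ Metric.ball a ε
    · exact χ.contDiff.contDiffAt.smul (hball x hx)
    · have hx' : x ∉ tsupport χ := fun h ↦ hx <| by
        rw [χ.tsupport_eq] at h
        exact Metric.closedBall_subset_ball (by show ε / 2 < ε; linarith) h
      refine contDiffAt_const (c := 0) |>.congr_of_eventuallyEq ?_
      filter_upwards [(isClosed_tsupport χ).isOpen_compl.mem_nhds hx'] with y hy
      rw [image_eq_zero_of_notMem_tsupport hy, zero_smul]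
  · filter_upwards [χ.eventuallyEq_one] with y hy
    rw [hy, Pi.one_apply, one_smul]

/-! ### The flow of commuting vector fields -/

section Flow

universe u
variable {E S : Type u} [NormedAddCommGroup E] [NormedSpace ℝ E]
  [NormedAddCommGroup S] [NormedSpace ℝ S] [CompleteSpace S]

local notation "I" => Set.Icc (0 : ℝ) 1

variable (S) in
/-- The operator `γ ↦ ∫_0^t γ` on continuous paths. -/
def integralOp : C(I, S) →L[ℝ] C(I, S) :=
  LinearMap.mkContinuous
    { toFun := fun γ ↦ ⟨fun t ↦ ∫ τ in (0 : ℝ)..t, ContinuousMap.IccExtendCM γ τ, by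
        have : Continuous fun t : ℝ ↦ ∫ τ in (0 : ℝ)..t, ContinuousMap.IccExtendCM γ τ :=
          intervalIntegral.continuous_primitive
            (fun a b ↦ (ContinuousMap.IccExtendCM γ).continuous.intervalIntegrable a b) 0
        exact this.comp continuous_subtype_val⟩
      map_add' := fun γ γ' ↦ by
        ext t
        exact intervalIntegral.integral_add
          ((ContinuousMap.IccExtendCM γ).continuous.intervalIntegrable _ _)
          ((ContinuousMap.IccExtendCM γ').continuous.intervalIntegrable _ _)
      map_smul' := fun c γ ↦ by
        ext t
        exact intervalIntegral.integral_smul c _ } 1 fun γ ↦ by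
    refine (ContinuousMap.norm_le _ (by positivity)).2 fun t ↦ ?_
    have h := intervalIntegral.norm_integral_le_of_norm_le_const (a := (0 : ℝ)) (b := t) (C := ‖γ‖)
      (f := ContinuousMap.IccExtendCM γ) fun τ _ ↦ γ.norm_coe_le_norm _
    refine h.trans ?_
    rw [sub_zero, abs_of_nonneg t.2.1, one_mul]
    exact mul_le_of_le_one_right (norm_nonneg _) t.2.2

theorem integralOp_apply (γ : C(I, S)) (t : I) :
    integralOp S γ t = ∫ τ in (0 : ℝ)..t, ContinuousMap.IccExtendCM γ τ := rfl

/-- A path of the form `p + ∫ γ` solves the corresponding differential equation. -/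
theorem hasDerivWithinAt_of_eq_integralOp {γ ζ : C(I, S)} {p : S}
    (h : ∀ t, ζ t = p + integralOp S γ t) {t : ℝ} (ht : t ∈ Set.Ico (0 : ℝ) 1) :
    HasDerivWithinAt (ContinuousMap.IccExtendCM ζ) (ContinuousMap.IccExtendCM γ t)
      (Set.Ici t) t := by
  have h1 : HasDerivAt (fun t : ℝ ↦ p + ∫ τ in (0 : ℝ)..t, ContinuousMap.IccExtendCM γ τ)
      (ContinuousMap.IccExtendCM γ t) t :=
    ((ContinuousMap.IccExtendCM γ).continuous.integral_hasStrictDerivAt 0 t).hasDerivAt.const_add p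
  have h2 : ∀ s ∈ Set.Icc (0 : ℝ) 1, ContinuousMap.IccExtendCM ζ s
      = p + ∫ τ in (0 : ℝ)..s, ContinuousMap.IccExtendCM γ τ := fun s hs ↦ by
    rw [ContinuousMap.IccExtendCM_of_mem hs, h, integralOp_apply]
  refine h1.hasDerivWithinAt.congr_of_eventuallyEq ?_ (h2 t ⟨ht.1, ht.2.le⟩)
  filter_upwards [inter_mem_nhdsWithin _ (Iio_mem_nhds ht.2)] with s hs
  exact h2 s ⟨ht.1.trans hs.1, (Set.mem_Iio.1 hs.2).le⟩

variable (S) in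
/-- Constant paths. -/
def constPath : S →L[ℝ] C(I, S) :=
  LinearMap.mkContinuous
    { toFun := fun p ↦ ContinuousMap.const I p
      map_add' := fun _ _ ↦ rfl
      map_smul' := fun _ _ ↦ rfl } 1 fun p ↦
    (ContinuousMap.norm_le _ (by positivity)).2 fun t ↦ (one_mul ‖p‖).ge

instance : NormedAddCommGroup C(I, E →L[ℝ] S) := ContinuousMap.instNormedAddCommGroup

instance : SeminormedAddCommGroup C(I, E →L[ℝ] S) := ContinuousMap.instSeminormedAddCommGroup

instance : NormedAddCommGroup (S →L[ℝ] E →L[ℝ] S) := ContinuousLinearMap.toNormedAddCommGroup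

instance : SeminormedAddCommGroup (S →L[ℝ] E →L[ℝ] S) :=
  ContinuousLinearMap.toSeminormedAddCommGroup

/-- Let `P` assign to each point of `S` a linear family of tangent vectors. The fixed point problem
`γ = p + ∫ P(γ) x` on paths, whose solution is the integral curve of the vector field
`y ↦ P(y) x` starting at `p`, has solutions that depend smoothly on `(x, p)`. -/
theorem exists_smooth_paths {P : C(S, E →L[ℝ] S)} (hP : ContDiff ℝ ∞ P) (p₀ : S) [CompleteSpace E] :
    ∃ Γ : E × S → C(I, S), Γ (0, p₀) = constPath S p₀ ∧
      (∀ᶠ q in 𝓝 ((0 : E), p₀), ContDiffAt ℝ ∞ Γ q) ∧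
      ∀ᶠ q in 𝓝 ((0 : E), p₀), Γ q = constPath S q.2
        + integralOp S (pointwiseApply I E S (P.comp (Γ q)) (constPath E q.1)) := by
  let B := pointwiseApply I E S
  let N : C(I, S) → C(I, E →L[ℝ] S) := fun γ ↦ P.comp γ
  have hN : ContDiff ℝ ∞ N := contDiff_comp_continuousMap hP
  let R : (E × S) × C(I, S) → C(I, S) := fun z ↦
    z.2 - (constPath S z.1.2 + integralOp S (B (N z.2) (constPath E z.1.1)))
  have hR : ContDiff ℝ ∞ R := by
    refine contDiff_snd.sub (((constPath S).contDiff.comp (contDiff_snd.comp contDiff_fst)).add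
      ((integralOp S).contDiff.comp ?_))
    have h1 : ContDiff ℝ ∞ (fun z : (E × S) × C(I, S) ↦ constPath E z.1.1) :=
      (constPath E).contDiff.comp (contDiff_fst.comp contDiff_fst)
    exact B.isBoundedBilinearMap.contDiff.comp ((hN.comp contDiff_snd).prodMk h1)
  let z₀ : (E × S) × C(I, S) := ((0, p₀), constPath S p₀)
  let D : E × S →L[ℝ] C(I, S) :=
    -((constPath S).comp (ContinuousLinearMap.snd ℝ E S)
      + (integralOp S).comp
        ((B (N z₀.2)).comp ((constPath E).comp (ContinuousLinearMap.fst ℝ E S))))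
  have hz₀ : R z₀ = 0 := by
    ext t
    simp [R, z₀]
  have hRD : HasFDerivAt R (ContinuousLinearMap.snd ℝ (E × S) C(I, S)
      + D.comp (ContinuousLinearMap.fst ℝ (E × S) C(I, S))) z₀ := by
    have h1 : HasFDerivAt (fun z : (E × S) × C(I, S) ↦ N z.2) _ z₀ :=
      ((hN.differentiable (by simp) z₀.2).hasFDerivAt).comp z₀ hasFDerivAt_snd
    have h2 : HasFDerivAt (fun z : (E × S) × C(I, S) ↦ constPath E z.1.1)
        ((constPath E).comp ((ContinuousLinearMap.fst ℝ E S).comp (.fst ℝ (E × S) C(I, S)))) z₀ :=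
      ((constPath E).comp ((ContinuousLinearMap.fst ℝ E S).comp
        (.fst ℝ (E × S) C(I, S)))).hasFDerivAt
    have h3 : HasFDerivAt (fun z : (E × S) × C(I, S) ↦ constPath S z.1.2)
        ((constPath S).comp ((ContinuousLinearMap.snd ℝ E S).comp (.fst ℝ (E × S) C(I, S)))) z₀ :=
      ((constPath S).comp ((ContinuousLinearMap.snd ℝ E S).comp
        (.fst ℝ (E × S) C(I, S)))).hasFDerivAt
    have h4 := (integralOp S).hasFDerivAt.comp z₀ (B.hasFDerivAt_of_bilinear h1 h2)
    refine (hasFDerivAt_snd.sub (h3.add h4)).congr_fderiv ?_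
    ext z <;> simp [D, z₀, sub_eq_add_neg]
  let e : ((E × S) × C(I, S)) ≃L[ℝ] ((E × S) × C(I, S)) :=
    (ContinuousLinearEquiv.refl ℝ (E × S)).skewProd (ContinuousLinearEquiv.refl ℝ C(I, S)) D
  have hFe : HasFDerivAt (fun z ↦ (z.1, R z)) (e : _ →L[ℝ] _) z₀ := by
    refine (hasFDerivAt_fst.prodMk hRD).congr_fderiv ?_
    ext z <;> rfl
  obtain ⟨G, hG0, hG, hFG⟩ := exists_smooth_localInverse
    (F := fun z : (E × S) × C(I, S) ↦ (z.1, R z)) (a := z₀)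
    (.of_forall fun z ↦ (contDiff_fst.prodMk hR).contDiffAt) hFe
  rw [hz₀] at hG0 hG hFG
  have hc : Tendsto (fun q : E × S ↦ (q, (0 : C(I, S)))) (𝓝 (0, p₀)) (𝓝 (z₀.1, 0)) :=
    (Continuous.prodMk_left (0 : C(I, S))).tendsto' _ _ rfl
  refine ⟨fun q ↦ (G (q, 0)).2, congrArg Prod.snd hG0, ?_, ?_⟩
  · filter_upwards [hc.eventually hG] with q hq
    exact contDiffAt_snd.comp q (hq.comp q (contDiffAt_id.prodMk contDiffAt_const))
  · filter_upwards [hc.eventually hFG] with q hq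
    have h1 : (G (q, 0)).1 = q := congrArg Prod.fst hq
    have h2 : R (G (q, 0)) = 0 := congrArg Prod.snd hq
    have h3 := sub_eq_zero.1 h2
    rw [h1] at h3
    exact h3

/-- If the vector fields `y ↦ P(y) v` commute near `p₀`, then the time one map `Z (x, p)` of the
flow of `y ↦ P(y) x` satisfies `∂_v Z = P(Z) v` in the directions of `x`. -/
theorem exists_flow {P : C(S, E →L[ℝ] S)} (hP : ContDiff ℝ ∞ P) (p₀ : S) [CompleteSpace E]
    (hcomm : ∀ᶠ p in 𝓝 p₀, ∀ u v, fderiv ℝ P p (P p u) v = fderiv ℝ P p (P p v) u) :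
    ∃ Z : E × S → S, (∀ᶠ q in 𝓝 ((0 : E), p₀), ContDiffAt ℝ ∞ Z q) ∧
      (∀ᶠ p in 𝓝 p₀, Z (0, p) = p) ∧
      ∀ᶠ q in 𝓝 ((0 : E), p₀), ∀ v, fderiv ℝ Z q (v, 0) = P (Z q) v := by
  obtain ⟨Γ, hΓ0, hΓ, hfix⟩ := exists_smooth_paths hP p₀
  have one_mem : (1 : ℝ) ∈ Set.Icc (0 : ℝ) 1 := ⟨zero_le_one, le_rfl⟩
  let ev := ContinuousMap.evalCLM ℝ (M := S) (⟨1, one_mem⟩ : I)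
  let P' : C(S, S →L[ℝ] E →L[ℝ] S) := ⟨fderiv ℝ P, hP.continuous_fderiv (by simp)⟩
  have hP' : ∀ z, HasFDerivAt P (P' z) z := fun z ↦ (hP.differentiable (by simp) z).hasFDerivAt
  have hΓcomm : ∀ᶠ q in 𝓝 ((0 : E), p₀), ∀ t, ∀ u v,
      P' (Γ q t) (P (Γ q t) u) v = P' (Γ q t) (P (Γ q t) v) u := by
    obtain ⟨ε, hε, hball⟩ := Metric.eventually_nhds_iff_ball.1 hcomm
    have hcont := hΓ.self_of_nhds.continuousAt
    filter_upwards [hcont.eventually (Metric.ball_mem_nhds _ hε)] with q hq t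
    refine hball _ ?_
    rw [hΓ0] at hq
    exact (ContinuousMap.dist_apply_le_dist t).trans_lt hq
  refine ⟨fun q ↦ Γ q ⟨1, one_mem⟩, ?_, ?_, ?_⟩
  · filter_upwards [hΓ] with q hq
    exact ev.contDiff.contDiffAt.comp q hq
  · have hc : Tendsto (fun p : S ↦ ((0 : E), p)) (𝓝 p₀) (𝓝 (0, p₀)) :=
      (Continuous.prodMk_right (0 : E)).tendsto' _ _ rfl
    filter_upwards [hc.eventually hfix] with p hp
    rw [map_zero, map_zero, map_zero, add_zero] at hp
    rw [hp]
    rfl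
  · filter_upwards [hΓ, hΓcomm, hfix.eventually_nhds] with q hq hqc hqf v
    have hd := (hq.differentiableAt (by simp)).hasFDerivAt
    let γ := Γ q
    let W := fderiv ℝ Γ q (v, 0)
    have hZ : fderiv ℝ (fun q ↦ Γ q ⟨1, one_mem⟩) q (v, 0) = W ⟨1, one_mem⟩ := by
      have := (ev.hasFDerivAt.comp q hd).fderiv
      exact congrArg (fun L : E × S →L[ℝ] S ↦ L (v, 0)) this
    -- the variational equation, obtained by differentiating the fixed point equation
    let α := pointwiseApply I E S (P.comp γ) (constPath E q.1)
    let β := pointwiseApply I E S (P.comp γ) (constPath E v)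
      + pointwiseApply I E S (pointwiseApply I S (E →L[ℝ] S) (P'.comp γ) W) (constPath E q.1)
    have hγ : ∀ t, γ t = q.2 + integralOp S α t := fun t ↦
      congrArg (fun ζ : C(I, S) ↦ ζ t) hqf.self_of_nhds
    have hW : ∀ t, W t = 0 + integralOp S β t := by
      have h1 : HasFDerivAt (fun q ↦ P.comp (Γ q)) _ q :=
        (hasFDerivAt_comp_continuousMap hP' (Γ q)).comp q hd
      have h2 : HasFDerivAt (fun q : E × S ↦ constPath E q.1)
          ((constPath E).comp (.fst ℝ E S)) q := ((constPath E).comp (.fst ℝ E S)).hasFDerivAt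
      have h3 : HasFDerivAt (fun q : E × S ↦ constPath S q.2)
          ((constPath S).comp (.snd ℝ E S)) q := ((constPath S).comp (.snd ℝ E S)).hasFDerivAt
      have h4 := h3.add ((integralOp S).hasFDerivAt.comp q
        ((pointwiseApply I E S).hasFDerivAt_of_bilinear h1 h2))
      have h5 := (h4.congr_of_eventuallyEq hqf).unique hd
      have h6 := congrArg (fun L : E × S →L[ℝ] C(I, S) ↦ L (v, 0)) h5
      intro t
      have h7 := congrArg (fun ζ : C(I, S) ↦ ζ t) h6
      exact h7.symm
    let w : ℝ → S := fun t ↦ ContinuousMap.IccExtendCM W t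
      - t • P (ContinuousMap.IccExtendCM γ t) v
    let w' : ℝ → S := fun t ↦ ContinuousMap.IccExtendCM β t
      - (t • P' (ContinuousMap.IccExtendCM γ t) (ContinuousMap.IccExtendCM α t) v
        + (1 : ℝ) • P (ContinuousMap.IccExtendCM γ t) v)
    have hw' : ∀ t ∈ Set.Ico (0 : ℝ) 1, HasDerivWithinAt w (w' t) (Set.Ici t) t := by
      intro t ht
      refine (hasDerivWithinAt_of_eq_integralOp hW ht).sub
        ((hasDerivWithinAt_id t _).smul ?_)
      have h := (hP' (ContinuousMap.IccExtendCM γ t)).comp_hasDerivWithinAt t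
        (hasDerivWithinAt_of_eq_integralOp hγ ht)
      exact ((ContinuousLinearMap.apply ℝ S v).hasFDerivAt.comp_hasDerivWithinAt t h)
    have hwc : ContinuousOn w (Set.Icc 0 1) := by
      have h1 := (ContinuousMap.IccExtendCM W).continuous
      have h2 := P.continuous.comp (ContinuousMap.IccExtendCM γ).continuous
      exact (h1.sub (continuous_id.smul (h2.clm_apply continuous_const))).continuousOn
    have hw0 : w 0 = 0 := by
      have h0 : (0 : ℝ) ∈ Set.Icc (0 : ℝ) 1 := ⟨le_rfl, zero_le_one⟩
      simp only [w, zero_smul, sub_zero]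
      rw [ContinuousMap.IccExtendCM_of_mem h0, hW, integralOp_apply]
      simp
    have hbound : ∀ t ∈ Set.Ico (0 : ℝ) 1, ‖w' t‖ ≤ (‖P'.comp γ‖ * ‖q.1‖) * ‖w t‖ := by
      intro t ht
      have ht' : t ∈ Set.Icc (0 : ℝ) 1 := ⟨ht.1, ht.2.le⟩
      have h1 : w' t = P' (γ ⟨t, ht'⟩) (w t) q.1 := by
        simp only [w', w, ContinuousMap.IccExtendCM_of_mem ht']
        have h2 : β ⟨t, ht'⟩ = P (γ ⟨t, ht'⟩) v + P' (γ ⟨t, ht'⟩) (W ⟨t, ht'⟩) q.1 := rfl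
        have h3 : α ⟨t, ht'⟩ = P (γ ⟨t, ht'⟩) q.1 := rfl
        rw [h2, h3, hqc, map_sub, map_smul, sub_apply, smul_apply, one_smul]
        abel
      rw [h1]
      calc ‖P' (γ ⟨t, ht'⟩) (w t) q.1‖ ≤ ‖P' (γ ⟨t, ht'⟩) (w t)‖ * ‖q.1‖ :=
            ContinuousLinearMap.le_opNorm _ _
        _ ≤ (‖P'.comp γ‖ * ‖w t‖) * ‖q.1‖ := by
            gcongr
            exact (ContinuousLinearMap.le_opNorm _ _).trans
              (mul_le_mul_of_nonneg_right ((P'.comp γ).norm_coe_le_norm _) (norm_nonneg _))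
        _ = _ := by ring
    have h := eq_zero_of_abs_deriv_le_mul_abs_self_of_eq_zero_right hwc hw' hw0 hbound 1 one_mem
    simp only [w, ContinuousMap.IccExtendCM_of_mem one_mem, one_smul] at h
    rw [hZ, sub_eq_zero.1 h]

end Flow

/-! ### A leafwise Poincaré lemma -/

section Potential

variable {E : Type*} [NormedAddCommGroup E] [NormedSpace ℝ E] [FiniteDimensional ℝ E]

theorem fderiv_apply_apply {G : E → E →L[ℝ] ℝ} {y : E} (hG : DifferentiableAt ℝ G y) (v w : E) :
    fderiv ℝ (fun z ↦ G z v) y w = fderiv ℝ G y w v := by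
  have h := ((ContinuousLinearMap.apply ℝ ℝ v).hasFDerivAt.comp y hG.hasFDerivAt).fderiv
  exact congrArg (fun L : E →L[ℝ] ℝ ↦ L w) h

/-- The lift of `v` along `ker θ` (with `e` as a complement) to `E × ℝ` with slope `-N`. -/
def leafLift (θ N : E → E →L[ℝ] ℝ) (e : E) (z : E × ℝ) : E →L[ℝ] E × ℝ :=
  (ContinuousLinearMap.id ℝ E - (θ z.1).smulRight e).prod (-N z.1 + N z.1 e • θ z.1)

theorem leafLift_apply (θ N : E → E →L[ℝ] ℝ) (e : E) (z : E × ℝ) (v : E) :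
    leafLift θ N e z v = (v - θ z.1 v • e, -N z.1 v + N z.1 e * θ z.1 v) := rfl

theorem contDiff_leafLift {θ N : E → E →L[ℝ] ℝ} (hθ : ContDiff ℝ ∞ θ) (hN : ContDiff ℝ ∞ N)
    (e : E) : ContDiff ℝ ∞ (leafLift θ N e) := by
  rw [contDiff_clm_apply_iff]
  intro v
  simp only [leafLift_apply]
  have h1 : ∀ {G : E → E →L[ℝ] ℝ} (w : E), ContDiff ℝ ∞ G →
      ContDiff ℝ ∞ fun z : E × ℝ ↦ G z.1 w := fun w hG ↦
    (hG.comp contDiff_fst).clm_apply contDiff_const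
  exact (contDiff_const.sub ((h1 v hθ).smul contDiff_const)).prodMk
    ((h1 v hN).neg.add ((h1 e hN).mul (h1 v hθ)))

theorem fderiv_leafLift {θ N : E → E →L[ℝ] ℝ} (hθ : ContDiff ℝ ∞ θ) (hN : ContDiff ℝ ∞ N)
    (e : E) (z w : E × ℝ) (v : E) :
    fderiv ℝ (leafLift θ N e) z w v = (-(fderiv ℝ θ z.1 w.1 v • e),
      -fderiv ℝ N z.1 w.1 v + (N z.1 e * fderiv ℝ θ z.1 w.1 v
        + θ z.1 v * fderiv ℝ N z.1 w.1 e)) := by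
  have h0 : ∀ {G : E → E →L[ℝ] ℝ} (u : E), ContDiff ℝ ∞ G → HasFDerivAt
      (fun z : E × ℝ ↦ G z.1 u) ((((ContinuousLinearMap.apply ℝ ℝ u).comp
        (fderiv ℝ G z.1))).comp (ContinuousLinearMap.fst ℝ E ℝ)) z := fun u hG ↦
    ((ContinuousLinearMap.apply ℝ ℝ u).hasFDerivAt.comp z.1
      (hG.differentiable (by simp) z.1).hasFDerivAt).comp z hasFDerivAt_fst
  have hP : HasFDerivAt (leafLift θ N e) _ z :=
    ((contDiff_leafLift hθ hN e).differentiable (by simp) z).hasFDerivAt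
  have h1 : HasFDerivAt (fun z ↦ leafLift θ N e z v) _ z :=
    (ContinuousLinearMap.apply ℝ (E × ℝ) v).hasFDerivAt.comp z hP
  have h2 : HasFDerivAt (fun z ↦ leafLift θ N e z v) _ z :=
    ((hasFDerivAt_const v z).sub ((h0 v hθ).smul_const e)).prodMk
      ((h0 v hN).neg.add ((h0 e hN).mul (h0 v hθ)))
  have h3 := congrArg (fun L : E × ℝ →L[ℝ] E × ℝ ↦ L w) (h1.unique h2)
  refine h3.trans (Prod.ext ?_ ?_)
  · simp
  · simp

/-- The fields `leafLift θ N e · v` commute if `θ` and `N` are closed on the planes `ker θ`. -/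
theorem leafLift_comm {θ N : E → E →L[ℝ] ℝ} (hθ : ContDiff ℝ ∞ θ) (hN : ContDiff ℝ ∞ N)
    {e : E} {z : E × ℝ} (he : ∀ᶠ y in 𝓝 z.1, θ y e = 1)
    (hdθ : ∀ u v, θ z.1 u = 0 → θ z.1 v = 0 → fderiv ℝ θ z.1 u v = fderiv ℝ θ z.1 v u)
    (hdN : ∀ u v, θ z.1 u = 0 → θ z.1 v = 0 → fderiv ℝ N z.1 u v = fderiv ℝ N z.1 v u)
    (u v : E) :
    fderiv ℝ (leafLift θ N e) z (leafLift θ N e z u) v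
      = fderiv ℝ (leafLift θ N e) z (leafLift θ N e z v) u := by
  have he0 : θ z.1 e = 1 := he.self_of_nhds
  have hde : ∀ w, fderiv ℝ θ z.1 w e = 0 := fun w ↦ by
    rw [← fderiv_apply_apply (hθ.differentiable (by simp) z.1) e w,
      Filter.EventuallyEq.fderiv_eq (f := fun _ ↦ (1 : ℝ)) he]
    simp
  have hker : ∀ u, θ z.1 (u - θ z.1 u • e) = 0 := fun u ↦ by
    rw [map_sub, map_smul, he0, smul_eq_mul, mul_one, sub_self]
  have h1 := hdθ _ _ (hker u) (hker v)
  have h2 := hdN _ _ (hker u) (hker v)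
  rw [map_sub (fderiv ℝ θ z.1 (u - _)), map_sub (fderiv ℝ θ z.1 (v - _)),
    map_smul (fderiv ℝ θ z.1 (u - _)), map_smul (fderiv ℝ θ z.1 (v - _)), hde, hde, smul_zero,
    smul_zero, sub_zero, sub_zero] at h1
  rw [map_sub (fderiv ℝ N z.1 (u - _)), map_sub (fderiv ℝ N z.1 (v - _)),
    map_smul (fderiv ℝ N z.1 (u - _)), map_smul (fderiv ℝ N z.1 (v - _)), smul_eq_mul,
    smul_eq_mul] at h2
  rw [fderiv_leafLift hθ hN, fderiv_leafLift hθ hN]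
  simp only [leafLift_apply, h1]
  refine Prod.ext rfl ?_
  linear_combination -h2

/-- The leafwise Poincaré lemma for globally smooth `θ` and `N`, with `θ` normalized by `θ(e) = 1`.
The flow of the commuting fields `leafLift` sweeps out the graphs, over the leaves of `ker θ`, of
the solutions of `df = -N`; those that start on the line `y₀ + t e` at the value `0` make up
the graph of `f`. -/
theorem exists_potential_of_contDiff {θ N : E → E →L[ℝ] ℝ} (hθ : ContDiff ℝ ∞ θ)
    (hN : ContDiff ℝ ∞ N) {e y₀ : E} (he : ∀ᶠ y in 𝓝 y₀, θ y e = 1)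
    (hdθ : ∀ᶠ y in 𝓝 y₀, ∀ u v, θ y u = 0 → θ y v = 0 → fderiv ℝ θ y u v = fderiv ℝ θ y v u)
    (hdN : ∀ᶠ y in 𝓝 y₀, ∀ u v, θ y u = 0 → θ y v = 0 → fderiv ℝ N y u v = fderiv ℝ N y v u) :
    ∃ f : E → ℝ, (∀ᶠ y in 𝓝 y₀, ContDiffAt ℝ ∞ f y) ∧
      ∀ᶠ y in 𝓝 y₀, ∀ v, θ y v = 0 → fderiv ℝ f y v = -N y v := by
  have hP := contDiff_leafLift hθ hN e
  have hfst : Tendsto (Prod.fst : E × ℝ → E) (𝓝 (y₀, 0)) (𝓝 y₀) := continuousAt_fst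
  obtain ⟨Z, hZ, hZ0, hZd⟩ := exists_flow (P := ⟨leafLift θ N e, hP.continuous⟩) hP (y₀, 0)
    (by
      filter_upwards [hfst.eventually he.eventually_nhds, hfst.eventually hdθ,
        hfst.eventually hdN] with z h1 h2 h3 u v
      exact leafLift_comm hθ hN h1 h2 h3 u v)
  have he0 := he.self_of_nhds
  -- The leaves through the points `y₀ + t e` are swept out by the flow.
  let c' : E →L[ℝ] E × E × ℝ :=
    (ContinuousLinearMap.id ℝ E).prod (((θ y₀).smulRight e).prod 0)
  let c : E → E × E × ℝ := fun x ↦ c' x + (0, y₀, 0)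
  have hcd : ∀ x, HasFDerivAt c c' x := fun x ↦ c'.hasFDerivAt.add_const _
  have hc0 : c 0 = (0, y₀, 0) := by simp [c]
  have hct : Tendsto c (𝓝 0) (𝓝 (0, y₀, 0)) := hc0 ▸ (hcd 0).continuousAt
  let ζ : E → E × ℝ := fun x ↦ Z (c x)
  have hζ : ∀ᶠ x in 𝓝 (0 : E), ContDiffAt ℝ ∞ ζ x := by
    filter_upwards [hct.eventually hZ] with x hx
    exact hx.comp x (c'.contDiff.add contDiff_const).contDiffAt
  have hζ' : ∀ᶠ x in 𝓝 (0 : E), ∀ v, fderiv ℝ ζ x v = leafLift θ N e (ζ x) v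
      + θ y₀ v • fderiv ℝ Z (c x) (0, e, 0) := by
    filter_upwards [hct.eventually hZ, hct.eventually hZd] with x hx hx' v
    have h := ((hx.differentiableAt (by simp)).hasFDerivAt.comp x (hcd x)).fderiv
    have h2 : fderiv ℝ ζ x v = fderiv ℝ Z (c x) (c' v) :=
      congrArg (fun L : E →L[ℝ] E × ℝ ↦ L v) h
    have h3 : c' v = (v, 0) + θ y₀ v • (0, e, 0) := by simp [c']
    rw [h2, h3, map_add, map_smul, hx' v]
    rfl
  have hζ0 : ζ 0 = (y₀, 0) := by
    simp only [ζ, hc0]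
    exact hZ0.self_of_nhds
  have hZe : fderiv ℝ Z (0, y₀, 0) (0, e, 0) = (e, 0) := by
    have h1 := (hZ.self_of_nhds.differentiableAt (by simp)).hasFDerivAt
    have h2 : HasFDerivAt (fun p : E × ℝ ↦ Z (0, p)) _ (y₀, (0 : ℝ)) :=
      h1.comp (y₀, (0 : ℝ)) (hasFDerivAt_prodMk_right (0 : E) (y₀, (0 : ℝ)))
    have h3 := (h2.congr_of_eventuallyEq (f₁ := id) (hZ0.mono fun p hp ↦ hp.symm)).unique
      (hasFDerivAt_id _)
    exact congrArg (fun L : E × ℝ →L[ℝ] E × ℝ ↦ L (e, 0)) h3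
  let φ : E → E := fun x ↦ (ζ x).1
  have hφ0 : φ 0 = y₀ := congrArg Prod.fst hζ0
  have hφd : ∀ᶠ x in 𝓝 (0 : E), HasFDerivAt φ
      ((ContinuousLinearMap.fst ℝ E ℝ).comp (fderiv ℝ ζ x)) x := hζ.mono fun x hx ↦
    (ContinuousLinearMap.fst ℝ E ℝ).hasFDerivAt.comp x (hx.differentiableAt (by simp)).hasFDerivAt
  obtain ⟨ψ, hψ0, hψ, hφψ⟩ := exists_smooth_localInverse (F := φ) (a := 0)
    (F' := ContinuousLinearEquiv.refl ℝ E)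
    (hζ.mono fun x hx ↦ contDiffAt_fst.comp x hx)
    (hφd.self_of_nhds.congr_fderiv (by
      ext v
      have h := hζ'.self_of_nhds v
      rw [hζ0, hc0, hZe, leafLift_apply] at h
      simp [h]))
  rw [hφ0] at hψ0 hψ hφψ
  have hψt : Tendsto ψ (𝓝 y₀) (𝓝 0) := hψ0 ▸ hψ.self_of_nhds.continuousAt
  refine ⟨fun y ↦ (ζ (ψ y)).2, ?_, ?_⟩
  · filter_upwards [hψ, hψt.eventually hζ] with y h1 h2
    exact contDiffAt_snd.comp y (h2.comp y h1)
  · filter_upwards [hψ, hψt.eventually hζ, hψt.eventually hζ', hφψ.eventually_nhds, he]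
      with y h1 h2 h3 h4 h5 w hw
    have hy : (ζ (ψ y)).1 = y := h4.self_of_nhds
    have hζψ : HasFDerivAt (fun y ↦ ζ (ψ y)) _ y :=
      (h2.differentiableAt (by simp)).hasFDerivAt.comp y (h1.differentiableAt (by simp)).hasFDerivAt
    have hfst : ∀ u, (fderiv ℝ ζ (ψ y) (fderiv ℝ ψ y u)).1 = u := fun u ↦ by
      have h6 := ((ContinuousLinearMap.fst ℝ E ℝ).hasFDerivAt.comp y hζψ).congr_of_eventuallyEq
        (f₁ := id) (h4.mono fun z hz ↦ hz.symm)
      exact congrArg (fun L : E →L[ℝ] E ↦ L u) (h6.unique (hasFDerivAt_id y))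
    have hsnd : fderiv ℝ (fun y ↦ (ζ (ψ y)).2) y w
        = (fderiv ℝ ζ (ψ y) (fderiv ℝ ψ y w)).2 := by
      have h6 := ((ContinuousLinearMap.snd ℝ E ℝ).hasFDerivAt.comp y hζψ).fderiv
      exact congrArg (fun L : E →L[ℝ] ℝ ↦ L w) h6
    -- The derivative of the sweep-out leaves `ker θ` only in the direction transverse to
    -- `ker θ y₀`.
    set q := fderiv ℝ Z (c (ψ y)) (0, e, 0) with hq
    have hθ1 : ∀ u, θ y u = θ y₀ (fderiv ℝ ψ y u) * θ y q.1 := fun u ↦ by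
      have h6 := hfst u
      rw [h3, leafLift_apply, hy] at h6
      have h7 := congrArg (θ y) h6
      simp only [Prod.fst_add, Prod.smul_fst, map_add, map_sub, map_smul, h5, smul_eq_mul,
        mul_one, sub_self, zero_add] at h7
      exact h7.symm
    have hq0 : θ y q.1 ≠ 0 := fun h ↦ by
      have := hθ1 e
      rw [h, h5, mul_zero] at this
      exact one_ne_zero this
    have ht : θ y₀ (fderiv ℝ ψ y w) = 0 := by
      have := hθ1 w
      rw [hw] at this
      exact (mul_eq_zero.1 this.symm).resolve_right hq0
    have h6 := hfst w
    rw [hsnd]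
    rw [h3, ht, zero_smul, add_zero, leafLift_apply, hy] at h6 ⊢
    have h7 := congrArg (N y) h6
    simp only [map_sub, map_smul, smul_eq_mul] at h7
    simp only
    linear_combination -h7

/-- **Leafwise Poincaré lemma**: if the 1-forms `Θ ≠ 0` and `N` are closed on the planes `ker Θ`
(so that `ker Θ` is integrable and `N` is closed along its leaves), then `-N` is locally the
differential of a function along `ker Θ`. -/
theorem exists_potential {Θ N : E → E →L[ℝ] ℝ} {y₀ : E}
    (hΘ : ∀ᶠ y in 𝓝 y₀, ContDiffAt ℝ ∞ Θ y) (hN : ∀ᶠ y in 𝓝 y₀, ContDiffAt ℝ ∞ N y)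
    (h0 : Θ y₀ ≠ 0)
    (hdΘ : ∀ᶠ y in 𝓝 y₀, ∀ u v, Θ y u = 0 → Θ y v = 0 → fderiv ℝ Θ y u v = fderiv ℝ Θ y v u)
    (hdN : ∀ᶠ y in 𝓝 y₀, ∀ u v, Θ y u = 0 → Θ y v = 0 → fderiv ℝ N y u v = fderiv ℝ N y v u) :
    ∃ f : E → ℝ, (∀ᶠ y in 𝓝 y₀, ContDiffAt ℝ ∞ f y) ∧
      ∀ᶠ y in 𝓝 y₀, ∀ v, Θ y v = 0 → fderiv ℝ f y v = -N y v := by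
  obtain ⟨e, he⟩ : ∃ e, Θ y₀ e ≠ 0 := by
    by_contra! h
    exact h0 (ContinuousLinearMap.ext h)
  have hΘe : ∀ᶠ y in 𝓝 y₀, ContDiffAt ℝ ∞ (fun y ↦ Θ y e) y := hΘ.mono fun y hy ↦
    hy.clm_apply contDiffAt_const
  have hne : ∀ᶠ y in 𝓝 y₀, Θ y e ≠ 0 := hΘe.self_of_nhds.continuousAt.eventually_ne he
  -- normalization `θ(e) = 1`
  obtain ⟨θ, hθ, hθeq⟩ := exists_contDiff_eventuallyEq
    (F := fun y ↦ (Θ y e)⁻¹ • Θ y) (a := y₀) <| by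
    filter_upwards [hΘ, hΘe, hne] with y h1 h2 h3
    exact (h2.inv h3).smul h1
  obtain ⟨N', hN', hNeq⟩ := exists_contDiff_eventuallyEq hN
  have hker : ∀ᶠ y in 𝓝 y₀, ∀ v, θ y v = 0 ↔ Θ y v = 0 := by
    filter_upwards [hθeq, hne] with y h1 h2 v
    rw [h1, smul_apply, smul_eq_mul, mul_eq_zero, or_iff_right (inv_ne_zero h2)]
  obtain ⟨f, hf, hfd⟩ := exists_potential_of_contDiff hθ hN' (e := e) (y₀ := y₀)
    (by
      filter_upwards [hθeq, hne] with y h1 h2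
      rw [h1, smul_apply, smul_eq_mul, inv_mul_cancel₀ h2])
    (by
      filter_upwards [hθeq.eventuallyEq_nhds, hne, hΘ, hΘe, hker, hdΘ]
        with y h1 h2 h3 h4 h5 h6 u v hu hv
      have h7 : HasFDerivAt (fun y ↦ (Θ y e)⁻¹ • Θ y) _ y :=
        (((h4.inv h2).differentiableAt (by simp)).hasFDerivAt).smul
          (h3.differentiableAt (by simp)).hasFDerivAt
      rw [h5] at hu hv
      rw [h1.fderiv_eq, h7.fderiv]
      simp [hu, hv, h6 u v hu hv])
    (by
      filter_upwards [hNeq.eventuallyEq_nhds, hker, hdN] with y h1 h2 h3 u v hu hv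
      rw [h1.fderiv_eq]
      exact h3 u v ((h2 u).1 hu) ((h2 v).1 hv))
  refine ⟨f, hf, ?_⟩
  filter_upwards [hfd, hker, hNeq] with y h1 h2 h3 v hv
  rw [h1 v ((h2 v).2 hv), h3]

end Potential

variable {E : Type*} [NormedAddCommGroup E] [NormedSpace ℝ E] [FiniteDimensional ℝ E]
  {M : Type*} [TopologicalSpace M] [ChartedSpace E M] [IsManifold 𝓘(ℝ, E) ∞ M]
variable {f f' : M → ℝ} {X Y Z V W : VField E M} {x : M} {g : BilinField E M} {Υ : M → ℝ}

/-! ### Germs of smooth functions and vector fields -/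

variable (E) in
/-- The function `f` is smooth in a neighbourhood of `x`. -/
def SmoothFnAt (f : M → ℝ) (x : M) : Prop :=
  ∀ᶠ y in 𝓝 x, ContMDiffAt 𝓘(ℝ, E) 𝓘(ℝ, ℝ) ∞ f y

/-- The vector field `X` is smooth in a neighbourhood of `x`. -/
def SmoothFieldAt (X : VField E M) (x : M) : Prop :=
  ∀ᶠ y in 𝓝 x, ContMDiffAt 𝓘(ℝ, E) (𝓘(ℝ, E).prod 𝓘(ℝ, E)) ∞
    (fun x ↦ Bundle.TotalSpace.mk' E (E := TangentSpace 𝓘(ℝ, E)) x (X x)) y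

variable {f f' : M → ℝ} {X Y Z V W : VField E M} {x : M}

namespace SmoothFnAt

theorem contMDiffAt (hf : SmoothFnAt E f x) : ContMDiffAt 𝓘(ℝ, E) 𝓘(ℝ, ℝ) ∞ f x :=
  hf.self_of_nhds

theorem mdifferentiableAt (hf : SmoothFnAt E f x) :
    MDifferentiableAt 𝓘(ℝ, E) 𝓘(ℝ, ℝ) f x :=
  hf.contMDiffAt.mdifferentiableAt (by simp)

theorem eventually (hf : SmoothFnAt E f x) : ∀ᶠ y in 𝓝 x, SmoothFnAt E f y :=
  eventually_eventually_nhds.2 hf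

theorem congr (hf : SmoothFnAt E f x) (h : f' =ᶠ[𝓝 x] f) : SmoothFnAt E f' x := by
  filter_upwards [hf, h.eventually_nhds] with y h1 h2 using h1.congr_of_eventuallyEq h2

theorem of_contMDiffOn {U : Set M} (hU : IsOpen U) (hx : x ∈ U)
    (hf : ContMDiffOn 𝓘(ℝ, E) 𝓘(ℝ, ℝ) ∞ f U) : SmoothFnAt E f x := by
  filter_upwards [hU.mem_nhds hx] with y hy using hf.contMDiffAt (hU.mem_nhds hy)

variable (E) in
theorem const (c : ℝ) (x : M) : SmoothFnAt E (fun _ ↦ c) x :=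
  Eventually.of_forall fun _ ↦ contMDiffAt_const

theorem add (hf : SmoothFnAt E f x) (hf' : SmoothFnAt E f' x) :
    SmoothFnAt E (fun y ↦ f y + f' y) x := by
  filter_upwards [hf, hf'] with y h1 h2 using h1.add h2

theorem mul (hf : SmoothFnAt E f x) (hf' : SmoothFnAt E f' x) :
    SmoothFnAt E (fun y ↦ f y * f' y) x := by
  filter_upwards [hf, hf'] with y h1 h2 using h1.mul h2

theorem neg (hf : SmoothFnAt E f x) : SmoothFnAt E (fun y ↦ - f y) x := by
  filter_upwards [hf] with y h1 using h1.neg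

theorem sub (hf : SmoothFnAt E f x) (hf' : SmoothFnAt E f' x) :
    SmoothFnAt E (fun y ↦ f y - f' y) x := by
  filter_upwards [hf, hf'] with y h1 h2 using h1.sub h2

theorem sum {ι : Type*} {s : Finset ι} {F : ι → M → ℝ} (h : ∀ i ∈ s, SmoothFnAt E (F i) x) :
    SmoothFnAt E (fun y ↦ ∑ i ∈ s, F i y) x := by
  filter_upwards [(Finset.eventually_all s).2 h] with y hy
  exact contMDiffAt_finsetSum hy

theorem prod {ι : Type*} {s : Finset ι} {F : ι → M → ℝ} (h : ∀ i ∈ s, SmoothFnAt E (F i) x) :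
    SmoothFnAt E (fun y ↦ ∏ i ∈ s, F i y) x := by
  filter_upwards [(Finset.eventually_all s).2 h] with y hy
  exact contMDiffAt_finsetProd hy

theorem comp {φ : ℝ → ℝ} (hf : SmoothFnAt E f x) (hφ : ∀ᶠ y in 𝓝 x, ContDiffAt ℝ ∞ φ (f y)) :
    SmoothFnAt E (fun y ↦ φ (f y)) x := by
  filter_upwards [hf, hφ] with y h1 h2
  exact h2.contMDiffAt.comp y h1

theorem exp (hf : SmoothFnAt E f x) : SmoothFnAt E (fun y ↦ Real.exp (f y)) x :=
  hf.comp (Eventually.of_forall fun _ ↦ Real.contDiff_exp.contDiffAt)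

theorem inv (hf : SmoothFnAt E f x) (h0 : f x ≠ 0) : SmoothFnAt E (fun y ↦ (f y)⁻¹) x :=
  hf.comp ((hf.contMDiffAt.continuousAt.eventually_ne h0).mono fun _ hy ↦ contDiffAt_inv ℝ hy)

theorem continuousAt (hf : SmoothFnAt E f x) : ContinuousAt f x := hf.contMDiffAt.continuousAt

end SmoothFnAt

namespace SmoothFieldAt

theorem contMDiffAt (hX : SmoothFieldAt X x) :
    ContMDiffAt 𝓘(ℝ, E) (𝓘(ℝ, E).prod 𝓘(ℝ, E)) ∞
      (fun x ↦ Bundle.TotalSpace.mk' E (E := TangentSpace 𝓘(ℝ, E)) x (X x)) x :=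
  hX.self_of_nhds

theorem mdifferentiableAt (hX : SmoothFieldAt X x) :
    MDifferentiableAt 𝓘(ℝ, E) (𝓘(ℝ, E).prod 𝓘(ℝ, E))
      (fun x ↦ Bundle.TotalSpace.mk' E (E := TangentSpace 𝓘(ℝ, E)) x (X x)) x :=
  hX.contMDiffAt.mdifferentiableAt (by simp)

theorem eventually (hX : SmoothFieldAt X x) : ∀ᶠ y in 𝓝 x, SmoothFieldAt X y :=
  eventually_eventually_nhds.2 hX

theorem congr (hX : SmoothFieldAt X x) (h : Y =ᶠ[𝓝 x] X) : SmoothFieldAt Y x := by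
  filter_upwards [hX, h.eventually_nhds] with y h1 h2
  exact h1.congr_of_eventuallyEq (h2.mono fun z hz ↦ by simp only [hz])

theorem of_smoothVFieldOn {U : Set M} (hU : IsOpen U) (hx : x ∈ U)
    (hX : SmoothVFieldOn U X) : SmoothFieldAt X x := by
  filter_upwards [hU.mem_nhds hx] with y hy using hX.contMDiffAt (hU.mem_nhds hy)

theorem add (hX : SmoothFieldAt X x) (hY : SmoothFieldAt Y x) :
    SmoothFieldAt (fun y ↦ X y + Y y) x := by
  filter_upwards [hX, hY] with y h1 h2 using h1.add_section h2

theorem sub (hX : SmoothFieldAt X x) (hY : SmoothFieldAt Y x) :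
    SmoothFieldAt (fun y ↦ X y - Y y) x := by
  filter_upwards [hX, hY] with y h1 h2 using h1.sub_section h2

theorem smul (hf : SmoothFnAt E f x) (hX : SmoothFieldAt X x) :
    SmoothFieldAt (fun y ↦ f y • X y) x := by
  filter_upwards [hf, hX] with y h1 h2 using h1.smul_section h2

theorem sum {ι : Type*} {s : Finset ι} {F : ι → VField E M}
    (h : ∀ i ∈ s, SmoothFieldAt (F i) x) : SmoothFieldAt (fun y ↦ ∑ i ∈ s, F i y) x := by
  filter_upwards [(Finset.eventually_all s).2 h] with y hy using ContMDiffAt.sum_section hy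

variable (E) in
theorem zero (x : M) : SmoothFieldAt (fun _ ↦ 0 : VField E M) x :=
  (SmoothFieldAt.sum (s := ∅) (F := fun (i : Empty) (y : M) ↦ (0 : TangentSpace 𝓘(ℝ, E) y))
    (by simp)).congr (by simp; rfl)

theorem mlieBracket (hX : SmoothFieldAt X x) (hY : SmoothFieldAt Y x) :
    SmoothFieldAt (VectorField.mlieBracket 𝓘(ℝ, E) X Y) x := by
  filter_upwards [hX, hY] with y h1 h2
  have : IsManifold 𝓘(ℝ, E) (((⊤ : ℕ∞) : WithTop ℕ∞) + 1) M := by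
    simpa using! (inferInstance : IsManifold 𝓘(ℝ, E) ∞ M)
  have : IsManifold 𝓘(ℝ, E) (minSmoothness ℝ 2) M := by
    simpa using! (inferInstance : IsManifold 𝓘(ℝ, E) 2 M)
  exact ContMDiffAt.mlieBracket_vectorField (m := ⊤) (n := ⊤) h1 h2 (by simp)

end SmoothFieldAt

/-! ### Local extensions of tangent vectors -/

theorem ext_apply_self (v : TangentSpace 𝓘(ℝ, E) x) : ext v x = v := by
  simp [ext]

theorem smoothFieldAt_ext_of_mem (v : TangentSpace 𝓘(ℝ, E) x) {y : M}
    (hy : y ∈ (chartAt E x).source) : SmoothFieldAt (ext v) y := by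
  set t := trivializationAt E (TangentSpace 𝓘(ℝ, E) (M := M)) x with ht
  have hb : t.baseSet = (chartAt E x).source := by simp [ht]
  refine SmoothFieldAt.of_smoothVFieldOn t.open_baseSet (hb ▸ hy) ?_
  refine t.contMDiffOn_section_baseSet_iff.2 ?_
  exact (contMDiffOn_const (c := (t ⟨x, v⟩).2)).congr fun z hz ↦ by
    simp [ext, FiberBundle.extend, ← ht, hz]

theorem smoothFieldAt_ext (v : TangentSpace 𝓘(ℝ, E) x) : SmoothFieldAt (ext v) x :=
  smoothFieldAt_ext_of_mem v (mem_chart_source E x)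

theorem ext_eq_symmL (v : TangentSpace 𝓘(ℝ, E) x) {y : M} (hy : y ∈ (chartAt E x).source) :
    ext v y = (trivializationAt E (TangentSpace 𝓘(ℝ, E)) x).symmL ℝ y
      ((trivializationAt E (TangentSpace 𝓘(ℝ, E)) x).continuousLinearMapAt ℝ x v) := by
  have h := congrFun (Bundle.Trivialization.coe_linearMapAt_of_mem (R := ℝ)
    (trivializationAt E (TangentSpace 𝓘(ℝ, E)) x)
    (FiberBundle.mem_baseSet_trivializationAt' x)) v
  rw [Bundle.Trivialization.continuousLinearMapAt_apply, h,
    Bundle.Trivialization.symmL_apply _ (by simpa using hy)]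
  rfl

/-- The extensions `ext v` are the coordinate vector fields of the chart at `x`. -/
theorem ext_eq_mfderiv_symm (v : TangentSpace 𝓘(ℝ, E) x) {y : M} (hy : y ∈ (chartAt E x).source) :
    ext v y = mfderiv 𝓘(ℝ, E) 𝓘(ℝ, E) (extChartAt 𝓘(ℝ, E) x).symm (extChartAt 𝓘(ℝ, E) x y) v := by
  have h1 := TangentBundle.symmL_trivializationAt (I := 𝓘(ℝ, E)) hy
  have h2 := TangentBundle.continuousLinearMapAt_trivializationAt (I := 𝓘(ℝ, E))
    (mem_chart_source E x)
  rw [ext_eq_symmL _ hy, h1, h2, mfderiv_extChartAt_self]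
  have h3 : Set.range 𝓘(ℝ, E) = Set.univ := by simp
  rw [h3, mfderivWithin_univ]
  rfl

/-! ### Directional derivatives -/

theorem dirDeriv_add_vec (f : M → ℝ) (x : M) (v w : TangentSpace 𝓘(ℝ, E) x) :
    dirDeriv f x (v + w) = dirDeriv f x v + dirDeriv f x w := map_add _ _ _

theorem dirDeriv_smul_vec (f : M → ℝ) (x : M) (c : ℝ) (v : TangentSpace 𝓘(ℝ, E) x) :
    dirDeriv f x (c • v) = c * dirDeriv f x v := map_smul (mvfderiv 𝓘(ℝ, E) f x) c v

theorem dirDeriv_congr (h : f =ᶠ[𝓝 x] f') (v : TangentSpace 𝓘(ℝ, E) x) :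
    dirDeriv f x v = dirDeriv f' x v := by
  have := h.mfderiv_eq (I := 𝓘(ℝ, E)) (I' := 𝓘(ℝ, ℝ))
  exact congrArg (fun L : TangentSpace 𝓘(ℝ, E) x →L[ℝ] ℝ ↦ L v) this

theorem dirDeriv_add (hf : SmoothFnAt E f x) (hf' : SmoothFnAt E f' x)
    (v : TangentSpace 𝓘(ℝ, E) x) :
    dirDeriv (fun y ↦ f y + f' y) x v = dirDeriv f x v + dirDeriv f' x v := by
  unfold dirDeriv
  rw [mvfderiv_fun_add hf.mdifferentiableAt hf'.mdifferentiableAt]; rfl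

theorem dirDeriv_sub (hf : SmoothFnAt E f x) (hf' : SmoothFnAt E f' x)
    (v : TangentSpace 𝓘(ℝ, E) x) :
    dirDeriv (fun y ↦ f y - f' y) x v = dirDeriv f x v - dirDeriv f' x v := by
  unfold dirDeriv
  rw [mvfderiv_fun_sub hf.mdifferentiableAt hf'.mdifferentiableAt]; rfl

theorem dirDeriv_mul (hf : SmoothFnAt E f x) (hf' : SmoothFnAt E f' x)
    (v : TangentSpace 𝓘(ℝ, E) x) :
    dirDeriv (fun y ↦ f y * f' y) x v = f x * dirDeriv f' x v + f' x * dirDeriv f x v := by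
  unfold dirDeriv
  rw [mvfderiv_fun_mul hf.mdifferentiableAt hf'.mdifferentiableAt]; rfl

theorem dirDeriv_const (c : ℝ) (v : TangentSpace 𝓘(ℝ, E) x) :
    dirDeriv (fun _ ↦ c) x v = 0 := by
  unfold dirDeriv
  rw [mvfderiv_const]; rfl

theorem dirDeriv_comp {φ : ℝ → ℝ} {φ' : ℝ} (hφ : HasDerivAt φ φ' (f x)) (hf : SmoothFnAt E f x)
    (v : TangentSpace 𝓘(ℝ, E) x) :
    dirDeriv (fun y ↦ φ (f y)) x v = φ' * dirDeriv f x v := by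
  have h := mfderiv_comp_apply (I := 𝓘(ℝ, E)) (I' := 𝓘(ℝ, ℝ)) (I'' := 𝓘(ℝ, ℝ)) x
    (hφ.differentiableAt.mdifferentiableAt) hf.mdifferentiableAt v
  rw [mfderiv_eq_fderiv, hφ.hasFDerivAt.fderiv] at h
  refine Eq.trans h ?_
  change dirDeriv f x v * φ' = _
  exact mul_comm _ _

theorem SmoothFnAt.dirDeriv (hf : SmoothFnAt E f x) (hV : SmoothFieldAt V x) :
    SmoothFnAt E (fun y ↦ dirDeriv f y (V y)) x := by
  filter_upwards [hf, hV] with y h1 h2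
  have h3 := ContMDiffAt.clm_apply_of_inCoordinates
    (ContMDiffAt.mfderiv_const (m := ∞) (n := ∞) h1 (by simp)) h2 h1
  exact (contMDiff_snd_tangentBundle_modelSpace ℝ 𝓘(ℝ, ℝ)).contMDiffAt.comp y h3

theorem dirDeriv_ext {f : M → ℝ} (v : TangentSpace 𝓘(ℝ, E) x) {y : M}
    (hy : y ∈ (chartAt E x).source) (hf : MDifferentiableAt 𝓘(ℝ, E) 𝓘(ℝ, ℝ) f y) :
    dirDeriv f y (ext v y)
      = fderiv ℝ (fun z ↦ f ((extChartAt 𝓘(ℝ, E) x).symm z)) (extChartAt 𝓘(ℝ, E) x y) v := by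
  have hy' : y ∈ (extChartAt 𝓘(ℝ, E) x).source := by simpa using hy
  have hyt := (extChartAt 𝓘(ℝ, E) x).map_source hy'
  have hl := (extChartAt 𝓘(ℝ, E) x).left_inv hy'
  have h2 : MDifferentiableAt 𝓘(ℝ, E) 𝓘(ℝ, E) (extChartAt 𝓘(ℝ, E) x).symm
      (extChartAt 𝓘(ℝ, E) x y) :=
    ((contMDiffOn_extChartAt_symm (n := ∞) (I := 𝓘(ℝ, E)) x).contMDiffAt
      (extChartAt_target_mem_nhds' hyt)).mdifferentiableAt (by simp)
  rw [ext_eq_mfderiv_symm v hy]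
  have h := mfderiv_comp_apply_of_eq (I := 𝓘(ℝ, E)) (I' := 𝓘(ℝ, E)) (I'' := 𝓘(ℝ, ℝ))
    (extChartAt 𝓘(ℝ, E) x y) hf h2 hl v
  rw [mfderiv_eq_fderiv, hl] at h
  exact h.symm

/-- The coordinate vector fields `ext u` and `ext v` commute. -/
theorem mlieBracket_ext (u v : TangentSpace 𝓘(ℝ, E) x) {y : M} (hy : y ∈ (chartAt E x).source) :
    VectorField.mlieBracket 𝓘(ℝ, E) (ext u) (ext v) y = 0 := by
  have key (w : TangentSpace 𝓘(ℝ, E) x) : ext w =ᶠ[𝓝 y]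
      VectorField.mpullback 𝓘(ℝ, E) 𝓘(ℝ, E) (extChartAt 𝓘(ℝ, E) x) (fun _ ↦ w) := by
    filter_upwards [(chartAt E x).open_source.mem_nhds hy] with z hz
    have hz' : z ∈ (extChartAt 𝓘(ℝ, E) x).source := by simpa using hz
    have h1 := mfderiv_extChartAt_comp_mfderivWithin_extChartAt_symm' (I := 𝓘(ℝ, E)) hz'
    have h2 := mfderivWithin_extChartAt_symm_comp_mfderiv_extChartAt' (I := 𝓘(ℝ, E)) hz'
    have h3 : Set.range 𝓘(ℝ, E) = Set.univ := by simp
    rw [h3, mfderivWithin_univ] at h1 h2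
    refine (ext_eq_mfderiv_symm w hz).trans ?_
    exact congrArg (fun L : E →L[ℝ] TangentSpace 𝓘(ℝ, E) z ↦ L w)
      (ContinuousLinearMap.inverse_eq h1 h2).symm
  have : IsManifold 𝓘(ℝ, E) (minSmoothness ℝ 2) M := by
    simpa using! (inferInstance : IsManifold 𝓘(ℝ, E) 2 M)
  have : IsManifold 𝓘(ℝ, E) (minSmoothness ℝ 2) E := by
    simpa using! (inferInstance : IsManifold 𝓘(ℝ, E) 2 E)
  rw [(key u).mlieBracket_vectorField_eq (key v)]
  have hs (w : E) : MDifferentiableAt 𝓘(ℝ, E) (𝓘(ℝ, E).prod 𝓘(ℝ, E))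
      (fun x : E ↦ Bundle.TotalSpace.mk' E (E := TangentSpace 𝓘(ℝ, E)) x w)
      (extChartAt 𝓘(ℝ, E) x y) := by
    exact (contMDiffAt_vectorSpace_iff_contDiffAt (n := 1) (V := fun _ : E ↦ w)).2
      contDiffAt_const |>.mdifferentiableAt one_ne_zero
  rw [← VectorField.mpullback_mlieBracket (n := ∞) (hs u) (hs v)
    (contMDiffAt_extChartAt' hy) (by simp; exact WithTop.coe_le_coe.2 le_top)]
  have h0 (u v : E) : VectorField.mlieBracket 𝓘(ℝ, E)
      (fun _ ↦ u : (z : E) → TangentSpace 𝓘(ℝ, E) z) (fun _ ↦ v)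
      (extChartAt 𝓘(ℝ, E) x y) = 0 := by
    have := congrFun (VectorField.mlieBracketWithin_eq_lieBracketWithin (𝕜 := ℝ)
      (V := (fun _ ↦ u : (z : E) → TangentSpace 𝓘(ℝ, E) z)) (W := fun _ ↦ v)
      (s := Set.univ)) (extChartAt 𝓘(ℝ, E) x y)
    rw [VectorField.lieBracketWithin_univ] at this
    refine Eq.trans this ?_
    change fderiv ℝ (fun _ : E ↦ v) _ u - fderiv ℝ (fun _ : E ↦ u) _ v = 0
    simp
  exact (congrArg (mfderiv 𝓘(ℝ, E) 𝓘(ℝ, E) (extChartAt 𝓘(ℝ, E) x) y).inverse (h0 u v)).trans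
    (map_zero _)

/-! ### Tensoriality -/

/-- The extensions of a basis form a local frame: a smooth field has smooth coefficients in it. -/
theorem exists_coeff_ext (hX : SmoothFieldAt X x) :
    ∃ c : Fin (Module.finrank ℝ E) → M → ℝ, (∀ i, SmoothFnAt E (c i) x) ∧
      X =ᶠ[𝓝 x] (fun y ↦ ∑ i, c i y • ext (tbasis x i) y : VField E M) := by
  set t := trivializationAt E (TangentSpace 𝓘(ℝ, E) (M := M)) x with ht
  have hb : t.baseSet = (chartAt E x).source := by simp [ht]
  have hmem : ∀ᶠ y in 𝓝 x, y ∈ t.baseSet := by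
    rw [hb]; exact (chartAt E x).open_source.mem_nhds (mem_chart_source E x)
  set b := Module.finBasis ℝ E
  have : IsManifold 𝓘(ℝ, E) (∞ + 1) M := by
    simpa using! (inferInstance : IsManifold 𝓘(ℝ, E) ∞ M)
  refine ⟨fun i y ↦ t.localFrameCoeff 𝓘(ℝ, E) b i y (X y), fun i ↦ ?_, ?_⟩
  · filter_upwards [hX, hmem] with y h1 h2
    exact contMDiffAt_localFrameCoeff b h2 h1 i
  · filter_upwards [hmem] with y hy
    refine (Bundle.Trivialization.eq_sum_localFrameCoeff_smul (I := 𝓘(ℝ, E)) (b := b)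
      (s := X) hy).trans ?_
    refine Finset.sum_congr rfl fun i _ ↦ ?_
    congr 1
    rw [Bundle.Trivialization.localFrame_apply_of_mem_baseSet _ _ hy,
      ext_eq_symmL _ (hb ▸ hy), TangentBundle.continuousLinearMapAt_trivializationAt (I := 𝓘(ℝ, E))
        (mem_chart_source E x), mfderiv_extChartAt_self]
    rw [Bundle.Trivialization.basisAt, Module.Basis.map_apply]
    exact (Bundle.Trivialization.symmL_apply t hy (b i)).symm

variable {A : Type*} [AddCommGroup A] [Module ℝ A]

/-- An operation on vector fields that is additive and homogeneous over germs at `x` of smooth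
functions, on vector fields that are smooth near `x`. -/
structure IsTensorialAt (Φ : VField E M → A) (x : M) : Prop where
  smul : ∀ (f : M → ℝ) (X : VField E M), SmoothFnAt E f x → SmoothFieldAt X x →
    Φ (fun y ↦ f y • X y) = f x • Φ X
  add : ∀ X Y : VField E M, SmoothFieldAt X x → SmoothFieldAt Y x →
    Φ (fun y ↦ X y + Y y) = Φ X + Φ Y

namespace IsTensorialAt

variable {Φ : VField E M → A}

theorem congr (hΦ : IsTensorialAt Φ x) (hX : SmoothFieldAt X x) (h : X =ᶠ[𝓝 x] Y) :
    Φ X = Φ Y := by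
  classical
  -- The indicator function of the coincidence set is constant near `x`, hence smooth there.
  set ψ : M → ℝ := fun y ↦ if X y = Y y then 1 else 0
  have h1 : ψ =ᶠ[𝓝 x] fun _ ↦ 1 := h.mono fun y hy ↦ by simp [ψ, hy]
  have hψ : SmoothFnAt E ψ x := (SmoothFnAt.const E 1 x).congr h1
  have hx : ψ x = 1 := h1.self_of_nhds
  have e : (fun y ↦ ψ y • X y) = fun y ↦ ψ y • Y y := by
    funext y
    by_cases hy : X y = Y y <;> simp [ψ, hy]
  have := hΦ.smul ψ X hψ hX
  rw [e, hΦ.smul ψ Y hψ (hX.congr h.symm), hx, one_smul, one_smul] at this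
  exact this.symm

theorem map_zero (hΦ : IsTensorialAt Φ x) : Φ (fun _ ↦ 0) = 0 := by
  simpa using hΦ.smul (fun _ ↦ 0) (fun _ ↦ 0) (SmoothFnAt.const E 0 x) (SmoothFieldAt.zero E x)

theorem map_sum (hΦ : IsTensorialAt Φ x) {ι : Type*} (s : Finset ι) (F : ι → VField E M)
    (hF : ∀ i, SmoothFieldAt (F i) x) : Φ (fun y ↦ ∑ i ∈ s, F i y) = ∑ i ∈ s, Φ (F i) := by
  classical
  induction s using Finset.induction_on with
  | empty => simpa using hΦ.map_zero
  | insert a s ha ih =>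
    simp only [Finset.sum_insert ha]
    rw [hΦ.add _ _ (hF a) (SmoothFieldAt.sum fun i _ ↦ hF i), ih]

/-- A tensorial operation is determined by its values on the coordinate vector fields. -/
theorem eq_sum (hΦ : IsTensorialAt Φ x) (hX : SmoothFieldAt X x) :
    Φ X = ∑ i, (tbasis x).repr (X x) i • Φ (ext (tbasis x i)) := by
  obtain ⟨c, hc, h⟩ := exists_coeff_ext hX
  rw [hΦ.congr hX h, hΦ.map_sum _ _ fun i ↦ (smoothFieldAt_ext _).smul (hc i)]
  refine Finset.sum_congr rfl fun i _ ↦ ?_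
  rw [hΦ.smul _ _ (hc i) (smoothFieldAt_ext _)]
  congr 1
  rw [h.self_of_nhds]
  simp [ext_apply_self, Finsupp.single_apply]

theorem eq_of_apply_eq (hΦ : IsTensorialAt Φ x) (hX : SmoothFieldAt X x) (hY : SmoothFieldAt Y x)
    (h : X x = Y x) : Φ X = Φ Y := by
  rw [hΦ.eq_sum hX, hΦ.eq_sum hY, h]

theorem apply_ext (hΦ : IsTensorialAt Φ x) (hX : SmoothFieldAt X x) : Φ (ext (X x)) = Φ X :=
  hΦ.eq_of_apply_eq (smoothFieldAt_ext _) hX (ext_apply_self _)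

theorem isLinearMap (hΦ : IsTensorialAt Φ x) :
    IsLinearMap ℝ fun v : TangentSpace 𝓘(ℝ, E) x ↦ Φ (ext v) where
  map_add v w := by
    rw [← hΦ.add _ _ (smoothFieldAt_ext v) (smoothFieldAt_ext w)]
    exact hΦ.eq_of_apply_eq (smoothFieldAt_ext _)
      ((smoothFieldAt_ext v).add (smoothFieldAt_ext w)) (by simp [ext_apply_self])
  map_smul c v := by
    rw [← hΦ.smul (fun _ ↦ c) _ (SmoothFnAt.const E c x) (smoothFieldAt_ext v)]
    exact hΦ.eq_of_apply_eq (smoothFieldAt_ext _)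
      ((smoothFieldAt_ext v).smul (SmoothFnAt.const E c x)) (by simp [ext_apply_self])

end IsTensorialAt

/-! ### The Lie bracket as a commutator of derivations -/

theorem mlieBracket_smul_left (hf : SmoothFnAt E f x) (hX : SmoothFieldAt X x) :
    VectorField.mlieBracket 𝓘(ℝ, E) (fun y ↦ f y • X y) Y x
      = -(dirDeriv f x (Y x)) • X x + f x • VectorField.mlieBracket 𝓘(ℝ, E) X Y x := by
  have := VectorField.mlieBracket_smul_left (W := Y) hf.mdifferentiableAt hX.mdifferentiableAt
  exact this

theorem mlieBracket_smul_right (hf : SmoothFnAt E f x) (hY : SmoothFieldAt Y x) :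
    VectorField.mlieBracket 𝓘(ℝ, E) X (fun y ↦ f y • Y y) x
      = dirDeriv f x (X x) • Y x + f x • VectorField.mlieBracket 𝓘(ℝ, E) X Y x := by
  have := VectorField.mlieBracket_smul_right (V := X) hf.mdifferentiableAt hY.mdifferentiableAt
  exact this

theorem mlieBracket_add_left (hX : SmoothFieldAt X x) (hY : SmoothFieldAt Y x) :
    VectorField.mlieBracket 𝓘(ℝ, E) (fun y ↦ X y + Y y) Z x
      = VectorField.mlieBracket 𝓘(ℝ, E) X Z x + VectorField.mlieBracket 𝓘(ℝ, E) Y Z x :=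
  VectorField.mlieBracket_add_left hX.mdifferentiableAt hY.mdifferentiableAt

theorem mlieBracket_add_right (hX : SmoothFieldAt X x) (hY : SmoothFieldAt Y x) :
    VectorField.mlieBracket 𝓘(ℝ, E) Z (fun y ↦ X y + Y y) x
      = VectorField.mlieBracket 𝓘(ℝ, E) Z X x + VectorField.mlieBracket 𝓘(ℝ, E) Z Y x :=
  VectorField.mlieBracket_add_right hX.mdifferentiableAt hY.mdifferentiableAt

theorem dirDeriv_dirDeriv_ext_comm (u v : TangentSpace 𝓘(ℝ, E) x) {y : M}
    (hy : y ∈ (chartAt E x).source) (hfy : SmoothFnAt E f y) :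
    dirDeriv (fun z ↦ dirDeriv f z (ext v z)) y (ext u y)
      = dirDeriv (fun z ↦ dirDeriv f z (ext u z)) y (ext v y) := by
  set e := extChartAt 𝓘(ℝ, E) x with he
  have hy' : y ∈ e.source := by simpa [he] using hy
  have hsymm : ContMDiffAt 𝓘(ℝ, E) 𝓘(ℝ, E) ∞ e.symm (e y) :=
    (contMDiffOn_extChartAt_symm (I := 𝓘(ℝ, E)) x).contMDiffAt
      (extChartAt_target_mem_nhds' (by simpa [he] using e.map_source hy'))
  have hsm : ContDiffAt ℝ ∞ (fun z ↦ f (e.symm z)) (e y) := by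
    have : ContMDiffAt 𝓘(ℝ, E) 𝓘(ℝ, ℝ) ∞ f (e.symm (e y)) := by
      rw [e.left_inv hy']; exact hfy.contMDiffAt
    exact (this.comp (e y) hsymm).contDiffAt
  have key (w w' : TangentSpace 𝓘(ℝ, E) x) :
      dirDeriv (fun z ↦ dirDeriv f z (ext w z)) y (ext w' y)
        = fderiv ℝ (fderiv ℝ (fun z ↦ f (e.symm z))) (e y) w' w := by
    have h1 := smoothFieldAt_ext_of_mem w hy
    rw [dirDeriv_ext w' hy (hfy.dirDeriv h1).mdifferentiableAt]
    have h2 : (fun z ↦ dirDeriv f (e.symm z) (ext w (e.symm z)))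
        =ᶠ[𝓝 (e y)] fun z ↦ fderiv ℝ (fun z ↦ f (e.symm z)) z w := by
      have h3 : ∀ᶠ z in 𝓝 (e y), z ∈ e.target :=
        extChartAt_target_mem_nhds' (by simpa [he] using e.map_source hy')
      have h4 : ∀ᶠ z in 𝓝 (e y), SmoothFnAt E f (e.symm z) := by
        have := hsymm.continuousAt
        rw [ContinuousAt, e.left_inv hy'] at this
        exact this.eventually hfy.eventually
      filter_upwards [h3, h4] with z h3 h4
      have := dirDeriv_ext w (x := x) (y := e.symm z) (by simpa [he] using e.map_target h3)
        h4.mdifferentiableAt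
      rw [e.right_inv h3] at this
      exact this
    rw [h2.fderiv_eq]
    have h5 : DifferentiableAt ℝ (fderiv ℝ (fun z ↦ f (e.symm z))) (e y) :=
      (hsm.fderiv_right (m := 1) (WithTop.coe_le_coe.2 le_top)).differentiableAt one_ne_zero
    have h6 (a b : E) : fderiv ℝ (fun z ↦ fderiv ℝ (fun z ↦ f (e.symm z)) z a) (e y) b
        = fderiv ℝ (fderiv ℝ (fun z ↦ f (e.symm z))) (e y) b a := by
      rw [fderiv_clm_apply h5 (differentiableAt_const a)]
      simp
    exact h6 w w'
  rw [key, key]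
  exact (hsm.isSymmSndFDerivAt (by
    rw [minSmoothness_of_isRCLikeNormedField]; exact WithTop.coe_le_coe.2 le_top)) u v

theorem dirDeriv_mlieBracket (hf : SmoothFnAt E f x) (hU : SmoothFieldAt X x)
    (hV : SmoothFieldAt Y x) :
    dirDeriv f x (VectorField.mlieBracket 𝓘(ℝ, E) X Y x)
      = dirDeriv (fun z ↦ dirDeriv f z (Y z)) x (X x)
        - dirDeriv (fun z ↦ dirDeriv f z (X z)) x (Y x) := by
  set Φ : VField E M → VField E M → ℝ := fun U V ↦
    dirDeriv f x (VectorField.mlieBracket 𝓘(ℝ, E) U V x)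
      - dirDeriv (fun z ↦ dirDeriv f z (V z)) x (U x)
        + dirDeriv (fun z ↦ dirDeriv f z (U z)) x (V x) with hΦ
  have t1 : ∀ V, SmoothFieldAt V x → IsTensorialAt (fun U ↦ Φ U V) x := fun V hV ↦
    { smul := fun h U hh hU ↦ by
        simp only [hΦ, dirDeriv_smul_vec, smul_eq_mul]
        rw [mlieBracket_smul_left hh hU, dirDeriv_mul hh (hf.dirDeriv hU),
          dirDeriv_add_vec, dirDeriv_smul_vec, dirDeriv_smul_vec]
        ring
      add := fun U U' hU hU' ↦ by
        simp only [hΦ, dirDeriv_add_vec]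
        rw [mlieBracket_add_left hU hU', dirDeriv_add (hf.dirDeriv hU) (hf.dirDeriv hU'),
          dirDeriv_add_vec]
        ring }
  have t2 : ∀ U, SmoothFieldAt U x → IsTensorialAt (fun V ↦ Φ U V) x := fun U hU ↦
    { smul := fun h V hh hV ↦ by
        simp only [hΦ, dirDeriv_smul_vec, smul_eq_mul]
        rw [mlieBracket_smul_right hh hV, dirDeriv_mul hh (hf.dirDeriv hV),
          dirDeriv_add_vec, dirDeriv_smul_vec, dirDeriv_smul_vec]
        ring
      add := fun V V' hV hV' ↦ by
        simp only [hΦ, dirDeriv_add_vec]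
        rw [mlieBracket_add_right hV hV', dirDeriv_add (hf.dirDeriv hV) (hf.dirDeriv hV'),
          dirDeriv_add_vec]
        ring }
  have h0 : Φ X Y = 0 := by
    rw [← (t1 Y hV).apply_ext hU, ← (t2 _ (smoothFieldAt_ext _)).apply_ext hV]
    simp only [hΦ]
    rw [mlieBracket_ext _ _ (mem_chart_source E x),
      dirDeriv_dirDeriv_ext_comm _ _ (mem_chart_source E x) hf]
    have : dirDeriv f x (0 : TangentSpace 𝓘(ℝ, E) x) = 0 := _root_.map_zero (mvfderiv 𝓘(ℝ, E) f x)
    rw [this]; ring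
  simp only [hΦ] at h0
  linarith

/-! ### Germs of metrics and the musical isomorphism -/

/-- `g` is a field of nondegenerate symmetric bilinear forms that is smooth near `x`. The algebraic
conditions are imposed at every point, because rescaling by an arbitrary function preserves them;
only the smoothness is local. -/
structure MetricAt (g : BilinField E M) (x : M) : Prop where
  symm : ∀ x v w, g x v w = g x w v
  nondegenerate : ∀ x v, (∀ w, g x v w = 0) → v = 0
  smooth : ∀ᶠ y in 𝓝 x, ContMDiffAt 𝓘(ℝ, E) (𝓘(ℝ, E).prod 𝓘(ℝ, E →L[ℝ] E →L[ℝ] ℝ)) ∞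
    (fun x ↦ Bundle.TotalSpace.mk' (E →L[ℝ] E →L[ℝ] ℝ)
      (E := fun x : M ↦ TangentSpace 𝓘(ℝ, E) x →L[ℝ] TangentSpace 𝓘(ℝ, E) x →L[ℝ] ℝ) x (g x)) y

theorem IsPseudoRiemannian.metricAt (hg : IsPseudoRiemannian g) (x : M) : MetricAt g x :=
  ⟨hg.symm, hg.nondegenerate, Eventually.of_forall fun y ↦ hg.smooth y⟩

namespace MetricAt

theorem eventually (hg : MetricAt g x) : ∀ᶠ y in 𝓝 x, MetricAt g y :=
  hg.smooth.eventually_nhds.mono fun _ hy ↦ ⟨hg.symm, hg.nondegenerate, hy⟩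

theorem smoothFnAt (hg : MetricAt g x) (hX : SmoothFieldAt X x) (hY : SmoothFieldAt Y x) :
    SmoothFnAt E (fun y ↦ g y (X y) (Y y)) x := by
  filter_upwards [hg.smooth, hX, hY] with y h1 h2 h3
  have := ContMDiffAt.clm_bundle_apply₂ (F₃ := ℝ) (E₃ := Bundle.Trivial M ℝ) h1 h2 h3
  exact (Bundle.contMDiffAt_totalSpace.1 this).2

theorem ext_left (hg : MetricAt g x) {v w : TangentSpace 𝓘(ℝ, E) x}
    (h : ∀ z, g x v z = g x w z) : v = w := by
  refine sub_eq_zero.1 (hg.nondegenerate x _ fun z ↦ ?_)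
  rw [map_sub, sub_apply, h z, sub_self]

theorem rescale (hg : MetricAt g x) {Υ : M → ℝ} (hΥ : SmoothFnAt E Υ x) :
    MetricAt (rescale Υ g) x where
  symm x v w := by simp [ConformalTractor.rescale, hg.symm x v w]
  nondegenerate x v h := hg.nondegenerate x v fun w ↦ by
    simpa [ConformalTractor.rescale, (Real.exp_pos _).ne'] using h w
  smooth := by
    have h := ((SmoothFnAt.const E 2 x).mul hΥ).exp
    filter_upwards [hg.smooth, h] with y h1 h2
    exact h2.smul_section h1

theorem isUnit_det_gram (hg : MetricAt g x) : IsUnit (gram g x).det := by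
  rw [isUnit_iff_ne_zero]
  intro h0
  obtain ⟨c, hc, h⟩ := Matrix.exists_vecMul_eq_zero_iff.2 h0
  apply hc
  have h1 : ∑ i, c i • tbasis x i = 0 := by
    refine hg.nondegenerate x _ fun w ↦ ?_
    have h2 : (g x (∑ i, c i • tbasis x i) : TangentSpace 𝓘(ℝ, E) x →ₗ[ℝ] ℝ) = 0 := by
      refine (tbasis x).ext fun j ↦ ?_
      have := congrFun h j
      simpa [Matrix.vecMul, dotProduct, gram] using this
    exact LinearMap.congr_fun h2 w
  funext i
  exact Fintype.linearIndependent_iff.1 (tbasis x).linearIndependent c h1 i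

theorem apply_raise (hg : MetricAt g x) {α : TangentSpace 𝓘(ℝ, E) x → ℝ} (hα : IsLinearMap ℝ α)
    (w : TangentSpace 𝓘(ℝ, E) x) : g x (raise g x α) w = α w := by
  have h2 : (g x (raise g x α) : TangentSpace 𝓘(ℝ, E) x →ₗ[ℝ] ℝ) = hα.mk' α := by
    refine (tbasis x).ext fun k ↦ ?_
    have hG : (gram g x)⁻¹.transpose = (gram g x)⁻¹ := by
      rw [Matrix.transpose_nonsing_inv]
      congr 1
      ext i j
      exact hg.symm x _ _
    have h1 : g x (raise g x α) (tbasis x k)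
        = ∑ j, α (tbasis x j) * ((gram g x)⁻¹ * gram g x) j k := by
      simp only [raise, map_sum, map_smul, sum_apply,
        smul_apply, smul_eq_mul, Matrix.mul_apply, Finset.mul_sum]
      rw [Finset.sum_comm]
      refine Finset.sum_congr rfl fun j _ ↦ Finset.sum_congr rfl fun i _ ↦ ?_
      have : (gram g x)⁻¹ i j = (gram g x)⁻¹ j i := congrFun (congrFun hG j) i
      rw [this, gram, Matrix.of_apply]; ring
    rw [Matrix.nonsing_inv_mul _ hg.isUnit_det_gram] at h1
    simpa [Matrix.one_apply] using h1
  exact LinearMap.congr_fun h2 w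

theorem eq_raise (hg : MetricAt g x) {α : TangentSpace 𝓘(ℝ, E) x → ℝ} (hα : IsLinearMap ℝ α)
    {v : TangentSpace 𝓘(ℝ, E) x} (h : ∀ w, g x v w = α w) : v = raise g x α :=
  hg.ext_left fun z ↦ by rw [h, hg.apply_raise hα]

end MetricAt

theorem smoothFnAt_det {n : ℕ} {A : Fin n → Fin n → M → ℝ} (hA : ∀ i j, SmoothFnAt E (A i j) x) :
    SmoothFnAt E (fun y ↦ (Matrix.of fun i j ↦ A i j y).det) x := by
  simp only [Matrix.det_apply', Matrix.of_apply]
  exact SmoothFnAt.sum fun σ _ ↦ (SmoothFnAt.const E _ x).mul (SmoothFnAt.prod fun i _ ↦ hA _ _)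

theorem smoothFnAt_inv {n : ℕ} {A : Fin n → Fin n → M → ℝ} (hA : ∀ i j, SmoothFnAt E (A i j) x)
    (h0 : (Matrix.of fun i j ↦ A i j x).det ≠ 0) (k l : Fin n) :
    SmoothFnAt E (fun y ↦ (Matrix.of fun i j ↦ A i j y)⁻¹ k l) x := by
  simp only [Matrix.inv_def, Ring.inverse_eq_inv', Matrix.smul_apply, smul_eq_mul,
    Matrix.adjugate_apply]
  refine ((smoothFnAt_det hA).inv h0).mul ?_
  have h : ∀ y, (Matrix.of fun i j ↦ A i j y).updateRow l (Pi.single k 1)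
      = Matrix.of fun i j ↦
          (if i = l then (fun _ ↦ (Pi.single k 1 : Fin n → ℝ) j) else A i j) y := by
    intro y
    ext i j
    by_cases hi : i = l <;> simp [Matrix.updateRow_apply, hi]
  simp only [h]
  refine smoothFnAt_det (A := fun i j ↦ if i = l then (fun _ ↦ (Pi.single k 1 : Fin n → ℝ) j)
    else A i j) fun i j ↦ ?_
  by_cases hi : i = l
  · simpa [hi] using SmoothFnAt.const E _ x
  · simpa [hi] using hA i j

/-- The coordinate vector fields of the chart at `x` form a frame near `x`. -/
theorem eventually_span_ext (x : M) : ∀ᶠ y in 𝓝 x,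
    ∃ b : Module.Basis (Fin (Module.finrank ℝ E)) ℝ (TangentSpace 𝓘(ℝ, E) y),
      ∀ i, b i = ext (tbasis x i) y := by
  filter_upwards [(chartAt E x).open_source.mem_nhds (mem_chart_source E x)] with y hy
  set t := trivializationAt E (TangentSpace 𝓘(ℝ, E) (M := M)) x with ht
  have hb : t.baseSet = (chartAt E x).source := by simp [ht]
  have hy' : y ∈ t.baseSet := hb ▸ hy
  refine ⟨(Module.finBasis ℝ E).map (t.linearEquivAt (R := ℝ) y hy').symm, fun i ↦ ?_⟩
  rw [ext_eq_symmL _ hy, TangentBundle.continuousLinearMapAt_trivializationAt (I := 𝓘(ℝ, E))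
        (mem_chart_source E x), mfderiv_extChartAt_self, Module.Basis.map_apply]
  exact (Bundle.Trivialization.symmL_apply t hy' (Module.finBasis ℝ E i)).symm

theorem MetricAt.smoothFieldAt_raise (hg : MetricAt g x)
    {α : (y : M) → TangentSpace 𝓘(ℝ, E) y → ℝ} (hα : ∀ᶠ y in 𝓝 x, IsLinearMap ℝ (α y))
    (h : ∀ Z, SmoothFieldAt Z x → SmoothFnAt E (fun y ↦ α y (Z y)) x) :
    SmoothFieldAt (fun y ↦ raise g y (α y)) x := by
  set F : Fin (Module.finrank ℝ E) → VField E M := fun i ↦ ext (tbasis x i) with hF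
  have hFs : ∀ i, SmoothFieldAt (F i) x := fun i ↦ smoothFieldAt_ext _
  set A : Fin (Module.finrank ℝ E) → Fin (Module.finrank ℝ E) → M → ℝ :=
    fun i j y ↦ g y (F i y) (F j y) with hA
  have hAs : ∀ i j, SmoothFnAt E (A i j) x := fun i j ↦ hg.smoothFnAt (hFs i) (hFs j)
  have hdet : (Matrix.of fun i j ↦ A i j x).det ≠ 0 := by
    have : (Matrix.of fun i j ↦ A i j x) = gram g x := by
      ext i j; simp [A, F, gram, ext_apply_self]
    rw [this]; exact hg.isUnit_det_gram.ne_zero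
  have key : (fun y ↦ raise g y (α y)) =ᶠ[𝓝 x]
      (fun y ↦ ∑ i, (∑ j, (Matrix.of fun i j ↦ A i j y)⁻¹ i j * α y (F j y)) • F i y :
        VField E M) := by
    filter_upwards [hα, eventually_span_ext (E := E) x, hg.eventually,
      (smoothFnAt_det hAs).continuousAt.eventually_ne hdet] with y h1 h2 h3 h4
    obtain ⟨b, hb⟩ := h2
    refine (h3.eq_raise h1 fun w ↦ ?_).symm
    have h5 : (g y (∑ i, (∑ j, (Matrix.of fun i j ↦ A i j y)⁻¹ i j * α y (F j y)) • F i y) :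
        TangentSpace 𝓘(ℝ, E) y →ₗ[ℝ] ℝ) = h1.mk' _ := by
      refine b.ext fun k ↦ ?_
      have hG : (Matrix.of fun i j ↦ A i j y)⁻¹.transpose = (Matrix.of fun i j ↦ A i j y)⁻¹ := by
        rw [Matrix.transpose_nonsing_inv]
        congr 1
        ext i j
        exact hg.symm y _ _
      have h6 : g y (∑ i, (∑ j, (Matrix.of fun i j ↦ A i j y)⁻¹ i j * α y (F j y)) • F i y) (b k)
          = ∑ j, α y (F j y)
            * ((Matrix.of fun i j ↦ A i j y)⁻¹ * (Matrix.of fun i j ↦ A i j y)) j k := by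
        simp only [hb, map_sum, map_smul, sum_apply,
          smul_apply, smul_eq_mul, Matrix.mul_apply, Finset.mul_sum,
          Finset.sum_mul]
        rw [Finset.sum_comm]
        refine Finset.sum_congr rfl fun j _ ↦ Finset.sum_congr rfl fun i _ ↦ ?_
        have : (Matrix.of fun i j ↦ A i j y)⁻¹ i j = (Matrix.of fun i j ↦ A i j y)⁻¹ j i :=
          congrFun (congrFun hG j) i
        rw [this]; simp only [A, Matrix.of_apply, F]; ring
      rw [Matrix.nonsing_inv_mul _ (isUnit_iff_ne_zero.2 h4)] at h6
      simp only [ContinuousLinearMap.coe_coe, IsLinearMap.mk'_apply]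
      rw [h6, hb]
      simp [Matrix.one_apply, F]
    exact LinearMap.congr_fun h5 w
  refine SmoothFieldAt.congr ?_ key
  exact SmoothFieldAt.sum fun i _ ↦ (hFs i).smul (SmoothFnAt.sum fun j _ ↦
    (smoothFnAt_inv hAs hdet i j).mul (h _ (hFs j)))

/-! ### The Levi-Civita connection -/

theorem dirDeriv_metric_smul_left (hg : MetricAt g x) (hf : SmoothFnAt E f x)
    (hX : SmoothFieldAt X x) (hY : SmoothFieldAt Y x) (v : TangentSpace 𝓘(ℝ, E) x) :
    dirDeriv (fun y ↦ g y (f y • X y) (Y y)) x v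
      = f x * dirDeriv (fun y ↦ g y (X y) (Y y)) x v + g x (X x) (Y x) * dirDeriv f x v := by
  rw [← dirDeriv_mul hf (hg.smoothFnAt hX hY)]
  simp

theorem dirDeriv_metric_smul_right (hg : MetricAt g x) (hf : SmoothFnAt E f x)
    (hX : SmoothFieldAt X x) (hY : SmoothFieldAt Y x) (v : TangentSpace 𝓘(ℝ, E) x) :
    dirDeriv (fun y ↦ g y (X y) (f y • Y y)) x v
      = f x * dirDeriv (fun y ↦ g y (X y) (Y y)) x v + g x (X x) (Y x) * dirDeriv f x v := by
  rw [← dirDeriv_mul hf (hg.smoothFnAt hX hY)]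
  simp

theorem dirDeriv_metric_add_left (hg : MetricAt g x) (hX : SmoothFieldAt X x)
    (hY : SmoothFieldAt Y x) (hZ : SmoothFieldAt Z x) (v : TangentSpace 𝓘(ℝ, E) x) :
    dirDeriv (fun y ↦ g y (X y + Y y) (Z y)) x v
      = dirDeriv (fun y ↦ g y (X y) (Z y)) x v + dirDeriv (fun y ↦ g y (Y y) (Z y)) x v := by
  rw [← dirDeriv_add (hg.smoothFnAt hX hZ) (hg.smoothFnAt hY hZ)]
  simp

theorem dirDeriv_metric_add_right (hg : MetricAt g x) (hX : SmoothFieldAt X x)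
    (hY : SmoothFieldAt Y x) (hZ : SmoothFieldAt Z x) (v : TangentSpace 𝓘(ℝ, E) x) :
    dirDeriv (fun y ↦ g y (Z y) (X y + Y y)) x v
      = dirDeriv (fun y ↦ g y (Z y) (X y)) x v + dirDeriv (fun y ↦ g y (Z y) (Y y)) x v := by
  rw [← dirDeriv_add (hg.smoothFnAt hZ hX) (hg.smoothFnAt hZ hY)]
  simp

theorem MetricAt.isTensorialAt_koszul_left (hg : MetricAt g x) (hX : SmoothFieldAt X x)
    (hZ : SmoothFieldAt Z x) : IsTensorialAt (fun V ↦ koszul g V X Z x) x where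
  smul f V hf hV := by
    simp only [koszul]
    rw [dirDeriv_metric_smul_left hg hf hV hZ, dirDeriv_metric_smul_left hg hf hV hX,
      mlieBracket_smul_left hf hV, mlieBracket_smul_left hf hV]
    simp only [dirDeriv_smul_vec, map_add, map_smul, map_neg, add_apply,
      smul_apply, smul_eq_mul, neg_smul, neg_apply]
    rw [hg.symm x (V x) (X x), hg.symm x (V x) (Z x)]
    ring
  add V V' hV hV' := by
    simp only [koszul]
    rw [dirDeriv_metric_add_left hg hV hV' hZ, dirDeriv_metric_add_left hg hV hV' hX,
      mlieBracket_add_left hV hV', mlieBracket_add_left hV hV']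
    simp only [dirDeriv_add_vec, map_add, add_apply]
    ring

theorem MetricAt.isTensorialAt_koszul_right (hg : MetricAt g x) (hV : SmoothFieldAt V x)
    (hX : SmoothFieldAt X x) : IsTensorialAt (fun Z ↦ koszul g V X Z x) x where
  smul f Z hf hZ := by
    simp only [koszul]
    rw [dirDeriv_metric_smul_right hg hf hX hZ, dirDeriv_metric_smul_right hg hf hV hZ,
      mlieBracket_smul_right hf hZ, mlieBracket_smul_right hf hZ]
    simp only [dirDeriv_smul_vec, map_add, map_smul, add_apply, smul_apply, smul_eq_mul]
    rw [hg.symm x (Z x) (X x), hg.symm x (Z x) (V x)]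
    ring
  add Z Z' hZ hZ' := by
    simp only [koszul]
    rw [dirDeriv_metric_add_right hg hZ hZ' hX, dirDeriv_metric_add_right hg hZ hZ' hV,
      mlieBracket_add_right hZ hZ', mlieBracket_add_right hZ hZ']
    simp only [dirDeriv_add_vec, map_add, add_apply]
    ring

/-- The Koszul formula, for vector fields instead of the local extensions in `nabla`. -/
theorem MetricAt.koszul_formula (hg : MetricAt g x) (hV : SmoothFieldAt V x)
    (hX : SmoothFieldAt X x) (hZ : SmoothFieldAt Z x) :
    g x (nabla g X x (V x)) (Z x) = koszul g V X Z x := by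
  rw [nabla, hg.apply_raise (hg.isTensorialAt_koszul_right (smoothFieldAt_ext _) hX).isLinearMap,
    (hg.isTensorialAt_koszul_right (smoothFieldAt_ext _) hX).apply_ext hZ]
  exact (hg.isTensorialAt_koszul_left hX hZ).apply_ext hV

theorem dirDeriv_isLinearMap (f : M → ℝ) (x : M) :
    IsLinearMap ℝ (dirDeriv f x : TangentSpace 𝓘(ℝ, E) x → ℝ) :=
  ⟨dirDeriv_add_vec f x, dirDeriv_smul_vec f x⟩

namespace MetricAt

theorem nabla_apply (hg : MetricAt g x) (hX : SmoothFieldAt X x) (v z : TangentSpace 𝓘(ℝ, E) x) :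
    g x (nabla g X x v) z = koszul g (ext v) X (ext z) x := by
  simpa [ext_apply_self] using
    hg.koszul_formula (smoothFieldAt_ext v) hX (smoothFieldAt_ext z)

theorem nabla_isLinearMap (hg : MetricAt g x) (hX : SmoothFieldAt X x) :
    IsLinearMap ℝ (nabla g X x) where
  map_add v w := hg.ext_left fun z ↦ by
    rw [map_add, add_apply, hg.nabla_apply hX, hg.nabla_apply hX, hg.nabla_apply hX]
    exact (hg.isTensorialAt_koszul_left hX (smoothFieldAt_ext z)).isLinearMap.map_add v w
  map_smul c v := hg.ext_left fun z ↦ by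
    rw [map_smul, smul_apply, hg.nabla_apply hX, hg.nabla_apply hX]
    exact (hg.isTensorialAt_koszul_left hX (smoothFieldAt_ext z)).isLinearMap.map_smul c v

theorem nabla_add_vec (hg : MetricAt g x) (hX : SmoothFieldAt X x)
    (v w : TangentSpace 𝓘(ℝ, E) x) :
    nabla g X x (v + w) = nabla g X x v + nabla g X x w :=
  (hg.nabla_isLinearMap hX).map_add v w

theorem nabla_smul_vec (hg : MetricAt g x) (hX : SmoothFieldAt X x) (c : ℝ)
    (v : TangentSpace 𝓘(ℝ, E) x) : nabla g X x (c • v) = c • nabla g X x v :=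
  (hg.nabla_isLinearMap hX).map_smul c v

theorem nabla_zero_vec (hg : MetricAt g x) (hX : SmoothFieldAt X x) : nabla g X x 0 = 0 :=
  (hg.nabla_isLinearMap hX).map_zero

theorem nabla_add (hg : MetricAt g x) (hX : SmoothFieldAt X x) (hY : SmoothFieldAt Y x)
    (v : TangentSpace 𝓘(ℝ, E) x) :
    nabla g (fun y ↦ X y + Y y) x v = nabla g X x v + nabla g Y x v := hg.ext_left fun z ↦ by
  rw [map_add, add_apply, hg.nabla_apply hX, hg.nabla_apply hY, hg.nabla_apply (hX.add hY)]
  have hv := smoothFieldAt_ext v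
  have hz := smoothFieldAt_ext z
  simp only [koszul]
  rw [dirDeriv_metric_add_left hg hX hY hz, dirDeriv_metric_add_right hg hX hY hv,
    mlieBracket_add_left hX hY, mlieBracket_add_right hX hY]
  simp only [dirDeriv_add_vec, map_add, add_apply]
  ring

theorem nabla_smul (hg : MetricAt g x) (hf : SmoothFnAt E f x) (hX : SmoothFieldAt X x)
    (v : TangentSpace 𝓘(ℝ, E) x) :
    nabla g (fun y ↦ f y • X y) x v = dirDeriv f x v • X x + f x • nabla g X x v :=
  hg.ext_left fun z ↦ by
  rw [map_add, add_apply, map_smul, map_smul, smul_apply, smul_apply, hg.nabla_apply hX,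
    hg.nabla_apply (hX.smul hf)]
  have hv := smoothFieldAt_ext v
  have hz := smoothFieldAt_ext z
  simp only [koszul]
  rw [dirDeriv_metric_smul_left hg hf hX hz, dirDeriv_metric_smul_right hg hf hv hX,
    mlieBracket_smul_left hf hX, mlieBracket_smul_right hf hX]
  simp only [dirDeriv_smul_vec, map_add, map_smul, map_neg, add_apply,
      smul_apply, smul_eq_mul, neg_smul, neg_apply, ext_apply_self]
  rw [hg.symm x v (X x)]
  ring

theorem nabla_neg (hg : MetricAt g x) (hX : SmoothFieldAt X x) (v : TangentSpace 𝓘(ℝ, E) x) :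
    nabla g (fun y ↦ -X y) x v = -nabla g X x v := by
  have := hg.nabla_smul (SmoothFnAt.const E (-1) x) hX v
  simpa [dirDeriv_const] using this

theorem nabla_sub (hg : MetricAt g x) (hX : SmoothFieldAt X x) (hY : SmoothFieldAt Y x)
    (v : TangentSpace 𝓘(ℝ, E) x) :
    nabla g (fun y ↦ X y - Y y) x v = nabla g X x v - nabla g Y x v := by
  have hY' : SmoothFieldAt (fun y ↦ -Y y) x := by
    simpa using hY.smul (SmoothFnAt.const E (-1) x)
  simp only [sub_eq_add_neg]
  rw [hg.nabla_add hX hY', hg.nabla_neg hY]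

theorem nabla_congr (hg : MetricAt g x) (hX : SmoothFieldAt X x) (h : X =ᶠ[𝓝 x] Y)
    (v : TangentSpace 𝓘(ℝ, E) x) : nabla g X x v = nabla g Y x v := hg.ext_left fun z ↦ by
  rw [hg.nabla_apply hX, hg.nabla_apply (hX.congr h.symm)]
  have h1 : (fun y ↦ g y (X y) (ext z y)) =ᶠ[𝓝 x] fun y ↦ g y (Y y) (ext z y) :=
    h.mono fun y hy ↦ by simp only [hy]
  have h2 : (fun y ↦ g y (ext v y) (X y)) =ᶠ[𝓝 x] fun y ↦ g y (ext v y) (Y y) :=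
    h.mono fun y hy ↦ by simp only [hy]
  have hr : (ext v : VField E M) =ᶠ[𝓝 x] ext v := EventuallyEq.rfl
  have hr' : (ext z : VField E M) =ᶠ[𝓝 x] ext z := EventuallyEq.rfl
  simp only [koszul]
  rw [dirDeriv_congr h1, dirDeriv_congr h2, h.self_of_nhds,
    hr.mlieBracket_vectorField_eq h, h.mlieBracket_vectorField_eq hr']

theorem dirDeriv_metric (hg : MetricAt g x) (hX : SmoothFieldAt X x) (hY : SmoothFieldAt Y x)
    (v : TangentSpace 𝓘(ℝ, E) x) :
    dirDeriv (fun y ↦ g y (X y) (Y y)) x v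
      = g x (nabla g X x v) (Y x) + g x (X x) (nabla g Y x v) := by
  have hv := smoothFieldAt_ext v
  have h1 := hg.koszul_formula hv hX hY
  have h2 := hg.koszul_formula hv hY hX
  rw [ext_apply_self] at h1 h2
  rw [h1, hg.symm x (X x), h2]
  simp only [koszul, ext_apply_self]
  rw [VectorField.mlieBracket_swap_apply (V := Y) (W := X)]
  simp only [fun y ↦ hg.symm y (Y y) (X y), map_neg, neg_apply]
  ring

theorem nabla_sub_nabla (hg : MetricAt g x) (hX : SmoothFieldAt X x) (hY : SmoothFieldAt Y x) :
    nabla g Y x (X x) - nabla g X x (Y x) = VectorField.mlieBracket 𝓘(ℝ, E) X Y x :=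
  hg.ext_left fun z ↦ by
  have hz := smoothFieldAt_ext z
  have h1 := hg.koszul_formula hX hY hz
  have h2 := hg.koszul_formula hY hX hz
  rw [ext_apply_self] at h1 h2
  rw [map_sub, sub_apply, h1, h2]
  simp only [koszul, ext_apply_self]
  rw [VectorField.mlieBracket_swap_apply (V := Y) (W := X)]
  simp only [fun y ↦ hg.symm y (Y y) (X y), map_neg, neg_apply]
  ring

theorem nabla_ext_comm (hg : MetricAt g x) {x' : M} (hx : x ∈ (chartAt E x').source)
    (u v : TangentSpace 𝓘(ℝ, E) x') :
    nabla g (ext v) x (ext u x) = nabla g (ext u) x (ext v x) := by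
  have := hg.nabla_sub_nabla (smoothFieldAt_ext_of_mem u hx) (smoothFieldAt_ext_of_mem v hx)
  rwa [mlieBracket_ext _ _ hx, sub_eq_zero] at this

theorem smoothFnAt_koszul (hg : MetricAt g x) (hV : SmoothFieldAt V x)
    (hX : SmoothFieldAt X x) (hZ : SmoothFieldAt Z x) : SmoothFnAt E (koszul g V X Z) x := by
  unfold koszul
  refine (SmoothFnAt.const E _ x).mul ?_
  refine ((((?_ : SmoothFnAt E _ x).add ?_).sub ?_).add ?_).sub ?_ |>.sub ?_
  · exact (hg.smoothFnAt hX hZ).dirDeriv hV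
  · exact (hg.smoothFnAt hV hZ).dirDeriv hX
  · exact (hg.smoothFnAt hV hX).dirDeriv hZ
  · exact hg.smoothFnAt (hV.mlieBracket hX) hZ
  · exact hg.smoothFnAt (hV.mlieBracket hZ) hX
  · exact hg.smoothFnAt (hX.mlieBracket hZ) hV

theorem smoothFieldAt_nabla (hg : MetricAt g x) (hX : SmoothFieldAt X x)
    (hV : SmoothFieldAt V x) : SmoothFieldAt (fun y ↦ nabla g X y (V y)) x := by
  refine (hg.smoothFieldAt_raise (α := fun y z ↦ koszul g (ext (V y)) X (ext z) y) ?_ fun Z hZ ↦ ?_)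
  · filter_upwards [hg.eventually, hX.eventually] with y h1 h2
    exact (h1.isTensorialAt_koszul_right (smoothFieldAt_ext _) h2).isLinearMap
  · refine (hg.smoothFnAt_koszul hV hX hZ).congr ?_
    filter_upwards [hg.eventually, hX.eventually, hZ.eventually, hV.eventually] with y h1 h2 h3 h4
    rw [(h1.isTensorialAt_koszul_right (smoothFieldAt_ext _) h2).apply_ext h3]
    exact (h1.isTensorialAt_koszul_left h2 h3).apply_ext h4

end MetricAt

/-! ### Curvature -/

/-- The curvature operator `∇_U ∇_V W - ∇_V ∇_U W - ∇_{[U, V]} W` on vector fields. -/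
def curvField (g : BilinField E M) (U V W : VField E M) (x : M) : TangentSpace 𝓘(ℝ, E) x :=
  nabla g (fun y ↦ nabla g W y (V y)) x (U x) - nabla g (fun y ↦ nabla g W y (U y)) x (V x)
    - nabla g W x (VectorField.mlieBracket 𝓘(ℝ, E) U V x)

theorem curv_eq_curvField (u v w : TangentSpace 𝓘(ℝ, E) x) :
    curv g x u v w = curvField g (ext u) (ext v) (ext w) x := by
  simp [curv, curvField, ext_apply_self]

namespace MetricAt

theorem curvField_swap (hg : MetricAt g x) (hX : SmoothFieldAt X x) :
    curvField g Y Z X x = -curvField g Z Y X x := by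
  simp only [curvField]
  have : nabla g X x (VectorField.mlieBracket 𝓘(ℝ, E) Y Z x)
      = -nabla g X x (VectorField.mlieBracket 𝓘(ℝ, E) Z Y x) := by
    rw [VectorField.mlieBracket_swap_apply]
    exact (hg.nabla_isLinearMap hX).map_neg _
  rw [this]
  abel

theorem isTensorialAt_curvField_left (hg : MetricAt g x) (hV : SmoothFieldAt V x)
    (hW : SmoothFieldAt W x) : IsTensorialAt (fun U ↦ curvField g U V W x) x where
  smul f U hf hU := by
    simp only [curvField]
    have h1 : (fun y ↦ nabla g W y (f y • U y)) =ᶠ[𝓝 x]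
        (fun y ↦ f y • nabla g W y (U y) : VField E M) := by
      filter_upwards [hg.eventually, hW.eventually] with y h1 h2 using h1.nabla_smul_vec h2 _ _
    rw [hg.nabla_congr (hg.smoothFieldAt_nabla hW (hU.smul hf)) h1,
      hg.nabla_smul hf (hg.smoothFieldAt_nabla hW hU), mlieBracket_smul_left hf hU,
      hg.nabla_add_vec hW, hg.nabla_smul_vec hW, hg.nabla_smul_vec hW,
      hg.nabla_smul_vec (hg.smoothFieldAt_nabla hW hV)]
    module
  add U U' hU hU' := by
    simp only [curvField]
    have h1 : (fun y ↦ nabla g W y (U y + U' y)) =ᶠ[𝓝 x]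
        (fun y ↦ nabla g W y (U y) + nabla g W y (U' y) : VField E M) := by
      filter_upwards [hg.eventually, hW.eventually] with y h1 h2 using h1.nabla_add_vec h2 _ _
    rw [hg.nabla_congr (hg.smoothFieldAt_nabla hW (hU.add hU')) h1,
      hg.nabla_add (hg.smoothFieldAt_nabla hW hU) (hg.smoothFieldAt_nabla hW hU'),
      mlieBracket_add_left hU hU',
      hg.nabla_add_vec hW, hg.nabla_add_vec (hg.smoothFieldAt_nabla hW hV)]
    module

theorem isTensorialAt_curvField_middle (hg : MetricAt g x) (hU : SmoothFieldAt X x)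
    (hW : SmoothFieldAt W x) : IsTensorialAt (fun V ↦ curvField g X V W x) x where
  smul f V hf hV := by
    rw [hg.curvField_swap hW, hg.curvField_swap hW (Y := X) (Z := V),
      (hg.isTensorialAt_curvField_left hU hW).smul f V hf hV, smul_neg]
  add V V' hV hV' := by
    rw [hg.curvField_swap hW, hg.curvField_swap hW (Y := X) (Z := V),
      hg.curvField_swap hW (Y := X) (Z := V'),
      (hg.isTensorialAt_curvField_left hU hW).add V V' hV hV', neg_add]

theorem isTensorialAt_curvField_right (hg : MetricAt g x) (hU : SmoothFieldAt X x)
    (hV : SmoothFieldAt V x) : IsTensorialAt (fun W ↦ curvField g X V W x) x where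
  smul f W hf hW := by
    simp only [curvField]
    have h1 (V : VField E M) (hV : SmoothFieldAt V x) :
        (fun y ↦ nabla g (fun y ↦ f y • W y) y (V y)) =ᶠ[𝓝 x]
        (fun y ↦ dirDeriv f y (V y) • W y + f y • nabla g W y (V y) : VField E M) := by
      filter_upwards [hg.eventually, hW.eventually, hf.eventually] with y h1 h2 h3 using
        h1.nabla_smul h3 h2 _
    have h2 (V : VField E M) (hV : SmoothFieldAt V x) (u : TangentSpace 𝓘(ℝ, E) x) :
        nabla g (fun y ↦ nabla g (fun y ↦ f y • W y) y (V y)) x u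
          = dirDeriv (fun y ↦ dirDeriv f y (V y)) x u • W x + dirDeriv f x (V x) • nabla g W x u
            + dirDeriv f x u • nabla g W x (V x)
            + f x • nabla g (fun y ↦ nabla g W y (V y)) x u := by
      rw [hg.nabla_congr (hg.smoothFieldAt_nabla (hW.smul hf) hV) (h1 V hV),
        hg.nabla_add (hW.smul (hf.dirDeriv hV)) ((hg.smoothFieldAt_nabla hW hV).smul hf),
        hg.nabla_smul (hf.dirDeriv hV) hW, hg.nabla_smul hf (hg.smoothFieldAt_nabla hW hV)]
      module
    rw [h2 V hV, h2 X hU, hg.nabla_smul hf hW, dirDeriv_mlieBracket hf hU hV]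
    module
  add W W' hW hW' := by
    simp only [curvField]
    have h2 (V : VField E M) (hV : SmoothFieldAt V x) (u : TangentSpace 𝓘(ℝ, E) x) :
        nabla g (fun y ↦ nabla g (fun y ↦ W y + W' y) y (V y)) x u
          = nabla g (fun y ↦ nabla g W y (V y)) x u
            + nabla g (fun y ↦ nabla g W' y (V y)) x u := by
      have h1 : (fun y ↦ nabla g (fun y ↦ W y + W' y) y (V y)) =ᶠ[𝓝 x]
          (fun y ↦ nabla g W y (V y) + nabla g W' y (V y) : VField E M) := by
        filter_upwards [hg.eventually, hW.eventually, hW'.eventually] with y h1 h2 h3 using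
          h1.nabla_add h2 h3 _
      rw [hg.nabla_congr (hg.smoothFieldAt_nabla (hW.add hW') hV) h1,
        hg.nabla_add (hg.smoothFieldAt_nabla hW hV) (hg.smoothFieldAt_nabla hW' hV)]
    rw [h2 V hV, h2 X hU, hg.nabla_add hW hW']
    module

theorem curv_apply (hg : MetricAt g x) (hU : SmoothFieldAt X x) (hV : SmoothFieldAt V x)
    (hW : SmoothFieldAt W x) : curv g x (X x) (V x) (W x) = curvField g X V W x := by
  have hU' := smoothFieldAt_ext (X x)
  have hV' := smoothFieldAt_ext (V x)
  rw [curv_eq_curvField, (hg.isTensorialAt_curvField_right hU' hV').apply_ext hW,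
    (hg.isTensorialAt_curvField_middle hU' hW).apply_ext hV,
    (hg.isTensorialAt_curvField_left hV hW).apply_ext hU]

theorem curv_isLinearMap_left (hg : MetricAt g x) (v w : TangentSpace 𝓘(ℝ, E) x) :
    IsLinearMap ℝ fun u ↦ curv g x u v w := by
  simp only [curv_eq_curvField]
  exact (hg.isTensorialAt_curvField_left (smoothFieldAt_ext v) (smoothFieldAt_ext w)).isLinearMap

theorem curv_isLinearMap_middle (hg : MetricAt g x) (u w : TangentSpace 𝓘(ℝ, E) x) :
    IsLinearMap ℝ fun v ↦ curv g x u v w := by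
  simp only [curv_eq_curvField]
  exact (hg.isTensorialAt_curvField_middle (smoothFieldAt_ext u) (smoothFieldAt_ext w)).isLinearMap

end MetricAt

/-! ### Traces -/

/-- The trace of an endomorphism of the tangent space at `x`, given as a bare function. -/
def tr (x : M) (T : TangentSpace 𝓘(ℝ, E) x → TangentSpace 𝓘(ℝ, E) x) : ℝ :=
  ∑ i, (tbasis x).repr (T (tbasis x i)) i

theorem ricci_eq_tr (g : BilinField E M) (x : M) (v w : TangentSpace 𝓘(ℝ, E) x) :
    ricci g x v w = tr x fun u ↦ curv g x u v w := rfl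

theorem repr_raise (α : TangentSpace 𝓘(ℝ, E) x → ℝ) (i : Fin (Module.finrank ℝ E)) :
    (tbasis x).repr (raise g x α) i = ∑ j, (gram g x)⁻¹ i j * α (tbasis x j) := by
  have : raise g x α = ∑ i, (∑ j, (gram g x)⁻¹ i j * α (tbasis x j)) • tbasis x i := by
    simp only [raise, Finset.sum_smul]
  rw [this, Module.Basis.repr_sum_self]

theorem scal_eq_tr (g : BilinField E M) (x : M) :
    scal g x = tr x fun v ↦ raise g x (ricci g x v) := by
  simp only [tr, repr_raise, scal]

theorem sum_repr_eq_trace {ι R N : Type*} [Fintype ι] [CommRing R] [AddCommGroup N] [Module R N]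
    (b : Module.Basis ι R N) (T : N →ₗ[R] N) :
    ∑ i, b.repr (T (b i)) i = LinearMap.trace R N T := by
  classical
  rw [LinearMap.trace_eq_matrix_trace R b, Matrix.trace]
  simp [LinearMap.toMatrix_apply]

theorem tr_eq_sum {x : M} {T : TangentSpace 𝓘(ℝ, E) x → TangentSpace 𝓘(ℝ, E) x}
    (hT : IsLinearMap ℝ T) {ι : Type*} [Fintype ι]
    (b : Module.Basis ι ℝ (TangentSpace 𝓘(ℝ, E) x)) :
    tr x T = ∑ i, b.repr (T (b i)) i :=
  (sum_repr_eq_trace (tbasis x) (hT.mk' T)).trans (sum_repr_eq_trace b (hT.mk' T)).symm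

theorem tr_add (x : M) (S T : TangentSpace 𝓘(ℝ, E) x → TangentSpace 𝓘(ℝ, E) x) :
    tr x (fun u ↦ S u + T u) = tr x S + tr x T := by
  simp [tr, Finset.sum_add_distrib]

theorem tr_smul (x : M) (c : ℝ) (T : TangentSpace 𝓘(ℝ, E) x → TangentSpace 𝓘(ℝ, E) x) :
    tr x (fun u ↦ c • T u) = c * tr x T := by
  simp [tr, Finset.mul_sum]

theorem tr_sub (x : M) (S T : TangentSpace 𝓘(ℝ, E) x → TangentSpace 𝓘(ℝ, E) x) :
    tr x (fun u ↦ S u - T u) = tr x S - tr x T := by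
  simp [tr, Finset.sum_sub_distrib]

theorem tr_id (x : M) :
    tr x (fun u : TangentSpace 𝓘(ℝ, E) x ↦ u) = (Module.finrank ℝ E : ℝ) := by
  simp [tr]

theorem tr_smul_const (x : M) {α : TangentSpace 𝓘(ℝ, E) x → ℝ} (hα : IsLinearMap ℝ α)
    (w : TangentSpace 𝓘(ℝ, E) x) : tr x (fun u ↦ α u • w) = α w := by
  conv_rhs => rw [← (tbasis x).sum_repr w]
  have := map_sum (hα.mk' α) (fun i ↦ (tbasis x).repr w i • tbasis x i) Finset.univ
  simp only [IsLinearMap.mk'_apply] at this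
  rw [this, tr]
  simp only [map_smul, hα.map_smul]
  exact Finset.sum_congr rfl fun i _ ↦ by simp [mul_comm]

theorem smoothFnAt_tr {T : (y : M) → TangentSpace 𝓘(ℝ, E) y → TangentSpace 𝓘(ℝ, E) y}
    (hT : ∀ᶠ y in 𝓝 x, IsLinearMap ℝ (T y))
    (h : ∀ Z, SmoothFieldAt Z x → SmoothFieldAt (fun y ↦ T y (Z y)) x) :
    SmoothFnAt E (fun y ↦ tr y (T y)) x := by
  choose c hc hcT using fun i ↦ exists_coeff_ext (h _ (smoothFieldAt_ext (tbasis x i)))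
  refine (SmoothFnAt.sum (s := Finset.univ) fun i _ ↦ hc i i).congr ?_
  filter_upwards [hT, eventually_span_ext (E := E) x, eventually_all.2 hcT] with y h1 h2 h3
  obtain ⟨b, hb⟩ := h2
  rw [tr_eq_sum h1 b]
  refine Finset.sum_congr rfl fun i _ ↦ ?_
  rw [hb, h3 i]
  simp only [← hb]
  rw [Module.Basis.repr_sum_self]

namespace MetricAt

/-- Traces in terms of the metric. -/
theorem tr_eq_sum_gram (hg : MetricAt g x)
    (T : TangentSpace 𝓘(ℝ, E) x → TangentSpace 𝓘(ℝ, E) x) :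
    tr x T = ∑ i, ∑ j, (gram g x)⁻¹ i j * g x (T (tbasis x i)) (tbasis x j) := by
  refine Finset.sum_congr rfl fun i _ ↦ ?_
  rw [← repr_raise (g := g) (x := x)]
  congr 2
  exact hg.eq_raise ⟨map_add _, map_smul _⟩ fun w ↦ rfl

theorem tr_eq_zero_of_skew (hg : MetricAt g x)
    {T : TangentSpace 𝓘(ℝ, E) x → TangentSpace 𝓘(ℝ, E) x}
    (hT : ∀ v w, g x (T v) w = - g x (T w) v) : tr x T = 0 := by
  have hG : (gram g x)⁻¹.transpose = (gram g x)⁻¹ := by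
    rw [Matrix.transpose_nonsing_inv]
    congr 1
    ext i j
    exact hg.symm x _ _
  have h1 := hg.tr_eq_sum_gram T
  have h2 : tr x T = -tr x T := by
    conv_lhs => rw [h1, Finset.sum_comm]
    rw [h1, ← Finset.sum_neg_distrib]
    refine Finset.sum_congr rfl fun i _ ↦ ?_
    rw [← Finset.sum_neg_distrib]
    refine Finset.sum_congr rfl fun j _ ↦ ?_
    have : (gram g x)⁻¹ j i = (gram g x)⁻¹ i j := congrFun (congrFun hG i) j
    rw [this, hT]; ring
  linarith

/-! ### Symmetries of the curvature and the Ricci tensor -/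

theorem curv_eq (hg : MetricAt g x) (u v w : TangentSpace 𝓘(ℝ, E) x) :
    curv g x u v w = nabla g (fun y ↦ nabla g (ext w) y (ext v y)) x u
      - nabla g (fun y ↦ nabla g (ext w) y (ext u y)) x v := by
  rw [curv, mlieBracket_ext _ _ (mem_chart_source E x), hg.nabla_zero_vec (smoothFieldAt_ext w),
    sub_zero]

/-- From the commutation of second derivatives of `g(w, z)` along coordinate fields. -/
theorem curv_skew (hg : MetricAt g x) (u v w z : TangentSpace 𝓘(ℝ, E) x) :
    g x (curv g x u v w) z = - g x (curv g x u v z) w := by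
  have hw := smoothFieldAt_ext w
  have hz := smoothFieldAt_ext z
  have key (u v : TangentSpace 𝓘(ℝ, E) x) :
      dirDeriv (fun y ↦ dirDeriv (fun y ↦ g y (ext w y) (ext z y)) y (ext v y)) x u
        = g x (nabla g (fun y ↦ nabla g (ext w) y (ext v y)) x u) z
          + g x (nabla g (ext w) x v) (nabla g (ext z) x u)
          + g x (nabla g (ext w) x u) (nabla g (ext z) x v)
          + g x w (nabla g (fun y ↦ nabla g (ext z) y (ext v y)) x u) := by
    have hv := smoothFieldAt_ext v
    have h1 : (fun y ↦ dirDeriv (fun y ↦ g y (ext w y) (ext z y)) y (ext v y)) =ᶠ[𝓝 x]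
        fun y ↦ g y (nabla g (ext w) y (ext v y)) (ext z y)
          + g y (ext w y) (nabla g (ext z) y (ext v y)) := by
      filter_upwards [hg.eventually, hw.eventually, hz.eventually] with y h1 h2 h3 using
        h1.dirDeriv_metric h2 h3 _
    have hw' := hg.smoothFieldAt_nabla hw hv
    have hz' := hg.smoothFieldAt_nabla hz hv
    rw [dirDeriv_congr h1, dirDeriv_add (hg.smoothFnAt hw' hz) (hg.smoothFnAt hw hz'),
      hg.dirDeriv_metric hw' hz, hg.dirDeriv_metric hw hz']
    simp only [ext_apply_self]
    ring
  have h := dirDeriv_dirDeriv_ext_comm u v (mem_chart_source E x) (hg.smoothFnAt hw hz)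
  rw [ext_apply_self, ext_apply_self, key, key] at h
  rw [hg.curv_eq, hg.curv_eq, map_sub, map_sub, sub_apply, sub_apply, hg.symm x _ w,
    hg.symm x _ w]
  linarith

/-- The first Bianchi identity. -/
theorem curv_bianchi (hg : MetricAt g x) (u v w : TangentSpace 𝓘(ℝ, E) x) :
    curv g x u v w + curv g x v w u + curv g x w u v = 0 := by
  have key (u v w : TangentSpace 𝓘(ℝ, E) x) :
      nabla g (fun y ↦ nabla g (ext w) y (ext v y)) x u
        = nabla g (fun y ↦ nabla g (ext v) y (ext w y)) x u := by
    refine hg.nabla_congr (hg.smoothFieldAt_nabla (smoothFieldAt_ext w) (smoothFieldAt_ext v)) ?_ u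
    filter_upwards [hg.eventually, (chartAt E x).open_source.mem_nhds (mem_chart_source E x)]
      with y h1 h2 using h1.nabla_ext_comm h2 v w
  rw [hg.curv_eq, hg.curv_eq, hg.curv_eq, key u v w, key v u w, key w u v]
  abel

/-- Trace of the Bianchi identity: the remaining curvature endomorphism is skew, hence traceless. -/
theorem ricci_symm (hg : MetricAt g x) (v w : TangentSpace 𝓘(ℝ, E) x) :
    ricci g x v w = ricci g x w v := by
  rw [← sub_eq_zero, ricci_eq_tr, ricci_eq_tr, ← tr_sub]
  refine hg.tr_eq_zero_of_skew fun a b ↦ ?_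
  have h (u : TangentSpace 𝓘(ℝ, E) x) :
      curv g x u v w - curv g x u w v = -curv g x v w u := by
    have h1 := hg.curv_bianchi u v w
    have h2 : curv g x u w v = -curv g x w u v := by
      rw [curv_eq_curvField, curv_eq_curvField, hg.curvField_swap (smoothFieldAt_ext v)]
    rw [h2]
    rw [← sub_eq_zero, ← h1]; abel
  rw [h, h, map_neg, map_neg, neg_apply, neg_apply, hg.curv_skew v w a b]

theorem ricci_isLinearMap_left (hg : MetricAt g x) (w : TangentSpace 𝓘(ℝ, E) x) :
    IsLinearMap ℝ fun v ↦ ricci g x v w where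
  map_add a b := by
    simp only [ricci_eq_tr, ← tr_add, (hg.curv_isLinearMap_middle _ w).map_add]
  map_smul c a := by
    simp only [ricci_eq_tr, smul_eq_mul, ← tr_smul, (hg.curv_isLinearMap_middle _ w).map_smul]

theorem ricci_isLinearMap (hg : MetricAt g x) (v : TangentSpace 𝓘(ℝ, E) x) :
    IsLinearMap ℝ (ricci g x v) := by
  have : ricci g x v = fun w ↦ ricci g x w v := funext fun w ↦ hg.ricci_symm v w
  rw [this]
  exact hg.ricci_isLinearMap_left v

theorem smoothFieldAt_curvField (hg : MetricAt g x) (hX : SmoothFieldAt X x)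
    (hY : SmoothFieldAt Y x) (hZ : SmoothFieldAt Z x) : SmoothFieldAt (curvField g X Y Z) x :=
  ((hg.smoothFieldAt_nabla (hg.smoothFieldAt_nabla hZ hY) hX).sub
    (hg.smoothFieldAt_nabla (hg.smoothFieldAt_nabla hZ hX) hY)).sub
    (hg.smoothFieldAt_nabla hZ (hX.mlieBracket hY))

theorem smoothFnAt_ricci (hg : MetricAt g x) (hX : SmoothFieldAt X x) (hY : SmoothFieldAt Y x) :
    SmoothFnAt E (fun y ↦ ricci g y (X y) (Y y)) x := by
  refine smoothFnAt_tr (T := fun y u ↦ curv g y u (X y) (Y y)) ?_ fun Z hZ ↦ ?_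
  · filter_upwards [hg.eventually] with y h1 using h1.curv_isLinearMap_left _ _
  · refine (hg.smoothFieldAt_curvField hZ hX hY).congr ?_
    filter_upwards [hg.eventually, hX.eventually, hY.eventually, hZ.eventually] with y h1 h2 h3 h4
      using h1.curv_apply h4 h2 h3

theorem raise_isLinearMap {x : M} {B : TangentSpace 𝓘(ℝ, E) x → TangentSpace 𝓘(ℝ, E) x → ℝ}
    (hB : ∀ w, IsLinearMap ℝ fun v ↦ B v w) : IsLinearMap ℝ fun v ↦ raise g x (B v) where
  map_add a b := by
    simp only [raise, ← Finset.sum_add_distrib, (hB _).map_add, ← add_smul, mul_add]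
  map_smul c a := by
    simp only [raise, Finset.smul_sum, smul_smul, (hB _).map_smul, smul_eq_mul]
    refine Finset.sum_congr rfl fun _ _ ↦ Finset.sum_congr rfl fun _ _ ↦ ?_
    congr 1; ring

theorem smoothFnAt_scal (hg : MetricAt g x) : SmoothFnAt E (scal g) x := by
  have : scal g = fun y ↦ tr y fun v ↦ raise g y (ricci g y v) := funext fun y ↦ scal_eq_tr g y
  rw [this]
  refine smoothFnAt_tr (T := fun y v ↦ raise g y (ricci g y v)) ?_ fun Z hZ ↦ ?_
  · filter_upwards [hg.eventually] with y h1 using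
      raise_isLinearMap fun w ↦ h1.ricci_isLinearMap_left w
  · exact hg.smoothFieldAt_raise (hg.eventually.mono fun y h1 ↦ h1.ricci_isLinearMap _)
      fun W hW ↦ hg.smoothFnAt_ricci hZ hW

/-! ### The Schouten tensor -/

theorem schouten_symm (hg : MetricAt g x) (v w : TangentSpace 𝓘(ℝ, E) x) :
    schouten g x v w = schouten g x w v := by
  rw [schouten, schouten, hg.ricci_symm, hg.symm x v w]

theorem schouten_isLinearMap (hg : MetricAt g x) (v : TangentSpace 𝓘(ℝ, E) x) :
    IsLinearMap ℝ (schouten g x v) where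
  map_add a b := by simp only [schouten, (hg.ricci_isLinearMap v).map_add, map_add]; ring
  map_smul c a := by
    simp only [schouten, (hg.ricci_isLinearMap v).map_smul, map_smul, smul_eq_mul]; ring

theorem smoothFnAt_schouten (hg : MetricAt g x) (hX : SmoothFieldAt X x)
    (hY : SmoothFieldAt Y x) : SmoothFnAt E (fun y ↦ schouten g y (X y) (Y y)) x := by
  unfold schouten
  refine (SmoothFnAt.const E _ x).mul ((hg.smoothFnAt_ricci hX hY).sub (SmoothFnAt.mul ?_
    (hg.smoothFnAt hX hY)))
  simp only [div_eq_mul_inv]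
  exact hg.smoothFnAt_scal.mul (SmoothFnAt.const E _ x)

end MetricAt

/-! ### Conformal change of the connection and of the Schouten tensor -/

/-- The gradient of `Υ` with respect to `g`. -/
def grad (g : BilinField E M) (Υ : M → ℝ) : VField E M := fun x ↦ raise g x (dirDeriv Υ x)

variable {Υ : M → ℝ}

theorem MetricAt.smoothFieldAt_grad (hg : MetricAt g x) (hΥ : SmoothFnAt E Υ x) :
    SmoothFieldAt (grad g Υ) x :=
  hg.smoothFieldAt_raise (Eventually.of_forall fun y ↦ dirDeriv_isLinearMap Υ y)
    fun _ hZ ↦ hΥ.dirDeriv hZ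

theorem MetricAt.apply_grad (hg : MetricAt g x) (Υ : M → ℝ) (v : TangentSpace 𝓘(ℝ, E) x) :
    g x (grad g Υ x) v = dirDeriv Υ x v := hg.apply_raise (dirDeriv_isLinearMap Υ x) v

theorem rescale_apply (Υ : M → ℝ) (g : BilinField E M) (x : M) (v w : TangentSpace 𝓘(ℝ, E) x) :
    rescale Υ g x v w = Real.exp (2 * Υ x) * g x v w := rfl

/-- The Levi-Civita connection of `e^{2Υ} g`. -/
theorem MetricAt.nabla_rescale (hg : MetricAt g x) (hΥ : SmoothFnAt E Υ x)
    (hX : SmoothFieldAt X x) (v : TangentSpace 𝓘(ℝ, E) x) :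
    nabla (ConformalTractor.rescale Υ g) X x v = nabla g X x v + g x (grad g Υ x) v • X x
      + g x (grad g Υ x) (X x) • v - g x v (X x) • grad g Υ x := by
  refine (hg.rescale hΥ).ext_left fun z ↦ ?_
  have hv := smoothFieldAt_ext v
  have hz := smoothFieldAt_ext z
  have h2 : SmoothFnAt E (fun y ↦ 2 * Υ y) x := (SmoothFnAt.const E 2 x).mul hΥ
  have key {Y Z : VField E M} (hY : SmoothFieldAt Y x) (hZ : SmoothFieldAt Z x)
      (u : TangentSpace 𝓘(ℝ, E) x) :
      dirDeriv (fun y ↦ ConformalTractor.rescale Υ g y (Y y) (Z y)) x u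
        = Real.exp (2 * Υ x) * (dirDeriv (fun y ↦ g y (Y y) (Z y)) x u
          + 2 * dirDeriv Υ x u * g x (Y x) (Z x)) := by
    simp only [rescale_apply]
    rw [dirDeriv_mul h2.exp (hg.smoothFnAt hY hZ),
      dirDeriv_comp (Real.hasDerivAt_exp _) h2, dirDeriv_mul (SmoothFnAt.const E 2 x) hΥ,
      dirDeriv_const]
    ring
  rw [(hg.rescale hΥ).nabla_apply hX, rescale_apply]
  simp only [map_add, map_sub, map_smul, add_apply, sub_apply, smul_apply, smul_eq_mul,
    hg.apply_grad]
  rw [hg.nabla_apply hX]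
  simp only [koszul]
  rw [key hX hz, key hv hz, key hv hX]
  simp only [rescale_apply, ext_apply_self]
  ring

/-- The difference of the Schouten tensors of `e^{2Υ} g` and `g`, as an endomorphism:
`u ↦ Υ(u) grad Υ - ∇_u grad Υ - |grad Υ|² u / 2`. -/
def schoutenShift (g : BilinField E M) (Υ : M → ℝ) (x : M) (u : TangentSpace 𝓘(ℝ, E) x) :
    TangentSpace 𝓘(ℝ, E) x :=
  g x (grad g Υ x) u • grad g Υ x - nabla g (grad g Υ) x u
    - (1 / 2 * g x (grad g Υ x) (grad g Υ x)) • u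

theorem MetricAt.hessian_symm (hg : MetricAt g x) (hΥ : SmoothFnAt E Υ x)
    (u v : TangentSpace 𝓘(ℝ, E) x) :
    g x (nabla g (grad g Υ) x u) v = g x (nabla g (grad g Υ) x v) u := by
  have hN := hg.smoothFieldAt_grad hΥ
  have key (u v : TangentSpace 𝓘(ℝ, E) x) :
      dirDeriv (fun z ↦ dirDeriv Υ z (ext v z)) x (ext u x)
        = g x (nabla g (grad g Υ) x u) v + g x (grad g Υ x) (nabla g (ext v) x u) := by
    have h1 : (fun z ↦ dirDeriv Υ z (ext v z)) =ᶠ[𝓝 x] fun z ↦ g z (grad g Υ z) (ext v z) :=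
      hg.eventually.mono fun z hz ↦ (hz.apply_grad Υ _).symm
    rw [dirDeriv_congr h1, hg.dirDeriv_metric hN (smoothFieldAt_ext v)]
    simp only [ext_apply_self]
  have h := dirDeriv_dirDeriv_ext_comm u v (mem_chart_source E x) hΥ
  have ht := hg.nabla_ext_comm (mem_chart_source E x) u v
  simp only [ext_apply_self] at ht
  rw [key, key, ht] at h
  linarith

/-- The Weyl part of the curvature is conformally invariant: the curvature changes by the
Kulkarni-Nomizu product of `g` with `schoutenShift`. -/
theorem MetricAt.curv_rescale (hg : MetricAt g x) (hΥ : SmoothFnAt E Υ x)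
    (u v w : TangentSpace 𝓘(ℝ, E) x) :
    curv (ConformalTractor.rescale Υ g) x u v w = curv g x u v w
      + g x (schoutenShift g Υ x v) w • u - g x (schoutenShift g Υ x u) w • v
      + g x v w • schoutenShift g Υ x u - g x u w • schoutenShift g Υ x v := by
  have hN := hg.smoothFieldAt_grad hΥ
  have hw := smoothFieldAt_ext w
  have hr := hg.rescale hΥ
  have key (u v : TangentSpace 𝓘(ℝ, E) x) :
      nabla (ConformalTractor.rescale Υ g)
        (fun y ↦ nabla (ConformalTractor.rescale Υ g) (ext w) y (ext v y)) x u
      = nabla g (fun y ↦ nabla g (ext w) y (ext v y)) x u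
        + ((g x (nabla g (grad g Υ) x u) v + g x (grad g Υ x) (nabla g (ext v) x u)) • w
            + g x (grad g Υ x) v • nabla g (ext w) x u)
        + ((g x (nabla g (grad g Υ) x u) w + g x (grad g Υ x) (nabla g (ext w) x u)) • v
            + g x (grad g Υ x) w • nabla g (ext v) x u)
        - ((g x (nabla g (ext v) x u) w + g x v (nabla g (ext w) x u)) • grad g Υ x
            + g x v w • nabla g (grad g Υ) x u)
        + g x (grad g Υ x) u • (nabla g (ext w) x v + g x (grad g Υ x) v • w
          + g x (grad g Υ x) w • v - g x v w • grad g Υ x)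
        + g x (grad g Υ x) (nabla g (ext w) x v + g x (grad g Υ x) v • w
          + g x (grad g Υ x) w • v - g x v w • grad g Υ x) • u
        - g x u (nabla g (ext w) x v + g x (grad g Υ x) v • w
          + g x (grad g Υ x) w • v - g x v w • grad g Υ x) • grad g Υ x := by
    have hv := smoothFieldAt_ext v
    have h1 : (fun y ↦ nabla (ConformalTractor.rescale Υ g) (ext w) y (ext v y)) =ᶠ[𝓝 x]
        (fun y ↦ nabla g (ext w) y (ext v y) + g y (grad g Υ y) (ext v y) • ext w y
          + g y (grad g Υ y) (ext w y) • ext v y - g y (ext v y) (ext w y) • grad g Υ y :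
          VField E M) := by
      filter_upwards [hg.eventually, hΥ.eventually, hw.eventually] with y h1 h2 h3 using
        h1.nabla_rescale h2 h3 _
    have s1 := hg.smoothFieldAt_nabla hw hv
    have s2 := hw.smul (hg.smoothFnAt hN hv)
    have s3 := hv.smul (hg.smoothFnAt hN hw)
    have s4 := hN.smul (hg.smoothFnAt hv hw)
    rw [hr.nabla_congr (hr.smoothFieldAt_nabla hw hv) h1,
      hg.nabla_rescale hΥ (((s1.add s2).add s3).sub s4), hg.nabla_sub ((s1.add s2).add s3) s4,
      hg.nabla_add (s1.add s2) s3, hg.nabla_add s1 s2, hg.nabla_smul (hg.smoothFnAt hN hv) hw,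
      hg.nabla_smul (hg.smoothFnAt hN hw) hv, hg.nabla_smul (hg.smoothFnAt hv hw) hN,
      hg.dirDeriv_metric hN hv, hg.dirDeriv_metric hN hw, hg.dirDeriv_metric hv hw]
    simp only [ext_apply_self]
  have ht : nabla g (ext v) x u = nabla g (ext u) x v := by
    simpa [ext_apply_self] using hg.nabla_ext_comm (mem_chart_source E x) u v
  have hs := hg.hessian_symm hΥ u v
  rw [hr.curv_eq, key, key, hg.curv_eq, ht, hs]
  simp only [schoutenShift, map_add, map_sub, map_smul, sub_apply, smul_apply, smul_eq_mul]
  rw [hg.symm x v (nabla g (ext w) x u), hg.symm x u (nabla g (ext w) x v),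
    hg.symm x v (grad g Υ x), hg.symm x u (grad g Υ x)]
  rw [hg.symm x v u]
  module

theorem MetricAt.schoutenShift_isLinearMap (hg : MetricAt g x) (hΥ : SmoothFnAt E Υ x) :
    IsLinearMap ℝ (schoutenShift g Υ x) where
  map_add a b := by
    simp only [schoutenShift, map_add, hg.nabla_add_vec (hg.smoothFieldAt_grad hΥ)]
    module
  map_smul c a := by
    simp only [schoutenShift, map_smul, hg.nabla_smul_vec (hg.smoothFieldAt_grad hΥ), smul_eq_mul]
    module

theorem MetricAt.ricci_rescale (hg : MetricAt g x) (hΥ : SmoothFnAt E Υ x)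
    (v w : TangentSpace 𝓘(ℝ, E) x) :
    ricci (ConformalTractor.rescale Υ g) x v w = ricci g x v w
      + ((Module.finrank ℝ E : ℝ) - 2) * g x (schoutenShift g Υ x v) w
      + tr x (schoutenShift g Υ x) * g x v w := by
  have hA := hg.schoutenShift_isLinearMap hΥ
  have h1 : IsLinearMap ℝ fun u ↦ g x (schoutenShift g Υ x u) w :=
    ⟨fun a b ↦ by simp [hA.map_add], fun c a ↦ by simp [hA.map_smul]⟩
  have h2 : IsLinearMap ℝ fun u ↦ g x u w :=
    ⟨fun a b ↦ by simp, fun c a ↦ by simp⟩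
  rw [ricci_eq_tr, ricci_eq_tr]
  simp only [hg.curv_rescale hΥ]
  rw [tr_sub, tr_add, tr_sub, tr_add, tr_smul, tr_id, tr_smul_const x h1, tr_smul_const x h2,
    tr_smul]
  ring

theorem MetricAt.raise_rescale (hg : MetricAt g x) (hΥ : SmoothFnAt E Υ x)
    {α : TangentSpace 𝓘(ℝ, E) x → ℝ} (hα : IsLinearMap ℝ α) :
    raise (ConformalTractor.rescale Υ g) x α = Real.exp (-(2 * Υ x)) • raise g x α := by
  refine ((hg.rescale hΥ).eq_raise hα fun w ↦ ?_).symm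
  rw [rescale_apply, map_smul, smul_apply, hg.apply_raise hα, smul_eq_mul, ← mul_assoc,
    ← Real.exp_add]
  simp

theorem MetricAt.scal_rescale (hg : MetricAt g x) (hΥ : SmoothFnAt E Υ x) :
    scal (ConformalTractor.rescale Υ g) x = Real.exp (-(2 * Υ x)) *
      (scal g x + 2 * ((Module.finrank ℝ E : ℝ) - 1) * tr x (schoutenShift g Υ x)) := by
  have h (v : TangentSpace 𝓘(ℝ, E) x) :
      raise (ConformalTractor.rescale Υ g) x (ricci (ConformalTractor.rescale Υ g) x v)
        = Real.exp (-(2 * Υ x)) • (raise g x (ricci g x v)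
          + ((Module.finrank ℝ E : ℝ) - 2) • schoutenShift g Υ x v
          + tr x (schoutenShift g Υ x) • v) := by
    rw [hg.raise_rescale hΥ ((hg.rescale hΥ).ricci_isLinearMap v)]
    congr 1
    refine (hg.eq_raise ((hg.rescale hΥ).ricci_isLinearMap v) fun w ↦ ?_).symm
    rw [hg.ricci_rescale hΥ]
    simp only [map_add, map_smul, add_apply, smul_apply, smul_eq_mul,
      hg.apply_raise (hg.ricci_isLinearMap v)]
  rw [scal_eq_tr, scal_eq_tr]
  simp only [h]
  rw [tr_smul, tr_add, tr_add, tr_smul, tr_smul, tr_id]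
  have : tr x (fun u ↦ schoutenShift g Υ x u) = tr x (schoutenShift g Υ x) := rfl
  rw [this]
  ring

theorem MetricAt.schouten_rescale (hg : MetricAt g x) (hΥ : SmoothFnAt E Υ x)
    (hn : 2 < Module.finrank ℝ E) (v w : TangentSpace 𝓘(ℝ, E) x) :
    schouten (ConformalTractor.rescale Υ g) x v w
      = schouten g x v w + g x (schoutenShift g Υ x v) w := by
  have hn' : (2 : ℝ) < Module.finrank ℝ E := by exact_mod_cast hn
  have h2 : (Module.finrank ℝ E : ℝ) - 2 ≠ 0 := by linarith
  have h1 : (Module.finrank ℝ E : ℝ) - 1 ≠ 0 := by linarith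
  have he : Real.exp (-(2 * Υ x)) * Real.exp (2 * Υ x) = 1 := by
    rw [← Real.exp_add]; simp
  simp only [schouten, hg.ricci_rescale hΥ, hg.scal_rescale hΥ, rescale_apply]
  set S := scal g x + 2 * ((Module.finrank ℝ E : ℝ) - 1) * tr x (schoutenShift g Υ x) with hS
  have h3 : Real.exp (-(2 * Υ x)) * S / (2 * ((Module.finrank ℝ E : ℝ) - 1))
      * (Real.exp (2 * Υ x) * g x v w) = S / (2 * ((Module.finrank ℝ E : ℝ) - 1)) * g x v w := by
    calc _ = (Real.exp (-(2 * Υ x)) * Real.exp (2 * Υ x)) * S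
          / (2 * ((Module.finrank ℝ E : ℝ) - 1)) * g x v w := by ring
      _ = _ := by rw [he, one_mul]
  rw [h3, hS]
  field_simp
  ring

/-! ### Invariance of the tractor connection -/

/-- The tractor field `s` is smooth near `x`. -/
def SmoothTractorAt (s : TractorField E M) (x : M) : Prop :=
  SmoothFnAt E (fun y ↦ (s y).1) x ∧ SmoothFieldAt (fun y ↦ (s y).2.1) x ∧
    SmoothFnAt E (fun y ↦ (s y).2.2) x

theorem SmoothTractorAt.of_smoothTractorOn {U : Set M} {s : TractorField E M} (hU : IsOpen U)
    (hx : x ∈ U) (hs : SmoothTractorOn U s) : SmoothTractorAt s x :=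
  ⟨.of_contMDiffOn hU hx hs.1, .of_smoothVFieldOn hU hx hs.2.1, .of_contMDiffOn hU hx hs.2.2⟩

theorem MetricAt.changeSplitting_eq (hg : MetricAt g x) (Υ : M → ℝ) (s : Tractor (E := E) x) :
    changeSplitting g Υ x s =
      (Real.exp (-Υ x) * (s.1 - g x (grad g Υ x) s.2.1
          - 1 / 2 * s.2.2 * g x (grad g Υ x) (grad g Υ x)),
        Real.exp (-Υ x) • (s.2.1 + s.2.2 • grad g Υ x), Real.exp (Υ x) * s.2.2) := by
  rw [changeSplitting, hg.apply_grad, hg.apply_grad]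
  rfl

/-- The tractor connection does not depend on the metric in the conformal class. -/
theorem MetricAt.tractorNabla_changeSplitting (hg : MetricAt g x) (hΥ : SmoothFnAt E Υ x)
    (hn : 2 < Module.finrank ℝ E) {s : TractorField E M} (hs : SmoothTractorAt s x)
    (v : TangentSpace 𝓘(ℝ, E) x) :
    tractorNabla (ConformalTractor.rescale Υ g) (fun y ↦ changeSplitting g Υ y (s y)) x v
      = changeSplitting g Υ x (tractorNabla g s x v) := by
  obtain ⟨h1, h2, h3⟩ := hs
  have hN := hg.smoothFieldAt_grad hΥ
  have hr := hg.rescale hΥ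
  have hev := hg.eventually
  have he : SmoothFnAt E (fun y ↦ Real.exp (-Υ y)) x := hΥ.neg.exp
  have hde : dirDeriv (fun y ↦ Real.exp (-Υ y)) x v
      = -Real.exp (-Υ x) * g x (grad g Υ x) v := by
    have h : HasDerivAt (fun t : ℝ ↦ Real.exp (-t)) (-Real.exp (-Υ x)) (Υ x) := by
      simpa using (hasDerivAt_neg (Υ x)).exp
    rw [dirDeriv_comp h hΥ, hg.apply_grad]
  have hde' : dirDeriv (fun y ↦ Real.exp (Υ y)) x v = Real.exp (Υ x) * g x (grad g Υ x) v := by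
    rw [dirDeriv_comp (Real.hasDerivAt_exp _) hΥ, hg.apply_grad]
  have c1 : (fun y ↦ (changeSplitting g Υ y (s y)).1) =ᶠ[𝓝 x] fun y ↦ Real.exp (-Υ y) *
      ((s y).1 - g y (grad g Υ y) (s y).2.1
          - 1 / 2 * (s y).2.2 * g y (grad g Υ y) (grad g Υ y)) :=
    hev.mono fun y hy ↦ by simp only [hy.changeSplitting_eq]
  have c2 : (fun y ↦ (changeSplitting g Υ y (s y)).2.1) =ᶠ[𝓝 x]
      (fun y ↦ Real.exp (-Υ y) • ((s y).2.1 + (s y).2.2 • grad g Υ y) : VField E M) :=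
    hev.mono fun y hy ↦ by simp only [hy.changeSplitting_eq]; rfl
  have c2x : (changeSplitting g Υ x (s x)).2.1
      = Real.exp (-Υ x) • ((s x).2.1 + (s x).2.2 • grad g Υ x) := by rw [hg.changeSplitting_eq]
  have hX := (h2.add (hN.smul h3)).smul he
  have p1 := hg.schouten_isLinearMap v
  have hsch : raise (ConformalTractor.rescale Υ g) x
      (fun w ↦ schouten (ConformalTractor.rescale Υ g) x v w)
      = Real.exp (-(2 * Υ x)) • (raise g x (fun w ↦ schouten g x v w) + schoutenShift g Υ x v) := by
    rw [hg.raise_rescale hΥ (hr.schouten_isLinearMap v)]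
    congr 1
    refine (hg.eq_raise (hr.schouten_isLinearMap v) fun w ↦ ?_).symm
    rw [map_add, add_apply, hg.apply_raise p1, hg.schouten_rescale hΥ hn]
  have hexp : Real.exp (2 * Υ x) = Real.exp (Υ x) * Real.exp (Υ x) := by
    rw [← Real.exp_add]; ring_nf
  have hexp1 : Real.exp (Υ x) * Real.exp (-Υ x) = 1 := by rw [← Real.exp_add]; simp
  have hexp2 : Real.exp (-(2 * Υ x)) = Real.exp (-Υ x) * Real.exp (-Υ x) := by
    rw [← Real.exp_add]; ring_nf
  rw [hg.changeSplitting_eq]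
  refine Prod.ext ?_ (Prod.ext ?_ ?_)
  · simp only [tractorNabla]
    rw [dirDeriv_congr c1, dirDeriv_mul he ((h1.sub (hg.smoothFnAt hN h2)).sub
      (((SmoothFnAt.const E _ x).mul h3).mul (hg.smoothFnAt hN hN))),
      dirDeriv_sub (h1.sub (hg.smoothFnAt hN h2))
        (((SmoothFnAt.const E _ x).mul h3).mul (hg.smoothFnAt hN hN)),
      dirDeriv_sub h1 (hg.smoothFnAt hN h2),
      dirDeriv_mul ((SmoothFnAt.const E _ x).mul h3) (hg.smoothFnAt hN hN),
      dirDeriv_mul (SmoothFnAt.const E _ x) h3, dirDeriv_const, hg.dirDeriv_metric hN h2,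
      hg.dirDeriv_metric hN hN, hde, c2x, hg.schouten_rescale hΥ hn]
    have q := hg.apply_raise p1 (grad g Υ x)
    rw [hg.symm] at q
    simp only [p1.map_smul, p1.map_add, map_add, map_smul, smul_eq_mul, schoutenShift, map_sub,
      sub_apply, smul_apply, q]
    rw [hg.symm x (grad g Υ x) (nabla g (grad g Υ) x v), hg.symm x v (grad g Υ x)]
    ring
  · simp only [tractorNabla]
    rw [← hr.nabla_congr hX c2.symm, hg.nabla_rescale hΥ hX, hg.nabla_smul he (h2.add (hN.smul h3)),
      hg.nabla_add h2 (hN.smul h3), hg.nabla_smul h3 hN, hde, hsch,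
      hg.changeSplitting_eq, hexp2]
    simp only [map_add, map_smul, smul_eq_mul, schoutenShift]
    have h4 : Real.exp (Υ x) * (s x).2.2 * 0 = 0 := by ring
    have h5 : ∀ u : TangentSpace 𝓘(ℝ, E) x, (Real.exp (Υ x) * (s x).2.2) •
        (Real.exp (-Υ x) * Real.exp (-Υ x)) • u = (Real.exp (-Υ x) * (s x).2.2) • u := fun u ↦ by
      rw [smul_smul]
      congr 1
      linear_combination (Real.exp (-Υ x) * (s x).2.2) * hexp1
    rw [h5, hg.symm x v (grad g Υ x)]
    module
  · simp only [tractorNabla]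
    have c3 : (fun y ↦ (changeSplitting g Υ y (s y)).2.2) = fun y ↦ Real.exp (Υ y) * (s y).2.2 :=
      rfl
    rw [c3, dirDeriv_mul hΥ.exp h3, hde', c2x, rescale_apply, hexp]
    simp only [map_smul, map_add, smul_eq_mul]
    rw [hg.symm x v (grad g Υ x)]
    linear_combination (-Real.exp (Υ x) *
      (g x v (s x).2.1 + (s x).2.2 * g x (grad g Υ x) v)) * hexp1

/-! ### The change of splitting as an isometry -/

/-- The tractor whose components in the splitting given by `e^{2Υ} g` are `s`, written in the
splitting given by `g`: the inverse of `changeSplitting`. -/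
def unsplit (g : BilinField E M) (Υ : M → ℝ) (x : M) (s : Tractor (E := E) x) :
    Tractor (E := E) x :=
  (Real.exp (Υ x) * s.1 + g x (grad g Υ x) (Real.exp (Υ x) • s.2.1)
      - 1 / 2 * (Real.exp (-Υ x) * s.2.2) * g x (grad g Υ x) (grad g Υ x),
    Real.exp (Υ x) • s.2.1 - (Real.exp (-Υ x) * s.2.2) • grad g Υ x, Real.exp (-Υ x) * s.2.2)

/-- `changeSplitting` as a linear automorphism of the tractor fibre. -/
def MetricAt.splittingEquiv (hg : MetricAt g x) (Υ : M → ℝ) :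
    Tractor (E := E) x ≃ₗ[ℝ] Tractor (E := E) x where
  toFun := changeSplitting g Υ x
  invFun := unsplit g Υ x
  map_add' s t := by
    simp only [hg.changeSplitting_eq]
    refine Prod.ext ?_ (Prod.ext ?_ ?_)
    · simp only [Prod.fst_add, Prod.snd_add, map_add]
      ring
    · simp only [Prod.fst_add, Prod.snd_add]
      module
    · simp only [Prod.snd_add]
      ring
  map_smul' c s := by
    simp only [hg.changeSplitting_eq]
    refine Prod.ext ?_ (Prod.ext ?_ ?_)
    · simp only [Prod.smul_fst, Prod.smul_snd, map_smul, smul_eq_mul, RingHom.id_apply]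
      ring
    · simp only [Prod.smul_fst, Prod.smul_snd, RingHom.id_apply, smul_eq_mul]
      module
    · simp only [Prod.smul_snd, smul_eq_mul, RingHom.id_apply]
      ring
  left_inv s := by
    have h : Real.exp (Υ x) * Real.exp (-Υ x) = 1 := by rw [← Real.exp_add]; simp
    have h' : Real.exp (-Υ x) * (Real.exp (Υ x) * s.2.2) = s.2.2 := by
      linear_combination s.2.2 * h
    have hX : Real.exp (Υ x) • Real.exp (-Υ x) • (s.2.1 + s.2.2 • grad g Υ x)
        = s.2.1 + s.2.2 • grad g Υ x := by rw [smul_smul, h, one_smul]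
    simp only [hg.changeSplitting_eq, unsplit, h', hX]
    refine Prod.ext ?_ (Prod.ext ?_ rfl)
    · simp only [map_add, map_smul, smul_eq_mul]
      linear_combination (s.1 - g x (grad g Υ x) s.2.1
          - 1 / 2 * s.2.2 * g x (grad g Υ x) (grad g Υ x)) * h
    · exact add_sub_cancel_right _ _
  right_inv s := by
    have h : Real.exp (-Υ x) * Real.exp (Υ x) = 1 := by rw [← Real.exp_add]; simp
    simp only [hg.changeSplitting_eq, unsplit]
    refine Prod.ext ?_ (Prod.ext ?_ ?_)
    · simp only [map_sub, map_smul, smul_eq_mul]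
      linear_combination s.1 * h
    · simp only [sub_add_cancel, smul_smul, h, one_smul]
    · linear_combination s.2.2 * h

theorem MetricAt.splittingEquiv_apply (hg : MetricAt g x) (Υ : M → ℝ) (s : Tractor (E := E) x) :
    hg.splittingEquiv Υ s = changeSplitting g Υ x s := rfl

theorem MetricAt.changeSplitting_unsplit (hg : MetricAt g x) (Υ : M → ℝ)
    (s : Tractor (E := E) x) : changeSplitting g Υ x (unsplit g Υ x s) = s :=
  (hg.splittingEquiv Υ).right_inv s

theorem MetricAt.changeSplitting_smul_add_smul_unsplit (hg : MetricAt g x) (Υ : M → ℝ) (a b : ℝ)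
    (s t : Tractor (E := E) x) :
    changeSplitting g Υ x (a • unsplit g Υ x s + b • unsplit g Υ x t) = a • s + b • t := by
  rw [← hg.splittingEquiv_apply, map_add, map_smul, map_smul, hg.splittingEquiv_apply,
    hg.splittingEquiv_apply, hg.changeSplitting_unsplit, hg.changeSplitting_unsplit]

/-- The tractor metric does not depend on the splitting. -/
theorem MetricAt.tractorMetric_changeSplitting (hg : MetricAt g x) (Υ : M → ℝ)
    (s t : Tractor (E := E) x) :
    tractorMetric (ConformalTractor.rescale Υ g) x (changeSplitting g Υ x s)
      (changeSplitting g Υ x t) = tractorMetric g x s t := by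
  have h : Real.exp (-Υ x) * Real.exp (Υ x) = 1 := by rw [← Real.exp_add]; simp
  have h2 : Real.exp (2 * Υ x) = Real.exp (Υ x) * Real.exp (Υ x) := by
    rw [← Real.exp_add]; ring_nf
  simp only [tractorMetric, hg.changeSplitting_eq, rescale_apply, h2, map_smul, map_add,
    smul_apply, add_apply, smul_eq_mul]
  rw [hg.symm x s.2.1 (grad g Υ x)]
  set e := Real.exp (-Υ x)
  set e' := Real.exp (Υ x)
  have h3 : e' * e' * (e * e) = 1 := by
    calc _ = (e * e') * (e * e') := by ring
      _ = 1 := by rw [h, one_mul]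
  linear_combination (s.2.2 * (t.1 - g x (grad g Υ x) t.2.1
      - 1 / 2 * t.2.2 * g x (grad g Υ x) (grad g Υ x))
    + t.2.2 * (s.1 - g x (grad g Υ x) s.2.1
      - 1 / 2 * s.2.2 * g x (grad g Υ x) (grad g Υ x))) * h
    + (g x s.2.1 t.2.1 + t.2.2 * g x (grad g Υ x) s.2.1 + s.2.2 * g x (grad g Υ x) t.2.1
      + s.2.2 * t.2.2 * g x (grad g Υ x) (grad g Υ x)) * h3

theorem smoothTractorOn_of_forall {U : Set M} {s : TractorField E M}
    (h : ∀ x ∈ U, SmoothTractorAt s x) : SmoothTractorOn U s :=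
  ⟨fun x hx ↦ (h x hx).1.contMDiffAt.contMDiffWithinAt,
    fun x hx ↦ (h x hx).2.1.contMDiffAt.contMDiffWithinAt,
    fun x hx ↦ (h x hx).2.2.contMDiffAt.contMDiffWithinAt⟩

theorem SmoothTractorAt.unsplit (hg : MetricAt g x) (hΥ : SmoothFnAt E Υ x)
    {s : TractorField E M} (hs : SmoothTractorAt s x) :
    SmoothTractorAt (fun y ↦ unsplit g Υ y (s y)) x := by
  have hN := hg.smoothFieldAt_grad hΥ
  have h3 := hΥ.neg.exp.mul hs.2.2
  have hX := hs.2.1.smul hΥ.exp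
  exact ⟨((hΥ.exp.mul hs.1).add (hg.smoothFnAt hN hX)).sub
      (((SmoothFnAt.const E (1 / 2) x).mul h3).mul (hg.smoothFnAt hN hN)),
    hX.sub (hN.smul h3), h3⟩

theorem SmoothTractorAt.changeSplitting (hg : MetricAt g x) (hΥ : SmoothFnAt E Υ x)
    {s : TractorField E M} (hs : SmoothTractorAt s x) :
    SmoothTractorAt (fun y ↦ changeSplitting g Υ y (s y)) x := by
  have hN := hg.smoothFieldAt_grad hΥ
  have hev := hg.eventually
  refine ⟨(hΥ.neg.exp.mul ((hs.1.sub (hg.smoothFnAt hN hs.2.1)).sub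
      (((SmoothFnAt.const E (1 / 2) x).mul hs.2.2).mul (hg.smoothFnAt hN hN)))).congr
      (hev.mono fun y hy ↦ by simp only [hy.changeSplitting_eq]),
    ((hs.2.1.add (hN.smul hs.2.2)).smul hΥ.neg.exp).congr
      (hev.mono fun y hy ↦ by simp only [hy.changeSplitting_eq]; rfl), hΥ.exp.mul hs.2.2⟩

/-! ### Null radiation and the Schouten tensor -/

theorem MetricAt.scal_of_ricci_eq (hg : MetricAt g x) {k : TangentSpace 𝓘(ℝ, E) x} {φ : ℝ}
    (hk : g x k k = 0) (h : ∀ v w, ricci g x v w = φ * (g x k v * g x k w)) : scal g x = 0 := by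
  have h1 : ∀ v, raise g x (ricci g x v) = (φ * g x k v) • k := fun v ↦
    (hg.eq_raise (hg.ricci_isLinearMap v) fun w ↦ by
      rw [map_smul, smul_apply, smul_eq_mul, h]; ring).symm
  rw [scal_eq_tr]
  simp only [h1]
  rw [tr_smul_const x (α := fun v ↦ φ * g x k v) ⟨fun v w ↦ by rw [map_add]; ring,
    fun c v ↦ by rw [map_smul, smul_eq_mul, smul_eq_mul]; ring⟩, hk, mul_zero]

theorem MetricAt.schouten_of_ricci_eq (hg : MetricAt g x) {k : TangentSpace 𝓘(ℝ, E) x} {φ : ℝ}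
    (hk : g x k k = 0) (h : ∀ v w, ricci g x v w = φ * (g x k v * g x k w))
    (v w : TangentSpace 𝓘(ℝ, E) x) :
    schouten g x v w
      = 1 / ((Module.finrank ℝ E : ℝ) - 2) * φ * (g x k v * g x k w) := by
  rw [schouten, hg.scal_of_ricci_eq hk h, h]
  ring

/-- Here `R_{ab} = (n - 2) c K_a K_b + r g_{ab}` with `r = R / (2 (n - 1))`. Its trace gives
`R = n r` because `K` is null, so that `(n - 2) r = 0`. -/
theorem MetricAt.ricci_of_schouten_eq (hg : MetricAt g x) (hn : 2 < Module.finrank ℝ E)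
    {k : TangentSpace 𝓘(ℝ, E) x} {c : ℝ} (hk : g x k k = 0)
    (h : ∀ v w, schouten g x v w = c * (g x k v * g x k w)) (v w : TangentSpace 𝓘(ℝ, E) x) :
    ricci g x v w = ((Module.finrank ℝ E : ℝ) - 2) * c * (g x k v * g x k w) := by
  have hn' : (2 : ℝ) < Module.finrank ℝ E := by exact_mod_cast hn
  have h2 : (Module.finrank ℝ E : ℝ) - 2 ≠ 0 := by linarith
  have h1 : (Module.finrank ℝ E : ℝ) - 1 ≠ 0 := by linarith
  set r := scal g x / (2 * ((Module.finrank ℝ E : ℝ) - 1)) with hr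
  clear_value r
  have hric : ∀ v w, ricci g x v w
      = ((Module.finrank ℝ E : ℝ) - 2) * c * (g x k v * g x k w) + r * g x v w := fun v w ↦ by
    have := h v w
    rw [schouten, ← hr] at this
    field_simp at this
    linear_combination this
  have hra : ∀ v, raise g x (ricci g x v)
      = (((Module.finrank ℝ E : ℝ) - 2) * c * g x k v) • k + r • v := fun v ↦
    (hg.eq_raise (hg.ricci_isLinearMap v) fun w ↦ by
      rw [map_add, map_smul, map_smul, add_apply, smul_apply, smul_apply, smul_eq_mul,
        smul_eq_mul, hric]; ring).symm
  have hs : scal g x = r * Module.finrank ℝ E := by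
    rw [scal_eq_tr]
    simp only [hra]
    rw [tr_add, tr_smul, tr_id, tr_smul_const x
      (α := fun v ↦ ((Module.finrank ℝ E : ℝ) - 2) * c * g x k v)
      ⟨fun v w ↦ by rw [map_add]; ring, fun c v ↦ by rw [map_smul, smul_eq_mul, smul_eq_mul]; ring⟩,
      hk]
    ring
  have hs0 : r = 0 := by
    have h3 : scal g x = 2 * ((Module.finrank ℝ E : ℝ) - 1) * r := by
      rw [hr]; field_simp
    have : ((Module.finrank ℝ E : ℝ) - 2) * r = 0 := by linear_combination hs - h3
    exact (mul_eq_zero.1 this).resolve_left h2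
  rw [hric, hs0, zero_mul, add_zero]

/-! ### Aligned pure radiation metrics and parallel null planes -/

theorem MetricAt.exists_apply_eq_one (hg : MetricAt g x) {k : TangentSpace 𝓘(ℝ, E) x}
    (hk : k ≠ 0) : ∃ w, g x k w = 1 := by
  by_contra! h
  refine hk (hg.nondegenerate x k fun w ↦ ?_)
  by_contra h0
  exact h ((g x k w)⁻¹ • w) (by rw [map_smul, smul_eq_mul, inv_mul_cancel₀ h0])

/-- A smooth field all of whose values are multiples of a recurrent field `K` has covariant
derivatives that are multiples of `K`. -/
theorem MetricAt.nabla_mem_ray (hg : MetricAt g x) {K : VField E M} (hK : SmoothFieldAt K x)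
    (h0 : K x ≠ 0) (hX : SmoothFieldAt X x) (hXK : ∀ᶠ y in 𝓝 x, ∃ a : ℝ, X y = a • K y)
    {v : TangentSpace 𝓘(ℝ, E) x} {c : ℝ} (hv : nabla g K x v = c • K x) :
    ∃ a : ℝ, nabla g X x v = a • K x := by
  obtain ⟨w, hw⟩ := hg.exists_apply_eq_one h0
  have hk := hg.smoothFnAt hK (smoothFieldAt_ext w)
  have hk0 : g x (K x) (ext w x) ≠ 0 := by rw [ext_apply_self, hw]; exact one_ne_zero
  have ha := (hg.smoothFnAt hX (smoothFieldAt_ext w)).mul (hk.inv hk0)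
  have hXa : X =ᶠ[𝓝 x] (fun y ↦ (g y (X y) (ext w y) * (g y (K y) (ext w y))⁻¹) • K y :
      VField E M) := by
    filter_upwards [hXK, hk.continuousAt.eventually_ne hk0] with y ⟨a, hy⟩ hy0
    rw [hy, map_smul, smul_apply, smul_eq_mul, mul_assoc, mul_inv_cancel₀ hy0, mul_one]
  have h := (hg.nabla_congr hX hXa v).trans (hg.nabla_smul ha hK v)
  rw [hv, smul_smul, ← add_smul] at h
  exact ⟨_, h⟩

/-- If the aligned pure radiation metric `e^{2Υ} g` has rays spanned by `K`, then the planes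
spanned by `(0, K, 0)` and `(0, 0, 1)` are totally null and parallel. -/
theorem isParallelNullPlaneOn_of_isAlignedPureRadiationOn (hn : 2 < Module.finrank ℝ E)
    (hg : ∀ x, MetricAt g x) {U : Set M} (hU : IsOpen U) {K : VField E M}
    {H : (x : M) → Submodule ℝ (Tractor (E := E) x)}
    (hΥ : ContMDiffOn 𝓘(ℝ, E) 𝓘(ℝ, ℝ) ∞ Υ U)
    (hK : IsAlignedPureRadiationOn U (rescale Υ g) K) (hH : IsSpannedByRayOn g U Υ K H) :
    IsParallelNullPlaneOn g U H where
  plane x hx := by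
    have hs : ∀ y ∈ U, SmoothTractorAt (fun y ↦ ((0, K y, 0) : Tractor (E := E) y)) y := fun y hy ↦
      ⟨.const E 0 y, .of_smoothVFieldOn hU hy hK.smooth, .const E 0 y⟩
    have ht : ∀ y ∈ U, SmoothTractorAt (fun y ↦ ((0, 0, 1) : Tractor (E := E) y)) y := fun y hy ↦
      ⟨.const E 0 y, .zero E y, .const E 1 y⟩
    have hΥ' : ∀ y ∈ U, SmoothFnAt E Υ y := fun y hy ↦ .of_contMDiffOn hU hy hΥ
    refine ⟨U, _, _, hU, hx, subset_rfl,
      smoothTractorOn_of_forall fun y hy ↦ (hs y hy).unsplit (hg y) (hΥ' y hy),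
      smoothTractorOn_of_forall fun y hy ↦ (ht y hy).unsplit (hg y) (hΥ' y hy), fun y hy ↦ ⟨?_, ?_⟩⟩
    · rw [LinearIndependent.pair_iff]
      intro a b hab
      have h2 := (((hg y).changeSplitting_smul_add_smul_unsplit Υ a b
        (0, K y, 0) (0, 0, 1)).symm.trans
        (congrArg _ hab)).trans (map_zero ((hg y).splittingEquiv Υ))
      have h3 := congrArg (fun t ↦ t.2.1) h2
      have h4 := congrArg (fun t ↦ t.2.2) h2
      simp at h3 h4
      exact ⟨h3.resolve_right (hK.ne_zero y hy), h4⟩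
    · ext t
      rw [hH y hy t, Submodule.mem_span_pair]
      refine exists_congr fun a ↦ exists_congr fun b ↦ ?_
      have h2 : a • ((0, K y, 0) : Tractor (E := E) y) + b • (0, 0, 1) = (0, a • K y, b) := by simp
      rw [← h2, ← (hg y).changeSplitting_smul_add_smul_unsplit Υ]
      exact ((hg y).splittingEquiv Υ).injective.eq_iff.trans eq_comm
  null x hx s hs t ht := by
    obtain ⟨a, b, hs⟩ := (hH x hx s).1 hs
    obtain ⟨c, d, ht⟩ := (hH x hx t).1 ht
    rw [← (hg x).tractorMetric_changeSplitting Υ, hs, ht]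
    have := hK.null x hx
    simp only [tractorMetric, map_smul, smul_apply, this, smul_zero, mul_zero, zero_mul, add_zero]
  parallel V s hV hVU hs hsH x hx v := by
    have hxU := hVU hx
    have hΥx : SmoothFnAt E Υ x := .of_contMDiffOn hU hxU hΥ
    have hsx := SmoothTractorAt.of_smoothTractorOn hV hx hs
    have hr := (hg x).rescale hΥx
    have hVx := hV.mem_nhds hx
    obtain ⟨φ, hφ⟩ := hK.ricci_eq
    obtain ⟨f, hf⟩ := hK.parallel_ray
    have hP := hr.schouten_of_ricci_eq (hK.null x hxU) (hφ x hxU)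
    obtain ⟨a, b, hab⟩ := (hH x hxU _).1 (hsH x hx)
    obtain ⟨c, hc⟩ := hr.nabla_mem_ray (.of_smoothVFieldOn hU hxU hK.smooth) (hK.ne_zero x hxU)
      (hsx.changeSplitting (hg x) hΥx).2.1 (by
        filter_upwards [hVx] with y hy
        obtain ⟨a, b, h⟩ := (hH y (hVU hy) _).1 (hsH y hy)
        exact ⟨a, by rw [h]⟩) (hf x hxU v)
    have hraise : raise (rescale Υ g) x (fun w ↦ schouten (rescale Υ g) x v w)
        = (1 / ((Module.finrank ℝ E : ℝ) - 2) * φ x * rescale Υ g x (K x) v) • K x :=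
      (hr.eq_raise (hr.schouten_isLinearMap v) fun w ↦ by
        rw [map_smul, smul_apply, smul_eq_mul, hP]; ring).symm
    have hd : dirDeriv (fun y ↦ (changeSplitting g Υ y (s y)).1) x v = 0 := by
      rw [dirDeriv_congr (f' := fun _ ↦ 0) (by
        filter_upwards [hVx] with y hy
        obtain ⟨a, b, h⟩ := (hH y (hVU hy) _).1 (hsH y hy)
        rw [h]), dirDeriv_const]
    rw [hH x hxU, ← (hg x).tractorNabla_changeSplitting hΥx hn hsx]
    refine ⟨c + b * (1 / ((Module.finrank ℝ E : ℝ) - 2) * φ x * rescale Υ g x (K x) v), _,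
      Prod.ext ?_ (Prod.ext ?_ rfl)⟩
    · simp only [tractorNabla, hd, hab, hP, map_smul, hK.null x hxU]
      simp
    · simp only [tractorNabla, hc, hab, hraise]
      simp only [zero_smul, add_zero, smul_smul, add_smul]

/-- A parallel null plane field that is spanned by `(0, K, 0)` and `(0, 0, 1)` in the splitting
given by `e^{2Υ} g` makes this metric an aligned pure radiation metric. -/
theorem isAlignedPureRadiationOn_of_isParallelNullPlaneOn (hn : 2 < Module.finrank ℝ E)
    (hg : ∀ x, MetricAt g x) {U : Set M} (hU : IsOpen U) {K : VField E M}
    {H : (x : M) → Submodule ℝ (Tractor (E := E) x)}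
    (hΥ : ContMDiffOn 𝓘(ℝ, E) 𝓘(ℝ, ℝ) ∞ Υ U) (hK : SmoothVFieldOn U K) (hK0 : ∀ x ∈ U, K x ≠ 0)
    (hH : IsSpannedByRayOn g U Υ K H) (hpar : IsParallelNullPlaneOn g U H) :
    IsAlignedPureRadiationOn U (rescale Υ g) K := by
  have hs : ∀ y ∈ U, SmoothTractorAt (fun y ↦ ((0, K y, 0) : Tractor (E := E) y)) y := fun y hy ↦
    ⟨.const E 0 y, .of_smoothVFieldOn hU hy hK, .const E 0 y⟩
  have ht : ∀ y ∈ U, SmoothTractorAt (fun y ↦ ((0, 0, 1) : Tractor (E := E) y)) y := fun y hy ↦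
    ⟨.const E 0 y, .zero E y, .const E 1 y⟩
  have hΥ' : ∀ y ∈ U, SmoothFnAt E Υ y := fun y hy ↦ .of_contMDiffOn hU hy hΥ
  have hr : ∀ x ∈ U, MetricAt (rescale Υ g) x := fun x hx ↦ (hg x).rescale (hΥ' x hx)
  have key : ∀ s : TractorField E M, (∀ y ∈ U, SmoothTractorAt s y) →
      (∀ y ∈ U, ∃ a b : ℝ, s y = (0, a • K y, b)) → ∀ x ∈ U, ∀ v,
      ∃ a b : ℝ, tractorNabla (rescale Υ g) s x v = (0, a • K x, b) := by
    intro s hs hsK x hx v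
    have h := hpar.parallel U (fun y ↦ unsplit g Υ y (s y)) hU subset_rfl
      (smoothTractorOn_of_forall fun y hy ↦ (hs y hy).unsplit (hg y) (hΥ' y hy))
      (fun y hy ↦ (hH y hy _).2 (by rw [(hg y).changeSplitting_unsplit]; exact hsK y hy)) x hx v
    rw [hH x hx, ← (hg x).tractorNabla_changeSplitting (hΥ' x hx) hn
      ((hs x hx).unsplit (hg x) (hΥ' x hx))] at h
    simpa only [(hg _).changeSplitting_unsplit] using h
  have hnull : ∀ x ∈ U, rescale Υ g x (K x) (K x) = 0 := fun x hx ↦ by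
    have hm : unsplit g Υ x (0, K x, 0) ∈ H x := (hH x hx _).2
      ⟨1, 0, by rw [(hg x).changeSplitting_unsplit, one_smul]⟩
    have := hpar.null x hx _ hm _ hm
    rw [← (hg x).tractorMetric_changeSplitting Υ, (hg x).changeSplitting_unsplit] at this
    simpa [tractorMetric] using this
  have hPK : ∀ x ∈ U, ∃ c : ℝ, ∀ v w, schouten (rescale Υ g) x v w
      = c * (rescale Υ g x (K x) v * rescale Υ g x (K x) w) := fun x hx ↦ by
    obtain ⟨w₀, hw₀⟩ := (hr x hx).exists_apply_eq_one (hK0 x hx)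
    have h1 : ∀ v, ∃ c : ℝ, ∀ w, schouten (rescale Υ g) x v w = c * rescale Υ g x (K x) w := by
      intro v
      obtain ⟨a, b, hab⟩ := key _ ht (fun y _ ↦ ⟨0, 1, by rw [zero_smul]⟩) x hx v
      have h2 := congrArg (fun t ↦ t.2.1) hab
      have h0 : nabla (rescale Υ g) (fun _ ↦ 0) x v = 0 := by
        have := (hr x hx).nabla_smul (.const E 0 x) (.zero E x) v
        simpa only [smul_zero, zero_smul, add_zero] using this
      simp only [tractorNabla, h0, zero_smul, zero_add, one_smul] at h2
      refine ⟨a, fun w ↦ ?_⟩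
      rw [← (hr x hx).apply_raise ((hr x hx).schouten_isLinearMap v) w]
      erw [h2]
      rw [map_smul, smul_apply, smul_eq_mul]
    choose c hc using h1
    refine ⟨c w₀, fun v w ↦ ?_⟩
    have h3 : c v = c w₀ * rescale Υ g x (K x) v := by
      rw [← hc, (hr x hx).schouten_symm, hc, hw₀, mul_one]
    rw [hc, h3, mul_assoc]
  have hray : ∀ x ∈ U, ∀ v, ∃ a : ℝ, nabla (rescale Υ g) K x v = a • K x := fun x hx v ↦ by
    obtain ⟨a, b, hab⟩ := key _ hs (fun y _ ↦ ⟨1, 0, by rw [one_smul]⟩) x hx v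
    have h2 := congrArg (fun t ↦ t.2.1) hab
    simp only [tractorNabla, zero_smul, add_zero] at h2
    exact ⟨a, h2⟩
  refine ⟨hK, hK0, hnull, ?_, ?_⟩
  · choose! c hc using hPK
    exact ⟨fun x ↦ ((Module.finrank ℝ E : ℝ) - 2) * c x, fun x hx ↦
      (hr x hx).ricci_of_schouten_eq hn (hnull x hx) (hc x hx)⟩
  · have : ∀ x : M, ∃ F : TangentSpace 𝓘(ℝ, E) x →L[ℝ] ℝ, x ∈ U → ∀ v,
        nabla (rescale Υ g) K x v = F v • K x := fun x ↦ by
      by_cases hx : x ∈ U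
      · obtain ⟨w₀, hw₀⟩ := (hr x hx).exists_apply_eq_one (hK0 x hx)
        have hlin := (hr x hx).nabla_isLinearMap (.of_smoothVFieldOn hU hx hK)
        let L : E →ₗ[ℝ] ℝ :=
          { toFun := fun v ↦ rescale Υ g x (nabla (rescale Υ g) K x v) w₀
            map_add' := fun v w ↦ by
              refine (congrArg (fun t ↦ rescale Υ g x t w₀) (hlin.map_add v w)).trans ?_
              rw [map_add, add_apply]
            map_smul' := fun c v ↦ by
              refine (congrArg (fun t ↦ rescale Υ g x t w₀) (hlin.map_smul c v)).trans ?_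
              rw [map_smul, smul_apply, RingHom.id_apply] }
        refine ⟨(LinearMap.toContinuousLinearMap L : E →L[ℝ] ℝ), fun _ v ↦ ?_⟩
        obtain ⟨a, ha⟩ := hray x hx v
        have : (LinearMap.toContinuousLinearMap L : E →L[ℝ] ℝ) v
          = rescale Υ g x (nabla (rescale Υ g) K x v) w₀ := rfl
        refine Eq.trans ?_ (congrArg (fun t : ℝ ↦ t • K x) this.symm)
        rw [ha, map_smul, smul_apply, hw₀, smul_eq_mul, mul_one]
      · exact ⟨0, fun h ↦ (hx h).elim⟩
    choose F hF using this
    exact ⟨F, fun x hx v ↦ hF x hx v⟩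

/-! ### The tractor metric -/

theorem tractorMetric_add_left (g : BilinField E M) (x : M) (s t r : Tractor (E := E) x) :
    tractorMetric g x (s + t) r = tractorMetric g x s r + tractorMetric g x t r := by
  simp only [tractorMetric, Prod.fst_add, Prod.snd_add, map_add, add_apply]
  ring

theorem tractorMetric_sub_left (g : BilinField E M) (x : M) (s t r : Tractor (E := E) x) :
    tractorMetric g x (s - t) r = tractorMetric g x s r - tractorMetric g x t r := by
  simp only [tractorMetric, Prod.fst_sub, Prod.snd_sub, map_sub, sub_apply]
  ring

theorem tractorMetric_smul_left (g : BilinField E M) (x : M) (c : ℝ) (s r : Tractor (E := E) x) :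
    tractorMetric g x (c • s) r = c * tractorMetric g x s r := by
  simp only [tractorMetric, Prod.smul_fst, Prod.smul_snd, map_smul, smul_apply, smul_eq_mul]
  ring

theorem MetricAt.eq_zero_of_tractorMetric (hg : MetricAt g x) {s : Tractor (E := E) x}
    (h : ∀ r, tractorMetric g x s r = 0) : s = 0 := by
  refine Prod.ext ?_ (Prod.ext ?_ ?_)
  · simpa [tractorMetric] using h (0, 0, 1)
  · exact hg.nondegenerate x _ fun w ↦ by simpa [tractorMetric] using h (0, w, 0)
  · simpa [tractorMetric] using h (1, 0, 0)

theorem MetricAt.exists_tractorMetric_ne_zero (hg : MetricAt g x) {s : Tractor (E := E) x}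
    (hs : s ≠ 0) : ∃ r, tractorMetric g x s r ≠ 0 := by
  by_contra! h
  exact hs (hg.eq_zero_of_tractorMetric h)

/-- Two linearly independent tractors have a nonvanishing `2 × 2` minor. -/
theorem MetricAt.exists_minor_ne_zero (hg : MetricAt g x) {s t : Tractor (E := E) x}
    (hst : LinearIndependent ℝ ![s, t]) : ∃ p q, tractorMetric g x s p * tractorMetric g x t q
      - tractorMetric g x t p * tractorMetric g x s q ≠ 0 := by
  rw [LinearIndependent.pair_iff] at hst
  obtain ⟨p, hp⟩ := hg.exists_tractorMetric_ne_zero (s := s) fun h ↦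
    one_ne_zero (hst 1 0 (by rw [h, smul_zero, zero_smul, add_zero])).1
  obtain ⟨q, hq⟩ := hg.exists_tractorMetric_ne_zero
      (s := -tractorMetric g x t p • s + tractorMetric g x s p • t) fun h ↦ hp (hst _ _ h).2
  refine ⟨p, q, ?_⟩
  rw [tractorMetric_add_left, tractorMetric_smul_left, tractorMetric_smul_left] at hq
  convert! hq using 1
  ring

theorem MetricAt.smoothFnAt_tractorMetric (hg : MetricAt g x) {s t : TractorField E M}
    (hs : SmoothTractorAt s x) (ht : SmoothTractorAt t x) :
    SmoothFnAt E (fun y ↦ tractorMetric g y (s y) (t y)) x :=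
  ((hs.2.2.mul ht.1).add (hs.1.mul ht.2.2)).add (hg.smoothFnAt hs.2.1 ht.2.1)

theorem SmoothTractorAt.add {s t : TractorField E M} (hs : SmoothTractorAt s x)
    (ht : SmoothTractorAt t x) : SmoothTractorAt (fun y ↦ s y + t y) x :=
  ⟨hs.1.add ht.1, hs.2.1.add ht.2.1, hs.2.2.add ht.2.2⟩

theorem SmoothTractorAt.sub {s t : TractorField E M} (hs : SmoothTractorAt s x)
    (ht : SmoothTractorAt t x) : SmoothTractorAt (fun y ↦ s y - t y) x :=
  ⟨hs.1.sub ht.1, hs.2.1.sub ht.2.1, hs.2.2.sub ht.2.2⟩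

theorem SmoothTractorAt.smul {s : TractorField E M} (hf : SmoothFnAt E f x)
    (hs : SmoothTractorAt s x) : SmoothTractorAt (fun y ↦ f y • s y) x :=
  ⟨hf.mul hs.1, hs.2.1.smul hf, hf.mul hs.2.2⟩

theorem exists_smoothTractorAt_eq (r : Tractor (E := E) x) :
    ∃ s : TractorField E M, SmoothTractorAt s x ∧ s x = r :=
  ⟨fun y ↦ (r.1, ext r.2.1 y, r.2.2), ⟨.const E _ x, smoothFieldAt_ext _, .const E _ x⟩,
    by simp only [ext_apply_self]⟩

theorem MetricAt.smoothTractorAt_tractorNabla (hg : MetricAt g x) {s : TractorField E M}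
    (hs : SmoothTractorAt s x) (hV : SmoothFieldAt V x) :
    SmoothTractorAt (fun y ↦ tractorNabla g s y (V y)) x := by
  refine ⟨(hs.1.dirDeriv hV).sub (hg.smoothFnAt_schouten hV hs.2.1),
    ((hg.smoothFieldAt_nabla hs.2.1 hV).add (hV.smul hs.1)).add
      (SmoothFieldAt.smul hs.2.2 (hg.smoothFieldAt_raise ?_ fun Z hZ ↦
        hg.smoothFnAt_schouten hV hZ)),
    (hs.2.2.dirDeriv hV).sub (hg.smoothFnAt hV hs.2.1)⟩
  exact hg.eventually.mono fun y hy ↦ hy.schouten_isLinearMap _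

/-! ### Extension across a dense open set -/

theorem eq_zero_of_dense {U : Set M} (hU : Dense U) {f : M → ℝ} (hf : ContinuousAt f x)
    (h : ∀ᶠ y in 𝓝 x, y ∈ U → f y = 0) : f x = 0 := by
  by_contra h0
  obtain ⟨y, hyU, hy, hy0⟩ :=
    ((mem_closure_iff_frequently.1 (hU x)).and_eventually (h.and (hf.eventually_ne h0))).exists
  exact hy0 (hy hyU)

/-- Let `s`, `t`, `r` be smooth near `x`, with `s x` and `t x` linearly independent. If `r` is a
combination of `s` and `t` at the points of a dense set, then it is one at `x`: the coefficients
are given by Cramer's rule, hence smooth near `x`. -/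
theorem MetricAt.mem_span_of_dense (hg : MetricAt g x) {U : Set M} (hU : Dense U)
    {s t r : TractorField E M} (hs : SmoothTractorAt s x) (ht : SmoothTractorAt t x)
    (hr : SmoothTractorAt r x) (hst : LinearIndependent ℝ ![s x, t x])
    (h : ∀ᶠ y in 𝓝 x, y ∈ U → r y ∈ Submodule.span ℝ {s y, t y}) :
    r x ∈ Submodule.span ℝ {s x, t x} := by
  obtain ⟨p₀, q₀, hpq⟩ := hg.exists_minor_ne_zero hst
  obtain ⟨p, hp, rfl⟩ := exists_smoothTractorAt_eq p₀
  obtain ⟨q, hq, rfl⟩ := exists_smoothTractorAt_eq q₀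
  have hsp := hg.smoothFnAt_tractorMetric hs hp
  have hsq := hg.smoothFnAt_tractorMetric hs hq
  have htp := hg.smoothFnAt_tractorMetric ht hp
  have htq := hg.smoothFnAt_tractorMetric ht hq
  have hrp := hg.smoothFnAt_tractorMetric hr hp
  have hrq := hg.smoothFnAt_tractorMetric hr hq
  have hz := (SmoothTractorAt.smul ((hsp.mul htq).sub (htp.mul hsq)) hr).sub
    ((SmoothTractorAt.smul ((hrp.mul htq).sub (hrq.mul htp)) hs).add
      (SmoothTractorAt.smul ((hrq.mul hsp).sub (hrp.mul hsq)) ht))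
  have h0 := hg.eq_zero_of_tractorMetric fun w₀ ↦ by
    obtain ⟨w, hw, rfl⟩ := exists_smoothTractorAt_eq w₀
    refine eq_zero_of_dense hU (hg.smoothFnAt_tractorMetric hz hw).continuousAt ?_
    filter_upwards [h] with y hy hyU
    obtain ⟨a, b, hab⟩ := Submodule.mem_span_pair.1 (hy hyU)
    simp only [← hab, tractorMetric_add_left, tractorMetric_sub_left, tractorMetric_smul_left]
    ring
  have h1 := sub_eq_zero.1 h0
  refine (Submodule.smul_mem_iff _ hpq).1 ?_
  rw [h1]
  exact Submodule.mem_span_pair.2 ⟨_, _, rfl⟩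

/-- A smooth plane field that is totally null and parallel over a dense open set is totally null
and parallel. -/
theorem IsParallelNullPlaneOn.extend (hg : ∀ x, MetricAt g x) {U : Set M} (hU : IsOpen U)
    (hUd : Dense U) {H : (x : M) → Submodule ℝ (Tractor (E := E) x)}
    (hH : IsPlaneSubbundleOn Set.univ H) (hpar : IsParallelNullPlaneOn g U H) :
    IsParallelNullPlaneOn g Set.univ H where
  plane := hH
  null x _ a ha b hb := by
    obtain ⟨V, s, t, hV, hxV, -, hs, ht, hst⟩ := hH x trivial
    have hs' := SmoothTractorAt.of_smoothTractorOn hV hxV hs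
    have ht' := SmoothTractorAt.of_smoothTractorOn hV hxV ht
    rw [(hst x hxV).2, Submodule.mem_span_pair] at ha hb
    obtain ⟨a₁, a₂, rfl⟩ := ha
    obtain ⟨b₁, b₂, rfl⟩ := hb
    have hc (c₁ c₂ : ℝ) : SmoothTractorAt (fun y ↦ c₁ • s y + c₂ • t y) x :=
      (SmoothTractorAt.smul (.const E c₁ x) hs').add (SmoothTractorAt.smul (.const E c₂ x) ht')
    refine eq_zero_of_dense hUd
      ((hg x).smoothFnAt_tractorMetric (hc a₁ a₂) (hc b₁ b₂)).continuousAt ?_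
    filter_upwards [hV.mem_nhds hxV] with y hy hyU
    have hm (c₁ c₂ : ℝ) : c₁ • s y + c₂ • t y ∈ H y := by
      rw [(hst y hy).2, Submodule.mem_span_pair]
      exact ⟨c₁, c₂, rfl⟩
    exact hpar.null y hyU _ (hm _ _) _ (hm _ _)
  parallel W r hW _ hr hrH x hx v := by
    obtain ⟨V, s, t, hV, hxV, -, hs, ht, hst⟩ := hH x trivial
    have hs' := SmoothTractorAt.of_smoothTractorOn hV hxV hs
    have ht' := SmoothTractorAt.of_smoothTractorOn hV hxV ht
    have hr' := (hg x).smoothTractorAt_tractorNabla (.of_smoothTractorOn hW hx hr)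
      (smoothFieldAt_ext v)
    have h := (hg x).mem_span_of_dense hUd hs' ht' hr' (hst x hxV).1 (by
      filter_upwards [hV.mem_nhds hxV, hW.mem_nhds hx] with y hy hyW hyU
      rw [← (hst y hy).2]
      exact hpar.parallel (W ∩ U) r (hW.inter hU) Set.inter_subset_right
        ⟨hr.1.mono Set.inter_subset_left, hr.2.1.mono Set.inter_subset_left,
          hr.2.2.mono Set.inter_subset_left⟩ (fun z hz ↦ hrH z hz.1) y ⟨hyW, hyU⟩ _)
    rw [ext_apply_self] at h
    rw [(hst x hxV).2]
    exact h

/-! ### One-forms in a chart -/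

theorem tendsto_extChartAt_symm (x : M) :
    Tendsto (extChartAt 𝓘(ℝ, E) x).symm (𝓝 (extChartAt 𝓘(ℝ, E) x x)) (𝓝 x) := by
  simpa only [ContinuousAt, extChartAt_to_inv] using continuousAt_extChartAt_symm (I := 𝓘(ℝ, E)) x

theorem SmoothFnAt.contDiffAt_comp_symm {z : E} (hz : z ∈ (extChartAt 𝓘(ℝ, E) x).target)
    (hf : SmoothFnAt E f ((extChartAt 𝓘(ℝ, E) x).symm z)) :
    ContDiffAt ℝ ∞ (fun z ↦ f ((extChartAt 𝓘(ℝ, E) x).symm z)) z := by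
  rw [← contMDiffAt_iff_contDiffAt]
  exact hf.contMDiffAt.comp z ((contMDiffOn_extChartAt_symm (n := ∞) (I := 𝓘(ℝ, E)) x).contMDiffAt
    (extChartAt_target_mem_nhds' hz))

/-- The 1-form `g(X, ·)` in the chart at `x`, on whose target `v : E` stands for the coordinate
vector field `ext v`. -/
def chartForm (g : BilinField E M) (X : VField E M) (x : M) (z : E) : E →L[ℝ] ℝ :=
  (g ((extChartAt 𝓘(ℝ, E) x).symm z) (X ((extChartAt 𝓘(ℝ, E) x).symm z))).comp
    (((trivializationAt E (TangentSpace 𝓘(ℝ, E)) x).symmL ℝ ((extChartAt 𝓘(ℝ, E) x).symm z)).comp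
      ((trivializationAt E (TangentSpace 𝓘(ℝ, E)) x).continuousLinearMapAt ℝ x))

theorem chartForm_apply {z : E} (hz : z ∈ (extChartAt 𝓘(ℝ, E) x).target)
    (v : TangentSpace 𝓘(ℝ, E) x) :
    chartForm g X x z v = g ((extChartAt 𝓘(ℝ, E) x).symm z) (X ((extChartAt 𝓘(ℝ, E) x).symm z))
      (ext v ((extChartAt 𝓘(ℝ, E) x).symm z)) := by
  have h := (extChartAt 𝓘(ℝ, E) x).map_target hz
  rw [extChartAt_source] at h
  rw [ext_eq_symmL v h]
  rfl

theorem exists_ext_eq {y : M} (hy : y ∈ (chartAt E x).source) (w : TangentSpace 𝓘(ℝ, E) y) :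
    ∃ v : TangentSpace 𝓘(ℝ, E) x, ext v y = w := by
  let e := trivializationAt E (TangentSpace 𝓘(ℝ, E)) x
  have hy' : y ∈ e.baseSet := by simpa [e] using hy
  have hx' : x ∈ e.baseSet := FiberBundle.mem_baseSet_trivializationAt' x
  refine ⟨e.symmL ℝ x (e.continuousLinearMapAt ℝ y w), ?_⟩
  rw [ext_eq_symmL _ hy]
  rw [e.continuousLinearMapAt_symmL hx', e.symmL_continuousLinearMapAt hy']

theorem contDiffAt_of_apply {G : E → E →L[ℝ] ℝ} {z : E}
    (h : ∀ v, ContDiffAt ℝ ∞ (fun z ↦ G z v) z) : ContDiffAt ℝ ∞ G z := by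
  let b := Module.finBasis ℝ E
  have hG : G = fun z ↦ ∑ i, G z (b i) • (LinearMap.toContinuousLinearMap (b.coord i)) := by
    funext z
    ext v
    have h1 : G z v = ∑ i, b.repr v i * G z (b i) := by
      conv_lhs => rw [← b.sum_repr v, map_sum]
      simp only [map_smul, smul_eq_mul]
    simp [h1, mul_comm]
  rw [hG]
  exact ContDiffAt.sum fun i _ ↦ (h (b i)).smul contDiffAt_const

theorem MetricAt.eventually_contDiffAt_chartForm (hg : MetricAt g x) (hX : SmoothFieldAt X x) :
    ∀ᶠ z in 𝓝 (extChartAt 𝓘(ℝ, E) x x), ContDiffAt ℝ ∞ (chartForm g X x) z := by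
  have ht := tendsto_extChartAt_symm (E := E) x
  filter_upwards [ht.eventually hg.eventually, ht.eventually hX.eventually,
    extChartAt_target_mem_nhds (I := 𝓘(ℝ, E)) x] with z h1 h2 hz
  have hs := (extChartAt 𝓘(ℝ, E) x).map_target hz
  rw [extChartAt_source] at hs
  refine contDiffAt_of_apply fun v ↦ ?_
  refine ((h1.smoothFnAt h2 (smoothFieldAt_ext_of_mem v hs)).contDiffAt_comp_symm hz)
    |>.congr_of_eventuallyEq ?_
  filter_upwards [extChartAt_target_mem_nhds' hz] with z' hz'
  exact chartForm_apply hz' v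

/-- The derivative of `g(X, ·)` in a chart, by metric compatibility. The last term is symmetric in
`u` and `v`, so closedness can be read off from the first one. -/
theorem MetricAt.eventually_fderiv_chartForm (hg : MetricAt g x) (hX : SmoothFieldAt X x) :
    ∀ᶠ z in 𝓝 (extChartAt 𝓘(ℝ, E) x x), ∀ u v : TangentSpace 𝓘(ℝ, E) x,
      fderiv ℝ (chartForm g X x) z u v
        = g ((extChartAt 𝓘(ℝ, E) x).symm z) (nabla g X ((extChartAt 𝓘(ℝ, E) x).symm z)
            (ext u ((extChartAt 𝓘(ℝ, E) x).symm z))) (ext v ((extChartAt 𝓘(ℝ, E) x).symm z))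
        + g ((extChartAt 𝓘(ℝ, E) x).symm z) (X ((extChartAt 𝓘(ℝ, E) x).symm z))
            (nabla g (ext v) ((extChartAt 𝓘(ℝ, E) x).symm z)
              (ext u ((extChartAt 𝓘(ℝ, E) x).symm z))) := by
  have ht := tendsto_extChartAt_symm (E := E) x
  filter_upwards [ht.eventually hg.eventually, ht.eventually hX.eventually,
    extChartAt_target_mem_nhds (I := 𝓘(ℝ, E)) x, hg.eventually_contDiffAt_chartForm hX]
    with z h1 h2 hz h3 u v
  have hs := (extChartAt 𝓘(ℝ, E) x).map_target hz
  rw [extChartAt_source] at hs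
  have hv := smoothFieldAt_ext_of_mem v hs
  rw [← h1.dirDeriv_metric h2 hv,
    dirDeriv_ext u hs (h1.smoothFnAt h2 hv).mdifferentiableAt, (extChartAt 𝓘(ℝ, E) x).right_inv hz]
  refine (fderiv_apply_apply (h3.differentiableAt (by simp)) v u).symm.trans ?_
  refine congrArg (fun L : E →L[ℝ] ℝ ↦ L u) (Filter.EventuallyEq.fderiv_eq ?_)
  filter_upwards [extChartAt_target_mem_nhds' hz] with z' hz'
  exact chartForm_apply hz' v

/-- If the 1-forms `g(K, ·)` and `g(Y, ·)` are closed on the planes `K^⊥`, then near `x` there is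
a function `Υ` with `dΥ = -g(Y, ·)` on these planes. -/
theorem MetricAt.exists_potential (hg : MetricAt g x) {K : VField E M} (hK : SmoothFieldAt K x)
    (hY : SmoothFieldAt Y x) (hK0 : K x ≠ 0)
    (h1 : ∀ᶠ y in 𝓝 x, ∀ u v, g y (K y) u = 0 → g y (K y) v = 0 →
      g y (nabla g K y u) v = g y (nabla g K y v) u)
    (h2 : ∀ᶠ y in 𝓝 x, ∀ u v, g y (K y) u = 0 → g y (K y) v = 0 →
      g y (nabla g Y y u) v = g y (nabla g Y y v) u) :
    ∃ Υ : M → ℝ, SmoothFnAt E Υ x ∧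
      ∀ᶠ y in 𝓝 x, ∀ w, g y (K y) w = 0 → dirDeriv Υ y w = -g y (Y y) w := by
  have ht := tendsto_extChartAt_symm (E := E) x
  have htgt := extChartAt_target_mem_nhds (I := 𝓘(ℝ, E)) x
  have closed {X : VField E M} (hX : SmoothFieldAt X x)
      (h : ∀ᶠ y in 𝓝 x, ∀ u v, g y (K y) u = 0 → g y (K y) v = 0 →
        g y (nabla g X y u) v = g y (nabla g X y v) u) :
      ∀ᶠ z in 𝓝 (extChartAt 𝓘(ℝ, E) x x), ∀ u v, chartForm g K x z u = 0 →
        chartForm g K x z v = 0 →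
        fderiv ℝ (chartForm g X x) z u v = fderiv ℝ (chartForm g X x) z v u := by
    filter_upwards [htgt, ht.eventually hg.eventually, ht.eventually h,
      hg.eventually_fderiv_chartForm hX] with z hz hgz hz1 hz2 u v hu hv
    have hs := (extChartAt 𝓘(ℝ, E) x).map_target hz
    rw [extChartAt_source] at hs
    have h4 := hz1 _ _ ((chartForm_apply hz u).symm.trans hu) ((chartForm_apply hz v).symm.trans hv)
    refine (hz2 u v).trans (Eq.trans ?_ (hz2 v u).symm)
    rw [h4, hgz.nabla_ext_comm hs u v]
  have h0 : chartForm g K x (extChartAt 𝓘(ℝ, E) x x) ≠ 0 := fun h ↦ by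
    refine hK0 (hg.nondegenerate x _ fun w ↦ ?_)
    have h3 := chartForm_apply (g := g) (X := K) (mem_extChartAt_target (I := 𝓘(ℝ, E)) x) w
    rw [h, extChartAt_to_inv, ext_apply_self] at h3
    exact h3.symm
  obtain ⟨f, hf, hfd⟩ := ConformalTractor.exists_potential
    (hg.eventually_contDiffAt_chartForm hK) (hg.eventually_contDiffAt_chartForm hY) h0
    (closed hK h1) (closed hY h2)
  have hφ : Tendsto (extChartAt 𝓘(ℝ, E) x) (𝓝 x) (𝓝 (extChartAt 𝓘(ℝ, E) x x)) :=
    continuousAt_extChartAt x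
  have hsrc : ∀ᶠ y in 𝓝 x, y ∈ (chartAt E x).source := chart_source_mem_nhds E x
  have hΥ : ∀ᶠ y in 𝓝 x, ContMDiffAt 𝓘(ℝ, E) 𝓘(ℝ, ℝ) ∞ (fun y ↦ f (extChartAt 𝓘(ℝ, E) x y)) y := by
    filter_upwards [hφ.eventually hf, hsrc] with y hy hys
    exact hy.contMDiffAt.comp y (contMDiffAt_extChartAt' hys)
  refine ⟨fun y ↦ f (extChartAt 𝓘(ℝ, E) x y), hΥ, ?_⟩
  filter_upwards [hφ.eventually hfd, hsrc, hΥ] with y hy hys hyΥ w hw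
  have hys' : y ∈ (extChartAt 𝓘(ℝ, E) x).source := by rwa [extChartAt_source]
  have hyt := (extChartAt 𝓘(ℝ, E) x).map_source hys'
  obtain ⟨v, rfl⟩ := exists_ext_eq hys w
  rw [dirDeriv_ext v hys (hyΥ.mdifferentiableAt (by simp))]
  have h4 : (fun z ↦ f (extChartAt 𝓘(ℝ, E) x ((extChartAt 𝓘(ℝ, E) x).symm z)))
      =ᶠ[𝓝 (extChartAt 𝓘(ℝ, E) x y)] f := by
    filter_upwards [extChartAt_target_mem_nhds' hyt] with z hz
    rw [(extChartAt 𝓘(ℝ, E) x).right_inv hz]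
  have h5 := chartForm_apply (g := g) (X := K) hyt v
  have h6 := chartForm_apply (g := g) (X := Y) hyt v
  rw [(extChartAt 𝓘(ℝ, E) x).left_inv hys'] at h5 h6
  rw [h4.fderiv_eq]
  refine (hy v (h5.trans hw)).trans ?_
  rw [h6]

/-! ### Adapted frames of a parallel null plane field -/

section Frame

variable {U : Set M} {H : (x : M) → Submodule ℝ (Tractor (E := E) x)}

theorem SmoothTractorAt.eventually {s : TractorField E M} (hs : SmoothTractorAt s x) :
    ∀ᶠ y in 𝓝 x, SmoothTractorAt s y := by
  filter_upwards [hs.1.eventually, hs.2.1.eventually, hs.2.2.eventually] with y h1 h2 h3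
  exact ⟨h1, h2, h3⟩

theorem IsParallelNullPlaneOn.mono (h : IsParallelNullPlaneOn g U H) {V : Set M} (hV : IsOpen V)
    (hVU : V ⊆ U) : IsParallelNullPlaneOn g V H where
  plane x hx := by
    obtain ⟨W, s, t, hW, hxW, -, hs, ht, hst⟩ := h.plane x (hVU hx)
    have hs' {r : TractorField E M} (hr : SmoothTractorOn W r) : SmoothTractorOn (W ∩ V) r :=
      ⟨hr.1.mono Set.inter_subset_left, hr.2.1.mono Set.inter_subset_left,
        hr.2.2.mono Set.inter_subset_left⟩
    exact ⟨W ∩ V, s, t, hW.inter hV, ⟨hxW, hx⟩, Set.inter_subset_right, hs' hs, hs' ht,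
      fun y hy ↦ hst y hy.1⟩
  null x hx := h.null x (hVU hx)
  parallel W s hW hWV := h.parallel W s hW (hWV.trans hVU)

theorem IsParallelNullPlaneOn.tractorNabla_mem (h : IsParallelNullPlaneOn g U H) (hU : IsOpen U)
    (hx : x ∈ U) {s : TractorField E M} (hs : SmoothTractorAt s x)
    (hsH : ∀ᶠ y in 𝓝 x, s y ∈ H y) (v : TangentSpace 𝓘(ℝ, E) x) : tractorNabla g s x v ∈ H x := by
  obtain ⟨V, hV, hVo, hxV⟩ := _root_.eventually_nhds_iff.1
    ((hs.eventually.and hsH).and (hU.mem_nhds hx))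
  exact h.parallel V s hVo (fun y hy ↦ (hV y hy).2)
    (smoothTractorOn_of_forall fun y hy ↦ (hV y hy).1.1) (fun y hy ↦ (hV y hy).1.2) x hxV v

/-- At the points of a dense set, the planes of a parallel plane field contain tractors with
`σ ≠ 0`: where `σ` vanishes on `H`, the component `dσ(v) - g(v, X) = -g(v, X)` of the derivative of
a section shows that `X` vanishes on `H`, too, and this leaves only a line. -/
theorem IsParallelNullPlaneOn.dense_sigma_ne_zero (hg : ∀ x, MetricAt g x)
    (h : IsParallelNullPlaneOn g U H) (hU : IsOpen U) (hUd : Dense U) :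
    Dense {x | x ∈ U ∧ ∃ s ∈ H x, s.2.2 ≠ 0} := by
  rw [dense_iff_inter_open]
  intro W hW hWne
  by_contra hempty
  obtain ⟨x, hxW, hxU⟩ := hUd.inter_open_nonempty W hW hWne
  have h0 : ∀ y ∈ W ∩ U, ∀ s ∈ H y, s.2.2 = 0 := fun y hy s hs ↦ by
    by_contra hne
    exact hempty ⟨y, hy.1, hy.2, s, hs, hne⟩
  have hWU : ∀ᶠ y in 𝓝 x, y ∈ W ∩ U := (hW.inter hU).mem_nhds ⟨hxW, hxU⟩
  obtain ⟨V, s, t, hV, hxV, hVU, hs, ht, hst⟩ := h.plane x hxU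
  have hX {r : TractorField E M} (hr : SmoothTractorOn V r) (hrH : ∀ y ∈ V, r y ∈ H y) :
      (r x).2 = 0 := by
    refine Prod.ext ((hg x).nondegenerate x _ fun v ↦ ?_) (h0 x ⟨hxW, hxU⟩ _ (hrH x hxV))
    have h1 := h0 x ⟨hxW, hxU⟩ _ (h.parallel V r hV hVU hr hrH x hxV v)
    have h2 : dirDeriv (fun y ↦ (r y).2.2) x v = 0 := by
      rw [dirDeriv_congr (f' := fun _ ↦ 0), dirDeriv_const]
      filter_upwards [hWU, hV.mem_nhds hxV] with y hy hyV
      exact h0 y hy _ (hrH y hyV)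
    simp only [tractorNabla, h2, zero_sub, neg_eq_zero] at h1
    rw [(hg x).symm]
    exact h1
  have hsx := hX hs fun y hy ↦ by
    rw [(hst y hy).2]; exact Submodule.subset_span (Set.mem_insert _ _)
  have htx := hX ht fun y hy ↦ by
    rw [(hst y hy).2]; exact Submodule.subset_span (Set.mem_insert_of_mem _ rfl)
  have hli := (hst x hxV).1
  rw [LinearIndependent.pair_iff] at hli
  have h1 := hli (t x).1 (-(s x).1) (Prod.ext (by simp [mul_comm]) (by simp [hsx, htx]))
  have h2 := hli 1 0 (Prod.ext (by simpa using h1.2) (by simp [hsx]))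
  exact one_ne_zero h2.1

/-- Near a point where `σ` does not vanish on `H`, there is a smooth frame `(ρ, K, 0)`,
`(α, Y, 1)` of `H`. -/
theorem IsPlaneSubbundleOn.exists_frame (h : IsPlaneSubbundleOn U H) (hx : x ∈ U)
    (hσ : ∃ s ∈ H x, s.2.2 ≠ 0) : ∃ k t : TractorField E M, SmoothTractorAt k x ∧
      SmoothTractorAt t x ∧ ∀ᶠ y in 𝓝 x, (k y).2.2 = 0 ∧ (t y).2.2 = 1 ∧ k y ≠ 0 ∧
        H y = Submodule.span ℝ {k y, t y} := by
  obtain ⟨V, s, t, hV, hxV, hVU, hs, ht, hst⟩ := h x hx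
  wlog ht0 : (t x).2.2 ≠ 0 generalizing s t
  · push Not at ht0
    refine this t s ht hs (fun y hy ↦ ⟨?_, ?_⟩) ?_
    · have := (hst y hy).1
      rw [LinearIndependent.pair_iff] at this ⊢
      exact fun a b hab ↦ (this b a (by rw [add_comm, hab])).symm
    · rw [(hst y hy).2, Set.pair_comm]
    · intro hs0
      obtain ⟨r, hr, hr0⟩ := hσ
      rw [(hst x hxV).2, Submodule.mem_span_pair] at hr
      obtain ⟨a, b, rfl⟩ := hr
      exact hr0 (by simp [hs0, ht0])
  have hs' := SmoothTractorAt.of_smoothTractorOn hV hxV hs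
  have ht' := SmoothTractorAt.of_smoothTractorOn hV hxV ht
  have ht'' := SmoothTractorAt.smul (ht'.2.2.inv ht0) ht'
  refine ⟨_, _, hs'.sub (SmoothTractorAt.smul hs'.2.2 ht''), ht'', ?_⟩
  filter_upwards [hV.mem_nhds hxV, ht'.2.2.continuousAt.eventually_ne ht0] with y hyV hy0
  have hli := (hst y hyV).1
  rw [LinearIndependent.pair_iff] at hli
  refine ⟨?_, ?_, fun h0 ↦ ?_, ?_⟩
  · simp [inv_mul_cancel₀ hy0]
  · simp [inv_mul_cancel₀ hy0]
  · refine one_ne_zero (hli 1 (-((s y).2.2 * ((t y).2.2)⁻¹)) ?_).1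
    rw [← h0]
    module
  · rw [(hst y hyV).2]
    ext r
    simp only [Submodule.mem_span_pair]
    constructor
    · rintro ⟨a, b, rfl⟩
      refine ⟨a, b * (t y).2.2 + a * (s y).2.2, ?_⟩
      have h1 : t y = (t y).2.2 • ((t y).2.2)⁻¹ • t y := by
        rw [smul_smul, mul_inv_cancel₀ hy0, one_smul]
      conv_rhs => rw [h1]
      module
    · rintro ⟨a, b, rfl⟩
      exact ⟨a, (b - a * (s y).2.2) * ((t y).2.2)⁻¹, by module⟩

/-- If `Y + grad Υ` is a multiple of `K`, then the null plane spanned by `(ρ, K, 0)` and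
`(α, Y, 1)` is spanned by `(0, K, 0)` and `(0, 0, 1)` in the splitting given by `e^{2Υ} g`. -/
theorem MetricAt.mem_span_iff_changeSplitting (hg : MetricAt g x) {k t : Tractor (E := E) x}
    {c : ℝ} (hk : k.2.2 = 0) (ht : t.2.2 = 1) (hkk : tractorMetric g x k k = 0)
    (hkt : tractorMetric g x k t = 0) (htt : tractorMetric g x t t = 0)
    (hc : t.2.1 + grad g Υ x = c • k.2.1) (s : Tractor (E := E) x) :
    s ∈ Submodule.span ℝ {k, t} ↔ ∃ a b : ℝ, changeSplitting g Υ x s = (0, a • k.2.1, b) := by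
  have hY : t.2.1 = c • k.2.1 - grad g Υ x := by rw [← hc, add_sub_cancel_right]
  simp only [tractorMetric, hk, ht, hY, map_sub, map_smul, sub_apply, smul_apply, smul_eq_mul,
    zero_mul, mul_zero, one_mul, mul_one, add_zero, zero_add] at hkk hkt htt
  rw [hg.symm x k.2.1 (grad g Υ x)] at hkt htt
  have h1 : changeSplitting g Υ x k = Real.exp (-Υ x) • (0, k.2.1, 0) := by
    rw [hg.changeSplitting_eq, hk]
    refine Prod.ext ?_ (Prod.ext ?_ ?_)
    · simp only [Prod.smul_fst, smul_eq_mul]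
      linear_combination Real.exp (-Υ x) * (hkt - c * hkk)
    · simp
    · simp
  have h2 : changeSplitting g Υ x t
      = (0, (Real.exp (-Υ x) * c) • k.2.1, Real.exp (Υ x)) := by
    rw [hg.changeSplitting_eq, ht, one_smul, hc, smul_smul, hY, mul_one]
    refine Prod.ext ?_ (by simp only [mul_one])
    simp only [map_sub, map_smul, smul_eq_mul]
    linear_combination Real.exp (-Υ x) * (1 / 2 * htt - c ^ 2 / 2 * hkk)
  have h3 (a b : ℝ) : changeSplitting g Υ x (a • k + b • t)
      = (0, (Real.exp (-Υ x) * (a + b * c)) • k.2.1, b * Real.exp (Υ x)) := by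
    rw [← hg.splittingEquiv_apply, map_add, map_smul, map_smul, hg.splittingEquiv_apply,
      hg.splittingEquiv_apply, h1, h2]
    refine Prod.ext ?_ (Prod.ext ?_ ?_)
    · simp
    · simp only [Prod.snd_add, Prod.fst_add, Prod.smul_snd, Prod.smul_fst]
      module
    · simp
  have he : Real.exp (-Υ x) * Real.exp (Υ x) = 1 := by rw [← Real.exp_add]; simp
  rw [Submodule.mem_span_pair]
  constructor
  · rintro ⟨a, b, rfl⟩
    exact ⟨_, _, h3 a b⟩
  · rintro ⟨a, b, hab⟩
    refine ⟨Real.exp (Υ x) * a - b * Real.exp (-Υ x) * c, b * Real.exp (-Υ x),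
      (hg.splittingEquiv Υ).injective ?_⟩
    rw [hg.splittingEquiv_apply, hg.splittingEquiv_apply, hab, h3]
    refine Prod.ext rfl (Prod.ext ?_ ?_)
    · simp only
      congr 1
      linear_combination a * he
    · simp only
      linear_combination b * he

/-- Near a point where `σ` does not vanish on the parallel null plane field `H`, some metric in the
conformal class has `H` spanned by `(0, K, 0)` and `(0, 0, 1)` in its splitting. The parallel
transport equations of the frame `(ρ, K, 0)`, `(α, Y, 1)` say that `g(K, ·)` and `g(Y, ·)` are
closed on `K^⊥`, so that `Υ` is a potential of `-g(Y, ·)` along the leaves of `K^⊥`. -/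
theorem IsParallelNullPlaneOn.exists_scale (hg : ∀ x, MetricAt g x)
    (h : IsParallelNullPlaneOn g U H) (hU : IsOpen U) (hx : x ∈ U)
    (hσ : ∃ s ∈ H x, s.2.2 ≠ 0) : ∃ (Υ : M → ℝ) (K : VField E M), ∀ᶠ y in 𝓝 x,
      y ∈ U ∧ SmoothFnAt E Υ y ∧ SmoothFieldAt K y ∧ K y ≠ 0 ∧
      ∀ s : Tractor (E := E) y, s ∈ H y ↔ ∃ a b : ℝ, changeSplitting g Υ y s = (0, a • K y, b) := by
  obtain ⟨k, t, hk, ht, hkt⟩ := h.plane.exists_frame hx hσ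
  have hkH : ∀ᶠ y in 𝓝 x, k y ∈ H y := hkt.mono fun y hy ↦ by
    rw [hy.2.2.2]; exact Submodule.subset_span (Set.mem_insert _ _)
  have htH : ∀ᶠ y in 𝓝 x, t y ∈ H y := hkt.mono fun y hy ↦ by
    rw [hy.2.2.2]; exact Submodule.subset_span (Set.mem_insert_of_mem _ rfl)
  have hUx : ∀ᶠ y in 𝓝 x, y ∈ U := hU.mem_nhds hx
  have hnull : ∀ᶠ y in 𝓝 x, tractorMetric g y (k y) (k y) = 0 ∧
      tractorMetric g y (k y) (t y) = 0 ∧ tractorMetric g y (t y) (t y) = 0 := by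
    filter_upwards [hUx, hkH, htH] with y hy h1 h2
    exact ⟨h.null y hy _ h1 _ h1, h.null y hy _ h1 _ h2, h.null y hy _ h2 _ h2⟩
  have hK0 : ∀ᶠ y in 𝓝 x, (k y).2.1 ≠ 0 := by
    filter_upwards [hkt, hnull] with y ⟨h1, h2, h3, _⟩ ⟨_, h5, _⟩ h6
    refine h3 (Prod.ext ?_ (Prod.ext h6 h1))
    simpa [tractorMetric, h1, h2, h6] using h5
  have hKK : ∀ᶠ y in 𝓝 x, g y (k y).2.1 (k y).2.1 = 0 := by
    filter_upwards [hkt, hnull] with y ⟨h1, _⟩ ⟨h4, _⟩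
    simpa [tractorMetric, h1] using h4
  obtain ⟨Υ, hΥ, hΥd⟩ := (hg x).exists_potential hk.2.1 ht.2.1 hK0.self_of_nhds
    (by
      filter_upwards [hkH.eventually_nhds, hkt.eventually_nhds, hUx, hk.eventually] with
        y h1 h2 h3 h4
      have key : ∀ u v, g y (k y).2.1 u = 0 → g y (k y).2.1 v = 0 →
          g y (nabla g (fun y ↦ (k y).2.1) y u) v = -(k y).1 * g y u v := by
        intro u v hu hv
        have h5 := h.tractorNabla_mem hU h3 h4 h1 u
        rw [h2.self_of_nhds.2.2.2, Submodule.mem_span_pair] at h5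
        obtain ⟨a, b, hab⟩ := h5
        have h6 : dirDeriv (fun y ↦ (k y).2.2) y u = 0 := by
          rw [dirDeriv_congr (f' := fun _ ↦ 0) (h2.mono fun z hz ↦ hz.1), dirDeriv_const]
        have h7 := congrArg (fun r ↦ r.2.2) hab
        have h8 := congrArg (fun r ↦ g y r.2.1 v) hab
        simp only [tractorNabla, h6, h2.self_of_nhds.1, h2.self_of_nhds.2.1, (hg y).symm y u, hu,
          Prod.snd_add, Prod.fst_add, Prod.smul_snd, Prod.smul_fst, smul_eq_mul] at h7 h8
        have hb : b = 0 := by linarith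
        simp only [hb, zero_smul, add_zero, map_add, map_smul, add_apply, smul_apply, smul_eq_mul,
          hv] at h8
        linear_combination -h8
      intro u v hu hv
      rw [key u v hu hv, key v u hv hu, (hg y).symm])
    (by
      filter_upwards [htH.eventually_nhds, hkt.eventually_nhds, hUx, ht.eventually] with
        y h1 h2 h3 h4
      have key : ∀ u v, g y (k y).2.1 u = 0 → g y (k y).2.1 v = 0 →
          g y (nabla g (fun y ↦ (t y).2.1) y u) v = -(t y).1 * g y u v - schouten g y u v
            - g y (t y).2.1 u * g y (t y).2.1 v := by
        intro u v hu hv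
        have h5 := h.tractorNabla_mem hU h3 h4 h1 u
        rw [h2.self_of_nhds.2.2.2, Submodule.mem_span_pair] at h5
        obtain ⟨a, b, hab⟩ := h5
        have h6 : dirDeriv (fun y ↦ (t y).2.2) y u = 0 := by
          rw [dirDeriv_congr (f' := fun _ ↦ 1) (h2.mono fun z hz ↦ hz.2.1), dirDeriv_const]
        have h7 := congrArg (fun r ↦ r.2.2) hab
        have h8 := congrArg (fun r ↦ g y r.2.1 v) hab
        simp only [tractorNabla, h6, h2.self_of_nhds.1, h2.self_of_nhds.2.1, (hg y).symm y u,
          Prod.snd_add, Prod.fst_add, Prod.smul_snd, Prod.smul_fst, smul_eq_mul] at h7 h8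
        have hb : b = -g y (t y).2.1 u := by linarith
        have h9 := (hg y).apply_raise ((hg y).schouten_isLinearMap u) v
        simp only [hb, map_add, map_smul, add_apply, smul_apply, smul_eq_mul, hv, one_smul,
          h9] at h8
        linear_combination -h8
      intro u v hu hv
      rw [key u v hu hv, key v u hv hu, (hg y).symm y u v, (hg y).schouten_symm u v]
      ring)
  refine ⟨Υ, fun y ↦ (k y).2.1, ?_⟩
  filter_upwards [hUx, hΥ.eventually, hk.2.1.eventually, hK0, hnull, hkt, hΥd, hKK]
    with y h1 h2 h3 h4 h5 h6 h7 h8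
  refine ⟨h1, h2, h3, h4, fun s ↦ ?_⟩
  obtain ⟨w, hw⟩ := (hg y).exists_apply_eq_one h4
  have hc : (t y).2.1 + grad g Υ y = g y ((t y).2.1 + grad g Υ y) w • (k y).2.1 := by
    refine (hg y).ext_left fun z ↦ ?_
    have h9 := h7 (z - g y (k y).2.1 z • w) (by
      rw [map_sub, map_smul, hw, smul_eq_mul, mul_one, sub_self])
    rw [← (hg y).apply_grad, map_sub, map_sub, map_smul, map_smul, smul_eq_mul, smul_eq_mul] at h9
    rw [map_smul, smul_apply, map_add, add_apply, add_apply, smul_eq_mul]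
    linear_combination h9
  rw [h6.2.2.2]
  exact (hg y).mem_span_iff_changeSplitting h6.1 h6.2.1 h5.1 h5.2.1 h5.2.2 hc s

end Frame

/-! ### Gluing local data over a dense open set -/

/-- A local property of sections that has local solutions near the points of a dense set has a
solution over a dense open set: the union of a maximal family of pairwise disjoint open sets over
which there are solutions. -/
theorem exists_dense_open_of_local {B : Type*} [TopologicalSpace B] {F : B → Type*}
    [∀ x, Nonempty (F x)] {Q : ((x : B) → F x) → B → Prop}
    (hQ : ∀ σ τ x, (∀ᶠ y in 𝓝 x, σ y = τ y) → Q σ x → Q τ x) {D : Set B} (hD : Dense D)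
    (hloc : ∀ x ∈ D, ∃ σ, ∀ᶠ y in 𝓝 x, Q σ y) :
    ∃ (U : Set B) (σ : (x : B) → F x), IsOpen U ∧ Dense U ∧ ∀ x ∈ U, Q σ x := by
  classical
  let Good : Set (Set (Set B)) := {𝒜 | (∀ W ∈ 𝒜, IsOpen W ∧ ∃ σ, ∀ x ∈ W, Q σ x) ∧
    𝒜.PairwiseDisjoint id}
  obtain ⟨𝒜, h𝒜, hmax⟩ := zorn_subset Good fun c hc hchain ↦ by
    refine ⟨⋃₀ c, ⟨fun W ⟨𝒜, h𝒜, hW⟩ ↦ (hc h𝒜).1 W hW, ?_⟩, fun s hs ↦ Set.subset_sUnion_of_mem hs⟩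
    exact (Set.pairwiseDisjoint_sUnion hchain.directedOn).2 fun 𝒜 h ↦ (hc h).2
  have hσ : ∀ W : 𝒜, ∃ σ, ∀ x ∈ W.1, Q σ x := fun W ↦ (h𝒜.1 W W.2).2
  choose σ hσ using hσ
  have huniq : ∀ W W' : 𝒜, ∀ x ∈ W.1, x ∈ W'.1 → W = W' := fun W W' x hx hx' ↦ by
    by_contra hne
    exact Set.disjoint_left.1 (h𝒜.2 W.2 W'.2 fun h ↦ hne (Subtype.ext h)) hx hx'
  refine ⟨⋃₀ 𝒜, fun x ↦ if hx : ∃ W : 𝒜, x ∈ W.1 then σ hx.choose x else Classical.arbitrary _,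
    isOpen_sUnion fun W hW ↦ (h𝒜.1 W hW).1, ?_, ?_⟩
  · rw [dense_iff_inter_open]
    intro O hO hOne
    by_contra hempty
    obtain ⟨x, hxO, hxD⟩ := hD.inter_open_nonempty O hO hOne
    obtain ⟨τ, hτ⟩ := hloc x hxD
    obtain ⟨V, hV, hVo, hxV⟩ := _root_.eventually_nhds_iff.1 (hτ.and (hO.mem_nhds hxO))
    have hdisj : ∀ W ∈ 𝒜, Disjoint V W := fun W hW ↦ Set.disjoint_left.2 fun y hy hyW ↦
      hempty ⟨y, (hV y hy).2, W, hW, hyW⟩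
    have hins : insert V 𝒜 ∈ Good := by
      refine ⟨fun W hW ↦ ?_, h𝒜.2.insert fun W hW _ ↦ hdisj W hW⟩
      rcases hW with rfl | hW
      · exact ⟨hVo, τ, fun y hy ↦ (hV y hy).1⟩
      · exact h𝒜.1 W hW
    have hV𝒜 : V ∈ 𝒜 := hmax hins (Set.subset_insert _ _) (Set.mem_insert _ _)
    exact hempty ⟨x, hxO, V, hV𝒜, hxV⟩
  · rintro x ⟨W, hW, hxW⟩
    refine hQ (σ ⟨W, hW⟩) _ x ?_ (hσ ⟨W, hW⟩ x hxW)
    filter_upwards [(h𝒜.1 W hW).1.mem_nhds hxW] with y hy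
    have hex : ∃ W : 𝒜, y ∈ W.1 := ⟨⟨W, hW⟩, hy⟩
    rw [dif_pos hex, huniq hex.choose ⟨W, hW⟩ y hex.choose_spec hy]

/-! ### The aligned pure radiation metric of a parallel null plane field -/

/-- Over a dense open set, a parallel null plane field is spanned by `(0, K, 0)` and `(0, 0, 1)` in
the splitting given by an aligned pure radiation metric. -/
theorem IsParallelNullPlaneOn.exists_isAlignedPureRadiationOn (hn : 2 < Module.finrank ℝ E)
    (hg : ∀ x, MetricAt g x) {U : Set M} {H : (x : M) → Submodule ℝ (Tractor (E := E) x)}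
    (h : IsParallelNullPlaneOn g U H) (hU : IsOpen U) (hUd : Dense U) :
    ∃ (U' : Set M) (Υ : M → ℝ) (K : VField E M), IsOpen U' ∧ Dense U' ∧
      ContMDiffOn 𝓘(ℝ, E) 𝓘(ℝ, ℝ) ∞ Υ U' ∧ IsAlignedPureRadiationOn U' (rescale Υ g) K ∧
      IsSpannedByRayOn g U' Υ K H := by
  obtain ⟨U', σ, hU', hU'd, hσ⟩ := exists_dense_open_of_local
    (F := fun x : M ↦ ℝ × TangentSpace 𝓘(ℝ, E) x)
    (Q := fun σ y ↦ y ∈ U ∧ SmoothFnAt E (fun z ↦ (σ z).1) y ∧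
      SmoothFieldAt (fun z ↦ (σ z).2) y ∧ (σ y).2 ≠ 0 ∧ ∀ s : Tractor (E := E) y,
        s ∈ H y ↔ ∃ a b : ℝ, changeSplitting g (fun z ↦ (σ z).1) y s = (0, a • (σ y).2, b))
    (by
      rintro σ τ x hστ ⟨h1, h2, h3, h4, h5⟩
      have he : (fun z ↦ (τ z).1) =ᶠ[𝓝 x] fun z ↦ (σ z).1 :=
        hστ.mono fun y hy ↦ congrArg Prod.fst hy.symm
      have hcs (s : Tractor (E := E) x) : changeSplitting g (fun z ↦ (τ z).1) x s
          = changeSplitting g (fun z ↦ (σ z).1) x s := by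
        have hd : dirDeriv (E := E) (fun z ↦ (τ z).1) x = dirDeriv (fun z ↦ (σ z).1) x :=
          funext fun v ↦ dirDeriv_congr he v
        simp only [changeSplitting, hd, he.self_of_nhds]
      refine ⟨h1, h2.congr he,
        h3.congr (hστ.mono fun y hy ↦ congrArg Prod.snd hy.symm), ?_, fun s ↦ ?_⟩
      · rw [← hστ.self_of_nhds]; exact h4
      · rw [hcs, ← hστ.self_of_nhds]; exact h5 s)
    (h.dense_sigma_ne_zero hg hU hUd)
    (fun x hx ↦ by
      obtain ⟨Υ, K, hΥK⟩ := h.exists_scale hg hU hx.1 hx.2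
      exact ⟨fun y ↦ (Υ y, K y), hΥK⟩)
  have hΥ : ContMDiffOn 𝓘(ℝ, E) 𝓘(ℝ, ℝ) ∞ (fun z ↦ (σ z).1) U' := fun x hx ↦
    (hσ x hx).2.1.contMDiffAt.contMDiffWithinAt
  have hsp : IsSpannedByRayOn g U' (fun z ↦ (σ z).1) (fun z ↦ (σ z).2) H := fun x hx ↦
    (hσ x hx).2.2.2.2
  exact ⟨U', fun z ↦ (σ z).1, fun z ↦ (σ z).2, hU', hU'd, hΥ,
    isAlignedPureRadiationOn_of_isParallelNullPlaneOn hn hg hU' hΥ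
      (fun x hx ↦ (hσ x hx).2.2.1.contMDiffAt.contMDiffWithinAt) (fun x hx ↦ (hσ x hx).2.2.2.1) hsp
      (h.mono hU' fun x hx ↦ (hσ x hx).1), hsp⟩

/-- The plane field is spanned by `(0, K, 0)` and `(0, 0, 1)` in the splitting given by the aligned
pure radiation metric. -/
theorem ContainsAlignedPureRadiation.admitsParallelNullPlane (hn : 2 < Module.finrank ℝ E)
    (hg : ∀ x, MetricAt g x) {U : Set M} (hU : IsOpen U) (h : ContainsAlignedPureRadiation g U) :
    AdmitsParallelNullPlane g U := by
  obtain ⟨Υ, K, hΥ, hK⟩ := h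
  let H : (x : M) → Submodule ℝ (Tractor (E := E) x) := fun x ↦
    (Submodule.span ℝ {(0, K x, 0), (0, 0, 1)}).comap
      ((hg x).splittingEquiv Υ : Tractor (E := E) x →ₗ[ℝ] Tractor (E := E) x)
  refine ⟨H, isParallelNullPlaneOn_of_isAlignedPureRadiationOn hn hg hU hΥ hK fun x _ s ↦ ?_⟩
  rw [Submodule.mem_comap, Submodule.mem_span_pair]
  refine exists_congr fun a ↦ exists_congr fun b ↦ ?_
  have h2 : a • ((0, K x, 0) : Tractor (E := E) x) + b • (0, 0, 1) = (0, a • K x, b) := by simp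
  rw [h2, eq_comm]
  rfl

end ConformalTractor

end

theorem theorem2 {E : Type*} [NormedAddCommGroup E] [NormedSpace ℝ E] [FiniteDimensional ℝ E]
    {M : Type*} [TopologicalSpace M] [T2Space M] [SecondCountableTopology M]
    [ChartedSpace E M] [IsManifold 𝓘(ℝ, E) ∞ M]
    (hn : 2 < Module.finrank ℝ E)
    (g : ConformalTractor.BilinField E M) (hg : ConformalTractor.IsPseudoRiemannian g) :
    -- the equivalence, on open dense subsets
    ((∃ V : Set M, IsOpen V ∧ Dense V ∧ ConformalTractor.AdmitsParallelNullPlane g V) ↔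
      ∃ U : Set M, IsOpen U ∧ Dense U ∧ ConformalTractor.ContainsAlignedPureRadiation g U) ∧
    -- the equivalence for planes that are defined on all of `M`
    (ConformalTractor.AdmitsParallelNullPlane g Set.univ ↔
      ∃ (U : Set M) (Υ : M → ℝ) (K : ConformalTractor.VField E M)
        (H : (x : M) → Submodule ℝ (ConformalTractor.Tractor (E := E) x)),
        IsOpen U ∧ Dense U ∧ ContMDiffOn 𝓘(ℝ, E) 𝓘(ℝ, ℝ) ∞ Υ U ∧
        ConformalTractor.IsAlignedPureRadiationOn U (ConformalTractor.rescale Υ g) K ∧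
        ConformalTractor.IsPlaneSubbundleOn Set.univ H ∧
        ConformalTractor.IsSpannedByRayOn g U Υ K H) ∧
    -- no extension is needed where the aligned pure radiation metric itself is defined
    (∀ U : Set M, IsOpen U → ConformalTractor.ContainsAlignedPureRadiation g U →
      ConformalTractor.AdmitsParallelNullPlane g U) := by
  have hm := hg.metricAt
  refine ⟨⟨?_, ?_⟩, ⟨?_, ?_⟩, fun U hU h ↦ h.admitsParallelNullPlane hn hm hU⟩
  · rintro ⟨V, hV, hVd, H, hH⟩
    obtain ⟨U, Υ, K, hU, hUd, hΥ, hK, -⟩ := hH.exists_isAlignedPureRadiationOn hn hm hV hVd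
    exact ⟨U, hU, hUd, Υ, K, hΥ, hK⟩
  · rintro ⟨U, hU, hUd, h⟩
    exact ⟨U, hU, hUd, h.admitsParallelNullPlane hn hm hU⟩
  · rintro ⟨H, hH⟩
    obtain ⟨U, Υ, K, hU, hUd, hΥ, hK, hs⟩ :=
      hH.exists_isAlignedPureRadiationOn hn hm isOpen_univ dense_univ
    exact ⟨U, Υ, K, H, hU, hUd, hΥ, hK, hH.plane, hs⟩
  · rintro ⟨U, Υ, K, H, hU, hUd, hΥ, hK, hH, hs⟩
    exact ⟨H, .extend hm hU hUd hH
      (ConformalTractor.isParallelNullPlaneOn_of_isAlignedPureRadiationOn hn hm hU hΥ hK hs)⟩
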